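/- Work on a RAM with unit-cost instructions, whose words hold integers of $O(\log n)$ bits or real numbers (on which only addition, subtraction and comparison are available). Let $G=(V,E)$ be a directed graph with $n$ vertices and $m$ edges, with positive real edge capacities $w$, a source $s$ and a sink $t\neq s$. An $(s,t)$-cut is a set $C\subseteq V$ with $s\in C$, $t\notin C$; its capacity is the total capacity of the edges leaving $C$, and it is an $(s,t)$-mincut if this is least possible. The Picard–Queyranne DAG $\mathcal D_{PQ}(H)$ of such a network $H$ is obtained from the residual graph of a maximum $(s,t)$-flow of $H$ by merging any two vertices that no $(s,t)$-mincut of $H$ separates and dropping loops; it is acyclic, and an $(s,t)$-cut is an $(s,t)$-mincut of $H$ if and only if it splits no node and no arc of $\mathcal D_{PQ}(H)$ leaves it. It is reported as the node of each vertex together with the list of all arcs with their capacities. There is a data structure for $G$ that occupies $O(n^2)$ words of space (including work space; each stored real is the total capacity of some set of edges of $G$) such that, given any edge $e\in E$ and any real $\Delta\ge -w(e)$, it reports for the network $G'$ obtained from $G$ by changing the capacity of $e$ from $w(e)$ to $w(e)+\Delta$: 1. the capacity of an $(s,t)$-mincut of $G'$ in $O(1)$ time; 2. an $(s,t)$-mincut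 $C$ of $G'$ in $O(|C|)$ time; 3. the DAG $\mathcal D_{PQ}(G')$, which occupies $O(m)$ space, in $O(m)$ time, provided that every vertex of $G$ is an endpoint of some edge (in general, in $O(m+i)$ space and time, where $i$ is the number of isolated vertices of $G$). The query algorithms are fixed programs, and all constants are absolute. -/

import Mathlib

/-! ## Networks, cuts, flows -/

/-- A directed weighted graph on the vertex set `{0, …, n-1}` with a designated source and a
designated sink. The edges are the ordered pairs of positive capacity. -/
structure STNetwork (n : ℕ) where
  cap : Fin n → Fin n → ℝ
  cap_nonneg : ∀ x y, 0 ≤ cap x y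
  source : Fin n
  sink : Fin n
  source_ne_sink : source ≠ sink

namespace STNetwork

variable {n : ℕ}

open Classical in
/-- The edge set `E`; its cardinality is `m`. -/
noncomputable def edges (G : STNetwork n) : Finset (Fin n × Fin n) :=
  Finset.univ.filter fun p => 0 < G.cap p.1 p.2

open Classical in
/-- The vertices that are not an endpoint of any edge. -/
noncomputable def isolated (G : STNetwork n) : Finset (Fin n) :=
  Finset.univ.filter fun v => ∀ p ∈ G.edges, p.1 ≠ v ∧ p.2 ≠ v

/-- The network obtained by changing the capacity of the pair `(u, v)` by `Δ`. -/
noncomputable def change (G : STNetwork n) (u v : Fin n) (Δ : ℝ) (h : -G.cap u v ≤ Δ) :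
    STNetwork n where
  cap x y := if x = u ∧ y = v then G.cap u v + Δ else G.cap x y
  cap_nonneg x y := by
    split_ifs
    · linarith
    · exact G.cap_nonneg x y
  source := G.source
  sink := G.sink
  source_ne_sink := G.source_ne_sink

/-- `C` is an `(s,t)`-cut. -/
def IsCut (G : STNetwork n) (C : Finset (Fin n)) : Prop :=
  G.source ∈ C ∧ G.sink ∉ C

/-- The total capacity of the edges that leave `C`. -/
noncomputable def cutCapacity (G : STNetwork n) (C : Finset (Fin n)) : ℝ :=
  ∑ x ∈ C, ∑ y ∈ Cᶜ, G.cap x y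

/-- `C` is an `(s,t)`-mincut. -/
def IsMincut (G : STNetwork n) (C : Finset (Fin n)) : Prop :=
  G.IsCut C ∧ ∀ C', G.IsCut C' → G.cutCapacity C ≤ G.cutCapacity C'

/-- `f` is an `(s,t)`-flow. -/
def IsFlow (G : STNetwork n) (f : Fin n → Fin n → ℝ) : Prop :=
  (∀ x y, 0 ≤ f x y ∧ f x y ≤ G.cap x y) ∧
  ∀ x, x ≠ G.source → x ≠ G.sink → ∑ y, f x y = ∑ y, f y x

/-- The value of a flow: the net flow out of the source. -/
noncomputable def flowValue (G : STNetwork n) (f : Fin n → Fin n → ℝ) : ℝ :=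
  ∑ y, f G.source y - ∑ y, f y G.source

/-- `f` is a maximum `(s,t)`-flow. -/
def IsMaxFlow (G : STNetwork n) (f : Fin n → Fin n → ℝ) : Prop :=
  G.IsFlow f ∧ ∀ g, G.IsFlow g → G.flowValue g ≤ G.flowValue f

open Classical in
/-- The arcs of the residual graph of the flow `f`, after every vertex `x` has been merged into
the node `node x` and loops have been dropped. An arc is a triple (tail, head, residual capacity);
an edge `(x, y)` gives a forward arc if it is not saturated, and a backward arc if it carries
flow. -/
noncomputable def contractedResidualArcs (G : STNetwork n) (f : Fin n → Fin n → ℝ)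
    (node : Fin n → ℕ) : Multiset (ℕ × ℕ × ℝ) :=
  ((Finset.univ.filter fun p : Fin n × Fin n =>
      node p.1 ≠ node p.2 ∧ f p.1 p.2 < G.cap p.1 p.2).val.map
        fun p => (node p.1, node p.2, G.cap p.1 p.2 - f p.1 p.2)) +
  ((Finset.univ.filter fun p : Fin n × Fin n =>
      node p.1 ≠ node p.2 ∧ 0 < f p.1 p.2).val.map
        fun p => (node p.2, node p.1, f p.1 p.2))

/-- The map `node` from vertices to (names of) nodes and the list `arcs` are the Picard–Queyranne
DAG of `G`: the residual graph of a maximum flow, in which two vertices are merged exactly when no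
mincut separates them. It is acyclic, and the mincuts are the `(s,t)`-cuts that split no node and
that no arc leaves. (The last two fields are consequences of the first two.) -/
structure IsPicardQueyranneDAG (G : STNetwork n) (node : Fin n → ℕ) (arcs : List (ℕ × ℕ × ℝ)) :
    Prop where
  node_eq_iff : ∀ x y, node x = node y ↔ ∀ C, G.IsMincut C → (x ∈ C ↔ y ∈ C)
  arcs_eq : ∃ f, G.IsMaxFlow f ∧ (arcs : Multiset (ℕ × ℕ × ℝ)) = G.contractedResidualArcs f node
  acyclic : ∀ i, ¬ Relation.TransGen (fun a b => ∃ c, (a, b, c) ∈ arcs) i i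
  mincut_iff : ∀ C, G.IsCut C → (G.IsMincut C ↔
    (∀ x y, node x = node y → (x ∈ C ↔ y ∈ C)) ∧
    ∀ x y c, (node x, node y, c) ∈ arcs → x ∈ C → y ∈ C)

end STNetwork

/-! ## The machine: a RAM with words of logarithmic size and with real registers -/

namespace RAM

/-- What stays fixed during a query: integers must be smaller than `wordBound`, the integer and
the real work memory have `workSize` cells each, and `ints`, `reals` are the cells of the (read-only)
data structure. -/
structure Machine where
  wordBound : ℕ
  workSize : ℕ
  ints : List ℕ
  reals : List ℝ

/-- Integer registers, real registers, integer and real work memory, and the output written so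
far. -/
structure State where
  ireg : ℕ → ℕ
  rreg : ℕ → ℝ
  imem : ℕ → ℕ
  rmem : ℕ → ℝ
  out : List (ℕ ⊕ ℝ)

/-- Instructions; all arguments are numbers of registers, except the constant in `iconst`. Memory
is addressed indirectly, through an integer register. -/
inductive Instr where
  | iconst (r k : ℕ)
  | iadd (r a b : ℕ)
  | isub (r a b : ℕ)
  | imul (r a b : ℕ)
  | idata (r a : ℕ)
  | iload (r a : ℕ)
  | istore (a r : ℕ)
  | radd (q a b : ℕ)
  | rsub (q a b : ℕ)
  | rdata (q a : ℕ)
  | rload (q a : ℕ)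
  | rstore (a q : ℕ)
  | iout (r : ℕ)
  | rout (q : ℕ)

/-- Write the integer `k` to the register `r`; an overflow is an error. -/
def State.setI (M : Machine) (σ : State) (r k : ℕ) : Option State :=
  if k < M.wordBound then some { σ with ireg := Function.update σ.ireg r k } else none

noncomputable def State.setR (σ : State) (q : ℕ) (x : ℝ) : State :=
  { σ with rreg := Function.update σ.rreg q x }

/-- The effect of one instruction; `none` is an error (an overflow, or an address out of range). -/
noncomputable def Instr.exec (M : Machine) (σ : State) : Instr → Option State
  | iconst r k => σ.setI M r k
  | iadd r a b => σ.setI M r (σ.ireg a + σ.ireg b)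
  | isub r a b => σ.setI M r (σ.ireg a - σ.ireg b)
  | imul r a b => σ.setI M r (σ.ireg a * σ.ireg b)
  | idata r a => M.ints[σ.ireg a]?.map fun k => { σ with ireg := Function.update σ.ireg r k }
  | iload r a =>
      if σ.ireg a < M.workSize then
        some { σ with ireg := Function.update σ.ireg r (σ.imem (σ.ireg a)) }
      else none
  | istore a r =>
      if σ.ireg a < M.workSize then
        some { σ with imem := Function.update σ.imem (σ.ireg a) (σ.ireg r) }
      else none
  | radd q a b => some (σ.setR q (σ.rreg a + σ.rreg b))
  | rsub q a b => some (σ.setR q (σ.rreg a - σ.rreg b))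
  | rdata q a => M.reals[σ.ireg a]?.map fun x => σ.setR q x
  | rload q a => if σ.ireg a < M.workSize then some (σ.setR q (σ.rmem (σ.ireg a))) else none
  | rstore a q =>
      if σ.ireg a < M.workSize then
        some { σ with rmem := Function.update σ.rmem (σ.ireg a) (σ.rreg q) }
      else none
  | iout r => some { σ with out := σ.out ++ [Sum.inl (σ.ireg r)] }
  | rout q => some { σ with out := σ.out ++ [Sum.inr (σ.rreg q)] }

/-- Tests: comparisons of two registers. -/
inductive Test where
  | ilt (a b : ℕ)
  | ieq (a b : ℕ)
  | rlt (a b : ℕ)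

def Test.Holds (σ : State) : Test → Prop
  | ilt a b => σ.ireg a < σ.ireg b
  | ieq a b => σ.ireg a = σ.ireg b
  | rlt a b => σ.rreg a < σ.rreg b

inductive Prog where
  | skip
  | instr (i : Instr)
  | seq (p q : Prog)
  | ite (c : Test) (p q : Prog)
  | loop (c : Test) (p : Prog)

/-- `Exec M p σ k τ`: started in `σ`, the program `p` halts without error in `τ` after exactly `k`
steps. Every instruction and every evaluation of a test is one step; `loop c p` is
"while `c` do `p`". -/
inductive Exec (M : Machine) : Prog → State → ℕ → State → Prop where
  | skip (σ) : Exec M .skip σ 0 σ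
  | instr {i σ τ} : i.exec M σ = some τ → Exec M (.instr i) σ 1 τ
  | seq {p q σ τ υ j k} : Exec M p σ j τ → Exec M q τ k υ → Exec M (.seq p q) σ (j + k) υ
  | ite_true {c p q σ τ k} : c.Holds σ → Exec M p σ k τ → Exec M (.ite c p q) σ (k + 1) τ
  | ite_false {c p q σ τ k} : ¬ c.Holds σ → Exec M q σ k τ → Exec M (.ite c p q) σ (k + 1) τ
  | loop_true {c p σ τ υ j k} : c.Holds σ → Exec M p σ j τ → Exec M (.loop c p) τ k υ →
      Exec M (.loop c p) σ (j + k + 1) υ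
  | loop_false {c p σ} : ¬ c.Holds σ → Exec M (.loop c p) σ 1 σ

end RAM

/-! ## Data structures and queries -/

/-- The content of a data structure: cells that hold integers and cells that hold reals. -/
structure OracleData where
  ints : List ℕ
  reals : List ℝ

namespace OracleData

/-- The machine on which queries for `n`-vertex graphs run: integers are smaller than `n ^ K`, that
is, have `O(log n)` bits, and the work memory has `O(n²)` cells. -/
def machine (D : OracleData) (n K : ℕ) : RAM.Machine where
  wordBound := n ^ K
  workSize := K * n ^ 2
  ints := D.ints
  reals := D.reals

/-- `D` occupies at most `K * n ^ 2` words; each is an integer of `O(log n)` bits or the total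
capacity of a set of edges of `G` (so that reals cannot be used to smuggle in other
information). -/
def FitsQuadraticSpace {n : ℕ} (D : OracleData) (G : STNetwork n) (K : ℕ) : Prop :=
  D.ints.length + D.reals.length ≤ K * n ^ 2 ∧
  (∀ k ∈ D.ints, k < n ^ K) ∧
  ∀ x ∈ D.reals, ∃ S ⊆ G.edges, x = ∑ p ∈ S, G.cap p.1 p.2

/-- With the data structure `D`, the program `p` started in `σ` halts after `k` steps with
output `o`. -/
def Answers (D : OracleData) (n K : ℕ) (p : RAM.Prog) (σ : RAM.State)
    (k : ℕ) (o : List (ℕ ⊕ ℝ)) : Prop :=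
  ∃ τ, RAM.Exec (D.machine n K) p σ k τ ∧ τ.out = o

end OracleData

/-- `σ` is a start state for the query `((u, v), Δ)`: the query is given in the integer registers
0 and 1 and the real register 0, and nothing has been written yet. The other registers and the work
memory hold arbitrary values, for instance those left by earlier queries. -/
def IsQueryState {n : ℕ} (σ : RAM.State) (u v : Fin n) (Δ : ℝ) : Prop :=
  σ.ireg 0 = u ∧ σ.ireg 1 = v ∧ σ.rreg 0 = Δ ∧ σ.out = []

/-- A single real number as an output. -/
def encodeReal (x : ℝ) : List (ℕ ⊕ ℝ) := [Sum.inr x]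

/-- A list of vertices as an output. -/
def encodeVertices {n : ℕ} (L : List (Fin n)) : List (ℕ ⊕ ℝ) := L.map fun v => Sum.inl (v : ℕ)

/-- A DAG as an output: the nodes of the vertices `0, …, n-1`, then all arcs with capacities. -/
def encodeDAG {n : ℕ} (node : Fin n → ℕ) (arcs : List (ℕ × ℕ × ℝ)) : List (ℕ ⊕ ℝ) :=
  (List.ofFn fun v => Sum.inl (node v)) ++
    arcs.flatMap fun a => [Sum.inl a.1, Sum.inl a.2.1, Sum.inr a.2.2]

/-!
The mincuts of the network `G'` that arises from `G` by a change of the capacity of one edge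
`(u, v)` are the least cuts of `G` among those that the edge does not leave (`avoidingMincuts`), the
least ones among those that it leaves (`leavingMincuts`), or both; a comparison of the two least
capacities tells which (`outcome`). To report the Picard–Queyranne DAG it is enough to know a
labelling of the vertices in which every inequality `label x < label y` is witnessed by a mincut
that contains `x` but not `y`, and in which vertices that a mincut separates have different labels
(`IsLabelOf`). Indeed, for every maximum flow, the edges that leave a mincut are saturated and
those that enter it carry no flow, so the labels alone tell which residual arc an edge contributes
(`isPicardQueyranneDAG_of_label`). Any set of cuts has such a labelling (`exists_label`), and
several labellings can be combined lexicographically (`isLabelOf_combine`). The point is that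
`O(n)` labellings and `O(n)` vertex sets are enough for all edges together.

For the cuts that `(u, v)` does not leave this is easy: such a cut either lacks `u` or contains `v`,
so the `2 n` families of the least cuts without a given vertex and of the least cuts with a given
vertex do (`exists_avoiding_labels`).

The cuts that `(u, v)` leaves matter only if the edge is weakly vital, that is, if some of them
becomes a mincut when the edge is removed. By submodularity no vital edge enters a least cut that
another weakly vital edge leaves (`IsWeaklyVital.isAdmissible`). The cuts which no vital edge enters
form a lattice, and among them the least capacity that separates two vertices is a symmetric
ultrametric (`min_sepCapacity_le`). If it is attained, for the end vertices of `(u, v)`, by the cuts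
that the edge leaves (regular edges; all vital edges are regular), then these cuts fall into those
without and those with the root of their ultrametric ball. The former are the cuts in one of `n`
lattices that lie in a certain greatest cut (`IsRegular.exists_rootlessFamily`), and at most `n`
greatest cuts occur, since their incidence vectors against the edges form a triangular matrix
(`card_le_of_triangular`, `exists_table_of_greatest`); the latter are treated by reversing the
network. So a labelling of the lattice, made constant outside the greatest cut, describes the cuts
of the edge (`exists_rootless_tables`, `exists_rooted_tables`). An irregular edge needs attention
only when its capacity is lowered to zero, and then both kinds of cuts are mincuts. If a mincut of
`G` separates its end vertices, uncrossing shows that the avoiding cuts alone separate everything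
(`exists_avoiding_separates`); and there are only `O(n)` other irregular edges, again by a triangular
matrix (`exists_irregular_table`).

`exists_isMincutTable` collects the tables and `IsMincutTable.exists_records` the pointers into
them, one record for each edge and outcome. The query programs look up the record, and compute the
labels of the vertices from it.
-/

/-! ### Maximum flows and minimum cuts -/

namespace STNetwork

variable {n : ℕ}

/-- The net flow across any cut is the value of the flow. -/
theorem flowValue_eq_across (G : STNetwork n) {f : Fin n → Fin n → ℝ} (hf : G.IsFlow f)
    {C : Finset (Fin n)} (hC : G.IsCut C) :
    G.flowValue f = ∑ x ∈ C, ∑ y ∈ Cᶜ, (f x y - f y x) := by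
  have h1 : ∑ x ∈ C, (∑ y, f x y - ∑ y, f y x) = G.flowValue f := by
    rw [Finset.sum_eq_single_of_mem G.source hC.1]
    · rfl
    · intro x hx hxs
      rw [hf.2 x hxs (fun h => hC.2 (h ▸ hx)), sub_self]
  have h2 : ∑ x ∈ C, ∑ y ∈ C, (f x y - f y x) = 0 := by
    have : ∑ x ∈ C, ∑ y ∈ C, f x y = ∑ x ∈ C, ∑ y ∈ C, f y x := Finset.sum_comm
    simp only [Finset.sum_sub_distrib]
    linarith
  rw [← h1, ← zero_add (∑ x ∈ C, ∑ y ∈ Cᶜ, _), ← h2, ← Finset.sum_add_distrib]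
  refine Finset.sum_congr rfl fun x _ => ?_
  rw [Finset.sum_add_sum_compl, Finset.sum_sub_distrib]

theorem flowValue_le_cutCapacity (G : STNetwork n) {f : Fin n → Fin n → ℝ} (hf : G.IsFlow f)
    {C : Finset (Fin n)} (hC : G.IsCut C) : G.flowValue f ≤ G.cutCapacity C := by
  rw [G.flowValue_eq_across hf hC]
  refine Finset.sum_le_sum fun x _ => Finset.sum_le_sum fun y _ => ?_
  linarith [(hf.1 x y).2, (hf.1 y x).1]

/-- The value of a flow reaches the capacity of a cut exactly when the flow saturates the edges
that leave the cut and vanishes on those that enter it. -/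
theorem flowValue_eq_cutCapacity_iff (G : STNetwork n) {f : Fin n → Fin n → ℝ} (hf : G.IsFlow f)
    {C : Finset (Fin n)} (hC : G.IsCut C) : G.flowValue f = G.cutCapacity C ↔
      ∀ x ∈ C, ∀ y ∉ C, f x y = G.cap x y ∧ f y x = 0 := by
  rw [G.flowValue_eq_across hf hC]
  have hle : ∀ x y, f x y - f y x ≤ G.cap x y := fun x y => by
    linarith [(hf.1 x y).2, (hf.1 y x).1]
  rw [cutCapacity, Finset.sum_eq_sum_iff_of_le
    fun x _ => Finset.sum_le_sum fun y _ => hle x y]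
  refine forall₂_congr fun x _ => ?_
  rw [Finset.sum_eq_sum_iff_of_le fun y _ => hle x y]
  simp only [Finset.mem_compl]
  refine forall₂_congr fun y _ => ?_
  have h1 := hf.1 x y
  have h2 := hf.1 y x
  constructor
  · intro h; constructor <;> linarith [h1.2, h2.1]
  · rintro ⟨h, h'⟩; rw [h, h', sub_zero]

theorem exists_isMaxFlow (G : STNetwork n) : ∃ f, G.IsMaxFlow f := by
  have hclosed : IsClosed {f : Fin n → Fin n → ℝ | G.IsFlow f} := by
    have : {f : Fin n → Fin n → ℝ | G.IsFlow f} =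
        (⋂ x, ⋂ y, {f | 0 ≤ f x y} ∩ {f | f x y ≤ G.cap x y}) ∩
        ⋂ x, ⋂ (_ : x ≠ G.source), ⋂ (_ : x ≠ G.sink),
          {f | ∑ y, f x y = ∑ y, f y x} := by
      ext f; simp [IsFlow]
    rw [this]
    refine IsClosed.inter ?_ ?_
    · refine isClosed_iInter fun x => isClosed_iInter fun y => IsClosed.inter ?_ ?_
      · exact isClosed_le continuous_const (by fun_prop)
      · exact isClosed_le (by fun_prop) continuous_const
    · refine isClosed_iInter fun x => isClosed_iInter fun _ => isClosed_iInter fun _ => ?_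
      exact isClosed_eq (by fun_prop) (by fun_prop)
  have hcomp : IsCompact {f : Fin n → Fin n → ℝ | G.IsFlow f} := by
    refine IsCompact.of_isClosed_subset
      (isCompact_Icc (a := (fun _ _ => 0 : Fin n → Fin n → ℝ)) (b := G.cap)) hclosed ?_
    intro f hf
    exact ⟨fun x y => (hf.1 x y).1, fun x y => (hf.1 x y).2⟩
  have hne : {f : Fin n → Fin n → ℝ | G.IsFlow f}.Nonempty :=
    ⟨fun _ _ => 0, fun x y => ⟨le_rfl, G.cap_nonneg x y⟩, fun _ _ _ => rfl⟩
  have hcont : Continuous fun f : Fin n → Fin n → ℝ => G.flowValue f := by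
    unfold flowValue; fun_prop
  obtain ⟨f, hf, hmax⟩ := hcomp.exists_isMaxOn hne hcont.continuousOn
  exact ⟨f, hf, fun g hg => hmax hg⟩

/-- `d` is a direction in which the flow values may be changed slightly without violating the
capacity constraints. These directions form a convex cone, which is why augmentation along a path
can be carried out one arc at a time. -/
def IsFeasibleDirection (G : STNetwork n) (f d : Fin n → Fin n → ℝ) : Prop :=
  ∀ x y, (f x y = G.cap x y → d x y ≤ 0) ∧ (f x y = 0 → 0 ≤ d x y)

/-- `(x, y)` is an arc of the residual graph of `f`. -/
def IsResidualArc (G : STNetwork n) (f : Fin n → Fin n → ℝ) (x y : Fin n) : Prop :=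
  f x y < G.cap x y ∨ 0 < f y x

theorem exists_feasibleDirection_of_reachable (G : STNetwork n) {f : Fin n → Fin n → ℝ} {a x : Fin n}
    (h : Relation.ReflTransGen (G.IsResidualArc f) a x) :
    ∃ d, G.IsFeasibleDirection f d ∧
      ∀ z, ∑ y, d z y - ∑ y, d y z = (if z = a then 1 else 0) - (if z = x then 1 else 0) := by
  classical
  induction h with
  | refl => exact ⟨fun _ _ => 0, fun _ _ => ⟨fun _ => le_rfl, fun _ => le_rfl⟩, by simp⟩
  | @tail x y _ hxy ih =>
    obtain ⟨d, hd, hdiv⟩ := ih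
    rcases hxy with hxy | hxy
    · refine ⟨fun p q => d p q + if p = x ∧ q = y then 1 else 0, ?_, ?_⟩
      · intro p q
        refine ⟨fun h => ?_, fun h => ?_⟩
        · have : ¬ (p = x ∧ q = y) := by rintro ⟨rfl, rfl⟩; exact hxy.ne h
          simpa [this] using (hd p q).1 h
        · have := (hd p q).2 h
          dsimp only; split_ifs <;> linarith
      · intro z
        have h1 : ∑ q, (if z = x ∧ q = y then (1:ℝ) else 0) = if z = x then 1 else 0 := by
          by_cases hz : z = x <;> simp [hz]
        have h2 : ∑ p, (if p = x ∧ z = y then (1:ℝ) else 0) = if z = y then 1 else 0 := by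
          by_cases hz : z = y <;> simp [hz]
        simp only [Finset.sum_add_distrib, h1, h2]
        linarith [hdiv z]
    · refine ⟨fun p q => d p q - if p = y ∧ q = x then 1 else 0, ?_, ?_⟩
      · intro p q
        refine ⟨fun h => ?_, fun h => ?_⟩
        · have := (hd p q).1 h
          dsimp only; split_ifs <;> linarith
        · have : ¬ (p = y ∧ q = x) := by rintro ⟨rfl, rfl⟩; exact hxy.ne' h
          simpa [this] using (hd p q).2 h
      · intro z
        have h1 : ∑ q, (if z = y ∧ q = x then (1:ℝ) else 0) = if z = y then 1 else 0 := by
          by_cases hz : z = y <;> simp [hz]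
        have h2 : ∑ p, (if p = y ∧ z = x then (1:ℝ) else 0) = if z = x then 1 else 0 := by
          by_cases hz : z = x <;> simp [hz]
        simp only [Finset.sum_sub_distrib, h1, h2]
        linarith [hdiv z]

open Filter Topology in
theorem not_reachable_sink_of_isMaxFlow (G : STNetwork n) {f : Fin n → Fin n → ℝ}
    (hf : G.IsMaxFlow f) : ¬ Relation.ReflTransGen (G.IsResidualArc f) G.source G.sink := by
  intro h
  obtain ⟨d, hd, hdiv⟩ := G.exists_feasibleDirection_of_reachable h
  have key : ∀ᶠ ε : ℝ in 𝓝[>] 0, ∀ x y, 0 ≤ f x y + ε * d x y ∧ f x y + ε * d x y ≤ G.cap x y := by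
    refine eventually_all.2 fun x => eventually_all.2 fun y => ?_
    have hlim : Tendsto (fun ε : ℝ => f x y + ε * d x y) (𝓝[>] 0) (𝓝 (f x y)) := by
      have : Tendsto (fun ε : ℝ => f x y + ε * d x y) (𝓝 0) (𝓝 (f x y + 0 * d x y)) :=
        (Continuous.tendsto (by fun_prop) 0)
      rw [zero_mul, add_zero] at this
      exact this.mono_left nhdsWithin_le_nhds
    have hpos : ∀ᶠ ε : ℝ in 𝓝[>] 0, 0 < ε := self_mem_nhdsWithin
    refine Filter.Eventually.and ?_ ?_
    · rcases (hf.1.1 x y).1.eq_or_lt with h0 | h0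
      · filter_upwards [hpos] with ε hε
        rw [← h0, zero_add]
        exact mul_nonneg hε.le ((hd x y).2 h0.symm)
      · filter_upwards [hlim.eventually (lt_mem_nhds h0)] with ε hε using hε.le
    · rcases (hf.1.1 x y).2.eq_or_lt with h0 | h0
      · filter_upwards [hpos] with ε hε
        rw [h0]
        nlinarith [(hd x y).1 h0]
      · filter_upwards [hlim.eventually (gt_mem_nhds h0)] with ε hε using hε.le
  obtain ⟨ε, hε, hεpos⟩ := (key.and (self_mem_nhdsWithin : ∀ᶠ ε : ℝ in 𝓝[>] 0, 0 < ε)).exists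
  have hout : ∀ z, ∑ y, (f z y + ε * d z y) - ∑ y, (f y z + ε * d y z) =
      (∑ y, f z y - ∑ y, f y z) + ε * (∑ y, d z y - ∑ y, d y z) := by
    intro z
    simp only [Finset.sum_add_distrib, ← Finset.mul_sum]
    ring
  have hflow : G.IsFlow fun x y => f x y + ε * d x y := by
    refine ⟨hε, fun x hs ht => ?_⟩
    have := hout x
    rw [hdiv, if_neg hs, if_neg ht, hf.1.2 x hs ht] at this
    linarith
  have hval := hf.2 _ hflow
  have := hout G.source
  rw [hdiv, if_pos rfl, if_neg G.source_ne_sink] at this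
  unfold flowValue at hval
  linarith [show (0:ℝ) < ε from hεpos]

/-- Max-flow min-cut: a maximum flow has the capacity of every mincut as its value. -/
theorem flowValue_eq_of_isMincut (G : STNetwork n) {f : Fin n → Fin n → ℝ} (hf : G.IsMaxFlow f)
    {C : Finset (Fin n)} (hC : G.IsMincut C) : G.flowValue f = G.cutCapacity C := by
  classical
  set R : Finset (Fin n) :=
    Finset.univ.filter fun x => Relation.ReflTransGen (G.IsResidualArc f) G.source x with hR
  have hRcut : G.IsCut R := by
    constructor
    · simpa [hR] using Relation.ReflTransGen.refl
    · simpa [hR] using G.not_reachable_sink_of_isMaxFlow hf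
  have hRval : G.flowValue f = G.cutCapacity R := by
    rw [G.flowValue_eq_cutCapacity_iff hf.1 hRcut]
    intro x hx y hy
    simp only [hR, Finset.mem_filter, Finset.mem_univ, true_and] at hx hy
    have hno : ¬ G.IsResidualArc f x y := fun h => hy (hx.tail h)
    simp only [IsResidualArc, not_or, not_lt] at hno
    exact ⟨le_antisymm (hf.1.1 x y).2 hno.1, le_antisymm hno.2 (hf.1.1 y x).1⟩
  exact le_antisymm (G.flowValue_le_cutCapacity hf.1 hC.1) (hRval ▸ hC.2 R hRcut)

/-! ### The Picard–Queyranne DAG from a vertex labelling -/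

/-- `label` is compatible with a family of vertex sets: a vertex with a smaller label is split off
from one with a larger label by a member of the family. -/
def IsOrderedBy (𝓡 : Set (Finset (Fin n))) (label : Fin n → ℕ) : Prop :=
  ∀ x y, label x < label y → ∃ W ∈ 𝓡, x ∈ W ∧ y ∉ W

/-- The arc that the edge `p` contributes to the DAG whose nodes are given by `node`. -/
noncomputable def labelledArc (G : STNetwork n) (node : Fin n → ℕ) (p : Fin n × Fin n) : ℕ × ℕ × ℝ :=
  if node p.1 < node p.2 then (node p.2, node p.1, G.cap p.1 p.2)
  else (node p.1, node p.2, G.cap p.1 p.2)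

/-- A labelling whose order is realized by mincuts and which takes different values on vertices
separated by a mincut determines the whole DAG: an edge between different nodes is saturated or
empty in every maximum flow, and the labels of its ends tell which is the case. -/
theorem isPicardQueyranneDAG_of_label (G : STNetwork n) {node : Fin n → ℕ}
    (hord : IsOrderedBy {C | G.IsMincut C} node)
    (hsep : ∀ C, G.IsMincut C → ∀ x ∈ C, ∀ y ∉ C, node x ≠ node y)
    {arcs : List (ℕ × ℕ × ℝ)} {S : Finset (Fin n × Fin n)}
    (hS : ∀ p, p ∈ S ↔ node p.1 ≠ node p.2 ∧ 0 < G.cap p.1 p.2)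
    (harcs : (arcs : Multiset (ℕ × ℕ × ℝ)) = S.val.map (G.labelledArc node)) :
    G.IsPicardQueyranneDAG node arcs := by
  classical
  obtain ⟨f, hf⟩ := G.exists_isMaxFlow
  have hsat : ∀ C, G.IsMincut C → ∀ x ∈ C, ∀ y ∉ C, f x y = G.cap x y ∧ f y x = 0 := fun C hC =>
    (G.flowValue_eq_cutCapacity_iff hf.1 hC.1).1 (G.flowValue_eq_of_isMincut hf hC)
  have hlt : ∀ x y, node x < node y → f x y = G.cap x y ∧ f y x = 0 := by
    intro x y h
    obtain ⟨C, hC, hx, hy⟩ := hord x y h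
    exact hsat C hC x hx y hy
  have hnode : ∀ x y, node x = node y ↔ ∀ C, G.IsMincut C → (x ∈ C ↔ y ∈ C) := by
    intro x y
    constructor
    · intro h C hC
      by_contra hne
      by_cases hx : x ∈ C
      · exact hsep C hC x hx y (fun hy => hne ⟨fun _ => hy, fun _ => hx⟩) h
      · exact hsep C hC y (by tauto) x hx h.symm
    · intro h
      rcases lt_trichotomy (node x) (node y) with h' | h' | h'
      · obtain ⟨C, hC, hx, hy⟩ := hord x y h'
        exact absurd ((h C hC).1 hx) hy
      · exact h'
      · obtain ⟨C, hC, hx, hy⟩ := hord y x h'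
        exact absurd ((h C hC).2 hx) hy
  have hmem : ∀ a b c, (a, b, c) ∈ arcs ↔ ∃ p ∈ S, G.labelledArc node p = (a, b, c) := by
    intro a b c
    rw [← Multiset.mem_coe, harcs, Multiset.mem_map]
    rfl
  -- every arc is an arc of the residual graph, so no mincut leaves it
  have harc : ∀ a b, (∃ c, (a, b, c) ∈ arcs) → ∃ x y, node x = a ∧ node y = b ∧ a ≠ b ∧
      ∀ C, G.IsMincut C → x ∈ C → y ∈ C := by
    rintro a b ⟨c, hc⟩
    obtain ⟨p, hp, hpe⟩ := (hmem a b c).1 hc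
    obtain ⟨hne, hcap⟩ := (hS p).1 hp
    unfold labelledArc at hpe
    split_ifs at hpe with h
    · simp only [Prod.mk.injEq] at hpe
      refine ⟨p.2, p.1, hpe.1, hpe.2.1, ?_, fun C hC hx => ?_⟩
      · rw [← hpe.1, ← hpe.2.1]; exact hne.symm
      · by_contra hy
        have h1 := hsat C hC _ hx _ hy
        have h2 := hlt _ _ h
        linarith [h1.2, h2.1]
    · simp only [Prod.mk.injEq] at hpe
      refine ⟨p.1, p.2, hpe.1, hpe.2.1, ?_, fun C hC hx => ?_⟩
      · rw [← hpe.1, ← hpe.2.1]; exact hne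
      · by_contra hy
        have h1 := hsat C hC _ hx _ hy
        have h2 := hlt _ _ (lt_of_le_of_ne (not_lt.1 h) hne.symm)
        linarith [h1.1, h2.2]
  refine ⟨hnode, ⟨f, hf, ?_⟩, ?_, ?_⟩
  · rw [harcs, contractedResidualArcs]
    have h1 : (Finset.univ.filter fun p : Fin n × Fin n =>
        node p.1 ≠ node p.2 ∧ f p.1 p.2 < G.cap p.1 p.2) =
        S.filter fun p => ¬ node p.1 < node p.2 := by
      ext p
      simp only [Finset.mem_filter, Finset.mem_univ, true_and, hS]
      constructor
      · rintro ⟨h, h'⟩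
        exact ⟨⟨h, (hf.1.1 _ _).1.trans_lt h'⟩, fun h'' => h'.ne (hlt _ _ h'').1⟩
      · rintro ⟨⟨h, h'⟩, h''⟩
        refine ⟨h, ?_⟩
        rw [(hlt _ _ (lt_of_le_of_ne (not_lt.1 h'') h.symm)).2]
        exact h'
    have h2 : (Finset.univ.filter fun p : Fin n × Fin n =>
        node p.1 ≠ node p.2 ∧ 0 < f p.1 p.2) = S.filter fun p => node p.1 < node p.2 := by
      ext p
      simp only [Finset.mem_filter, Finset.mem_univ, true_and, hS]
      constructor
      · rintro ⟨h, h'⟩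
        refine ⟨⟨h, h'.trans_le (hf.1.1 _ _).2⟩, ?_⟩
        by_contra h''
        exact h'.ne' (hlt _ _ (lt_of_le_of_ne (not_lt.1 h'') h.symm)).2
      · rintro ⟨⟨h, h'⟩, h''⟩
        refine ⟨h, ?_⟩
        rw [(hlt _ _ h'').1]
        exact h'
    rw [h1, h2, add_comm]
    have hsplit := Multiset.filter_add_not (fun p : Fin n × Fin n => node p.1 < node p.2) S.val
    conv_lhs => rw [← hsplit, Multiset.map_add]
    rw [← Finset.filter_val, ← Finset.filter_val]
    congr 1
    · refine Multiset.map_congr rfl fun p hp => ?_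
      have hp' := (Finset.mem_filter.1 (Finset.mem_def.2 hp)).2
      rw [labelledArc, if_pos hp', (hlt _ _ hp').1]
    · refine Multiset.map_congr rfl fun p hp => ?_
      have hp' := Finset.mem_filter.1 (Finset.mem_def.2 hp)
      have hne := ((hS p).1 hp'.1).1
      rw [labelledArc, if_neg hp'.2,
        (hlt _ _ (lt_of_le_of_ne (not_lt.1 hp'.2) hne.symm)).2, sub_zero]
  · -- along a cycle no mincut could separate any two nodes, but the ends of an arc are separated
    have htrans : ∀ a b, Relation.TransGen (fun a b => ∃ c, (a, b, c) ∈ arcs) a b →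
        ∃ x y, node x = a ∧ node y = b ∧ ∀ C, G.IsMincut C → x ∈ C → y ∈ C := by
      intro a b h
      induction h with
      | single h =>
        obtain ⟨x, y, hx, hy, _, hC⟩ := harc _ _ h
        exact ⟨x, y, hx, hy, hC⟩
      | tail _ h ih =>
        obtain ⟨x, y, hx, hy, hC⟩ := ih
        obtain ⟨x', y', hx', hy', _, hC'⟩ := harc _ _ h
        refine ⟨x, y', hx, hy', fun C hmc hxC => hC' C hmc ?_⟩
        exact ((hnode y x').1 (hy.trans hx'.symm) C hmc).1 (hC C hmc hxC)
    intro i hi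
    cases hi with
    | single h =>
      obtain ⟨_, _, _, _, hne, _⟩ := harc _ _ h
      exact hne rfl
    | @tail b _ hib hbi =>
      obtain ⟨x, y, hx, hy, hC⟩ := htrans _ _ hib
      obtain ⟨x', y', hx', hy', hne, hC'⟩ := harc _ _ hbi
      refine hne (hx'.symm.trans (Eq.trans ?_ hy'))
      refine (hnode x' y').2 fun C hmc => ⟨hC' C hmc, fun h => ?_⟩
      have h1 := ((hnode y' x).1 (hy'.trans hx.symm) C hmc).1 h
      exact ((hnode y x').1 (hy.trans hx'.symm) C hmc).1 (hC C hmc h1)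
  · intro C hC
    constructor
    · intro hmc
      refine ⟨fun x y h => (hnode x y).1 h C hmc, fun x y c h hx => ?_⟩
      obtain ⟨x', y', hx', hy', _, hC'⟩ := harc _ _ ⟨c, h⟩
      exact ((hnode y' y).1 hy' C hmc).1 (hC' C hmc (((hnode x' x).1 hx' C hmc).2 hx))
    · rintro ⟨hcl, har⟩
      have hval : G.flowValue f = G.cutCapacity C := by
        rw [G.flowValue_eq_cutCapacity_iff hf.1 hC]
        intro x hx y hy
        have hne : node x ≠ node y := fun h => hy ((hcl x y h).1 hx)
        rcases lt_or_gt_of_ne hne with h | h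
        · exact hlt x y h
        · -- an edge against the order of the labels would be an arc that leaves `C`
          have hxy : ¬ 0 < G.cap x y := fun hcap => hy (har x y (G.cap x y)
            ((hmem _ _ _).2 ⟨(x, y), (hS _).2 ⟨hne, hcap⟩, if_neg (not_lt.2 h.le)⟩) hx)
          have hyx : ¬ 0 < G.cap y x := fun hcap => hy (har x y (G.cap y x)
            ((hmem _ _ _).2 ⟨(y, x), (hS _).2 ⟨hne.symm, hcap⟩, if_pos h⟩) hx)
          have h1 := hf.1.1 x y
          have h2 := hf.1.1 y x
          have h3 := G.cap_nonneg x y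
          constructor <;> linarith
      refine ⟨hC, fun C' hC' => ?_⟩
      rw [← hval]
      exact G.flowValue_le_cutCapacity hf.1 hC'

end STNetwork

/-! ### Submodularity and cuts that a given edge leaves -/

namespace STNetwork

variable {n : ℕ}

theorem cutCapacity_eq_sum (G : STNetwork n) (W : Finset (Fin n)) :
    G.cutCapacity W =
      ∑ p : Fin n × Fin n, if p.1 ∈ W ∧ p.2 ∉ W then G.cap p.1 p.2 else 0 := by
  rw [cutCapacity, Fintype.sum_prod_type, ← Finset.sum_ite_mem_eq]
  refine Finset.sum_congr rfl fun x _ => ?_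
  rw [← Finset.sum_ite_mem_eq]
  by_cases hx : x ∈ W <;> simp [hx]

/-- Submodularity of the cut capacity, with the terms that are lost by uncrossing: the edges of `T`
join the two differences of the sets. -/
theorem cutCapacity_inter_add_union_le (G : STNetwork n) (W C : Finset (Fin n))
    (T : Finset (Fin n × Fin n))
    (hT : ∀ p ∈ T, (p.1 ∈ W ∧ p.1 ∉ C ∧ p.2 ∉ W ∧ p.2 ∈ C) ∨
      (p.1 ∉ W ∧ p.1 ∈ C ∧ p.2 ∈ W ∧ p.2 ∉ C)) :
    G.cutCapacity (W ∩ C) + G.cutCapacity (W ∪ C) + ∑ p ∈ T, G.cap p.1 p.2 ≤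
      G.cutCapacity W + G.cutCapacity C := by
  simp only [cutCapacity_eq_sum]
  rw [← Finset.sum_ite_mem_eq T, ← Finset.sum_add_distrib, ← Finset.sum_add_distrib,
    ← Finset.sum_add_distrib]
  refine Finset.sum_le_sum fun p _ => ?_
  have h0 := G.cap_nonneg p.1 p.2
  have hp := hT p
  simp only [Finset.mem_inter, Finset.mem_union]
  by_cases h1 : p.1 ∈ W <;> by_cases h2 : p.1 ∈ C <;> by_cases h3 : p.2 ∈ W <;>
    by_cases h4 : p.2 ∈ C <;> by_cases h5 : p ∈ T <;>
    simp [h1, h2, h3, h4, h5] at hp ⊢ <;> linarith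

theorem submodular (G : STNetwork n) (W C : Finset (Fin n)) :
    G.cutCapacity (W ∩ C) + G.cutCapacity (W ∪ C) ≤ G.cutCapacity W + G.cutCapacity C := by
  simpa using G.cutCapacity_inter_add_union_le W C ∅ (by simp)

theorem submodular_of_edge (G : STNetwork n) {W C : Finset (Fin n)} {u v : Fin n}
    (hu : u ∈ C) (hu' : u ∉ W) (hv : v ∈ W) (hv' : v ∉ C) :
    G.cutCapacity (W ∩ C) + G.cutCapacity (W ∪ C) + G.cap u v ≤
      G.cutCapacity W + G.cutCapacity C := by
  simpa using G.cutCapacity_inter_add_union_le W C {(u, v)} (by simp [*])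

theorem submodular_of_two_edges (G : STNetwork n) {W C : Finset (Fin n)} {u v u' v' : Fin n}
    (hu : u ∈ C) (hu' : u ∉ W) (hv : v ∈ W) (hv' : v ∉ C)
    (h1 : u' ∈ W) (h2 : u' ∉ C) (h3 : v' ∈ C) (h4 : v' ∉ W) :
    G.cutCapacity (W ∩ C) + G.cutCapacity (W ∪ C) + (G.cap u v + G.cap u' v') ≤
      G.cutCapacity W + G.cutCapacity C := by
  have hne : (u, v) ≠ (u', v') := fun h => by
    have h' : u = u' := congrArg Prod.fst h
    exact hu' (h' ▸ h1)
  have := G.cutCapacity_inter_add_union_le W C {(u, v), (u', v')} (by simp [*])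
  rwa [Finset.sum_pair hne] at this

theorem IsCut.inter {G : STNetwork n} {W C : Finset (Fin n)} (hW : G.IsCut W) (hC : G.IsCut C) :
    G.IsCut (W ∩ C) :=
  ⟨Finset.mem_inter.2 ⟨hW.1, hC.1⟩, fun h => hW.2 (Finset.mem_inter.1 h).1⟩

theorem IsCut.union {G : STNetwork n} {W C : Finset (Fin n)} (hW : G.IsCut W) (hC : G.IsCut C) :
    G.IsCut (W ∪ C) :=
  ⟨Finset.mem_union_left _ hW.1, fun h => (Finset.mem_union.1 h).elim hW.2 hC.2⟩

/-- A cut of least capacity among those with the property `P`. -/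
theorem exists_cut_min (G : STNetwork n) (P : Finset (Fin n) → Prop)
    (h : ∃ W, G.IsCut W ∧ P W) :
    ∃ W, (G.IsCut W ∧ P W) ∧ ∀ W', G.IsCut W' → P W' → G.cutCapacity W ≤ G.cutCapacity W' := by
  classical
  obtain ⟨W₀, h₀⟩ := h
  obtain ⟨W, hW, hmin⟩ := Finset.exists_min_image
    (Finset.univ.filter fun W => G.IsCut W ∧ P W) G.cutCapacity ⟨W₀, by simpa using h₀⟩
  refine ⟨W, by simpa using hW, fun W' h1 h2 => hmin W' (by simpa using ⟨h1, h2⟩)⟩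

theorem exists_isMincut (G : STNetwork n) : ∃ C, G.IsMincut C := by
  obtain ⟨W, hW, hmin⟩ := G.exists_cut_min (fun _ => True)
    ⟨{G.source}, ⟨by simp, by simpa using G.source_ne_sink.symm⟩, trivial⟩
  exact ⟨W, hW.1, fun C' h => hmin C' h trivial⟩

/-- The capacity of the mincuts. -/
noncomputable def mincutCapacity (G : STNetwork n) : ℝ :=
  G.cutCapacity G.exists_isMincut.choose

theorem mincutCapacity_le (G : STNetwork n) {C : Finset (Fin n)} (hC : G.IsCut C) :
    G.mincutCapacity ≤ G.cutCapacity C :=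
  G.exists_isMincut.choose_spec.2 C hC

theorem IsMincut.cutCapacity_eq {G : STNetwork n} {C : Finset (Fin n)} (hC : G.IsMincut C) :
    G.cutCapacity C = G.mincutCapacity :=
  le_antisymm (hC.2 _ G.exists_isMincut.choose_spec.1) (G.mincutCapacity_le hC.1)

theorem isMincut_of_le {G : STNetwork n} {C : Finset (Fin n)} (hC : G.IsCut C)
    (h : G.cutCapacity C ≤ G.mincutCapacity) : G.IsMincut C :=
  ⟨hC, fun _ hC' => h.trans (G.mincutCapacity_le hC')⟩

/-- The cuts of least capacity among those that the pair `(u, v)` leaves. -/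
def leavingMincuts (G : STNetwork n) (u v : Fin n) : Set (Finset (Fin n)) :=
  {W | G.IsCut W ∧ u ∈ W ∧ v ∉ W ∧
    ∀ W', G.IsCut W' → u ∈ W' → v ∉ W' → G.cutCapacity W ≤ G.cutCapacity W'}

theorem mem_leavingMincuts_of_le {G : STNetwork n} {u v : Fin n} {W W' : Finset (Fin n)}
    (hW : W ∈ G.leavingMincuts u v) (hcut : G.IsCut W') (hu : u ∈ W') (hv : v ∉ W')
    (h : G.cutCapacity W' ≤ G.cutCapacity W) : W' ∈ G.leavingMincuts u v :=
  ⟨hcut, hu, hv, fun C hC hCu hCv => h.trans (hW.2.2.2 C hC hCu hCv)⟩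

theorem cutCapacity_eq_of_mem_leavingMincuts {G : STNetwork n} {u v : Fin n}
    {W W' : Finset (Fin n)} (hW : W ∈ G.leavingMincuts u v) (hW' : W' ∈ G.leavingMincuts u v) :
    G.cutCapacity W = G.cutCapacity W' :=
  le_antisymm (hW.2.2.2 _ hW'.1 hW'.2.1 hW'.2.2.1) (hW'.2.2.2 _ hW.1 hW.2.1 hW.2.2.1)

/-- The edge `(u, v)` is weakly vital: some cut that it leaves becomes a mincut, at least
alongside others, when the edge is removed. -/
def IsWeaklyVital (G : STNetwork n) (u v : Fin n) : Prop :=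
  0 < G.cap u v ∧
    ∃ W ∈ G.leavingMincuts u v, G.cutCapacity W ≤ G.mincutCapacity + G.cap u v

/-- The edge `(u, v)` is vital: its removal decreases the capacity of the mincuts. -/
def IsVital (G : STNetwork n) (u v : Fin n) : Prop :=
  0 < G.cap u v ∧
    ∃ W ∈ G.leavingMincuts u v, G.cutCapacity W < G.mincutCapacity + G.cap u v

theorem IsVital.isWeaklyVital {G : STNetwork n} {u v : Fin n} (h : G.IsVital u v) :
    G.IsWeaklyVital u v :=
  ⟨h.1, h.2.imp fun _ hW => ⟨hW.1, hW.2.le⟩⟩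

theorem IsWeaklyVital.cutCapacity_le {G : STNetwork n} {u v : Fin n} (h : G.IsWeaklyVital u v)
    {W : Finset (Fin n)} (hW : W ∈ G.leavingMincuts u v) :
    G.cutCapacity W ≤ G.mincutCapacity + G.cap u v := by
  obtain ⟨_, W', hW', hle⟩ := h
  rwa [cutCapacity_eq_of_mem_leavingMincuts hW hW']

/-- Uncrossing a least cut that `(u, v)` leaves with a cut `C` and an edge `(a, b)` that leaves `C`
and enters `W` shows that the capacity of `C` is at least that of a mincut plus that of `(a, b)`. -/
theorem add_cap_le_of_enters {G : STNetwork n} {u v a b : Fin n} (h : G.IsWeaklyVital u v)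
    {W C : Finset (Fin n)} (hW : W ∈ G.leavingMincuts u v) (hC : G.IsCut C)
    (ha : a ∈ C) (hb : b ∉ C) (ha' : a ∉ W) (hb' : b ∈ W) :
    G.mincutCapacity + G.cap a b ≤ G.cutCapacity C := by
  have hWle := h.cutCapacity_le hW
  have h1 := G.submodular_of_edge ha ha' hb' hb
  have hI := G.mincutCapacity_le (hW.1.inter hC)
  have hU := G.mincutCapacity_le (hW.1.union hC)
  by_cases hu : u ∈ C
  · have := hW.2.2.2 (W ∩ C) (hW.1.inter hC) (Finset.mem_inter.2 ⟨hW.2.1, hu⟩)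
      (fun h => hW.2.2.1 (Finset.mem_inter.1 h).1)
    linarith
  · by_cases hv : v ∈ C
    · have := G.submodular_of_two_edges ha ha' hb' hb hW.2.1 hu hv hW.2.2.1
      linarith
    · have := hW.2.2.2 (W ∪ C) (hW.1.union hC) (Finset.mem_union_left _ hW.2.1)
        (fun h => (Finset.mem_union.1 h).elim hW.2.2.1 hv)
      linarith

/-- A cut that no vital edge enters. -/
def IsAdmissible (G : STNetwork n) (W : Finset (Fin n)) : Prop :=
  G.IsCut W ∧ ∀ a b, G.IsVital a b → b ∈ W → a ∈ W

theorem IsAdmissible.inter {G : STNetwork n} {W C : Finset (Fin n)} (hW : G.IsAdmissible W)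
    (hC : G.IsAdmissible C) : G.IsAdmissible (W ∩ C) := by
  refine ⟨hW.1.inter hC.1, fun a b h hb => ?_⟩
  rw [Finset.mem_inter] at hb ⊢
  exact ⟨hW.2 a b h hb.1, hC.2 a b h hb.2⟩

theorem IsAdmissible.union {G : STNetwork n} {W C : Finset (Fin n)} (hW : G.IsAdmissible W)
    (hC : G.IsAdmissible C) : G.IsAdmissible (W ∪ C) := by
  refine ⟨hW.1.union hC.1, fun a b h hb => ?_⟩
  rw [Finset.mem_union] at hb ⊢
  exact hb.imp (hW.2 a b h) (hC.2 a b h)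

theorem IsWeaklyVital.isAdmissible {G : STNetwork n} {u v : Fin n} (h : G.IsWeaklyVital u v)
    {W : Finset (Fin n)} (hW : W ∈ G.leavingMincuts u v) : G.IsAdmissible W := by
  refine ⟨hW.1, fun a b hab hb => ?_⟩
  by_contra ha
  obtain ⟨_, C, hC, hlt⟩ := hab
  exact (add_cap_le_of_enters h hW hC.1 hC.2.1 hC.2.2.1 ha hb).not_gt hlt

/-! ### The ultrametric of separation by admissible cuts -/

open scoped Classical in
/-- The least capacity of an admissible cut that separates `x` and `y`, in either direction; a value
above all cut capacities if there is none. -/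
noncomputable def sepCapacity (G : STNetwork n) (x y : Fin n) : ℝ :=
  Finset.univ.inf' Finset.univ_nonempty fun W : Finset (Fin n) =>
    if G.IsAdmissible W ∧ ¬ (x ∈ W ↔ y ∈ W) then G.cutCapacity W else (∑ x, ∑ y, G.cap x y) + 1

theorem cutCapacity_le_sum (G : STNetwork n) (W : Finset (Fin n)) :
    G.cutCapacity W ≤ ∑ x, ∑ y, G.cap x y := by
  rw [cutCapacity_eq_sum, ← Fintype.sum_prod_type']
  refine Finset.sum_le_sum fun p _ => ?_
  split_ifs
  · exact le_rfl
  · exact G.cap_nonneg _ _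

theorem sepCapacity_le (G : STNetwork n) {x y : Fin n} {W : Finset (Fin n)}
    (hW : G.IsAdmissible W) (h : ¬ (x ∈ W ↔ y ∈ W)) : G.sepCapacity x y ≤ G.cutCapacity W := by
  refine (Finset.inf'_le _ (Finset.mem_univ W)).trans ?_
  rw [if_pos ⟨hW, h⟩]

theorem le_sepCapacity (G : STNetwork n) {x y : Fin n} {c : ℝ}
    (hc : c ≤ (∑ x, ∑ y, G.cap x y) + 1)
    (h : ∀ W, G.IsAdmissible W → ¬ (x ∈ W ↔ y ∈ W) → c ≤ G.cutCapacity W) :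
    c ≤ G.sepCapacity x y := by
  refine Finset.le_inf' _ _ fun W _ => ?_
  split_ifs with hW
  · exact h W hW.1 hW.2
  · exact hc

theorem sepCapacity_le_sum (G : STNetwork n) (x y : Fin n) :
    G.sepCapacity x y ≤ (∑ x, ∑ y, G.cap x y) + 1 := by
  refine (Finset.inf'_le _ (Finset.mem_univ ∅)).trans ?_
  split_ifs
  · linarith [G.cutCapacity_le_sum ∅]
  · exact le_rfl

theorem cutCapacity_lt_sepCapacity_self (G : STNetwork n) (W : Finset (Fin n)) (x : Fin n) :
    G.cutCapacity W < G.sepCapacity x x := by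
  have : (∑ x, ∑ y, G.cap x y) + 1 ≤ G.sepCapacity x x := G.le_sepCapacity le_rfl (by simp)
  linarith [G.cutCapacity_le_sum W]

theorem sepCapacity_le_self (G : STNetwork n) (x y z : Fin n) :
    G.sepCapacity x y ≤ G.sepCapacity z z :=
  (G.sepCapacity_le_sum x y).trans (G.le_sepCapacity le_rfl (by simp))

theorem sepCapacity_comm (G : STNetwork n) (x y : Fin n) :
    G.sepCapacity x y = G.sepCapacity y x := by
  unfold sepCapacity
  congr! 4
  exact Iff.comm

theorem min_sepCapacity_le (G : STNetwork n) (x y z : Fin n) :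
    min (G.sepCapacity x y) (G.sepCapacity y z) ≤ G.sepCapacity x z := by
  refine G.le_sepCapacity ((min_le_left _ _).trans (G.sepCapacity_le_sum _ _)) fun W hW h => ?_
  by_cases hxy : x ∈ W ↔ y ∈ W
  · exact (min_le_right _ _).trans (G.sepCapacity_le hW fun h' => h (hxy.trans h'))
  · exact (min_le_left _ _).trans (G.sepCapacity_le hW hxy)

theorem le_sepCapacity_trans {G : STNetwork n} {x y z : Fin n} {c : ℝ}
    (h1 : c ≤ G.sepCapacity x y) (h2 : c ≤ G.sepCapacity y z) : c ≤ G.sepCapacity x z :=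
  (le_min h1 h2).trans (G.min_sepCapacity_le x y z)

theorem lt_sepCapacity_trans {G : STNetwork n} {x y z : Fin n} {c : ℝ}
    (h1 : c < G.sepCapacity x y) (h2 : c < G.sepCapacity y z) : c < G.sepCapacity x z :=
  (lt_min h1 h2).trans_le (G.min_sepCapacity_le x y z)

theorem mem_iff_of_lt_sepCapacity {G : STNetwork n} {x y : Fin n} {W : Finset (Fin n)}
    (hW : G.IsAdmissible W) (h : G.cutCapacity W < G.sepCapacity x y) : x ∈ W ↔ y ∈ W := by
  by_contra hne
  exact (G.sepCapacity_le hW hne).not_gt h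

/-- A weakly vital edge is regular if no admissible cut that it enters is smaller than the least
cuts that it leaves. All vital edges are regular. -/
def IsRegular (G : STNetwork n) (u v : Fin n) : Prop :=
  G.IsWeaklyVital u v ∧ ∀ C, G.IsAdmissible C → v ∈ C → u ∉ C →
    ∀ W ∈ G.leavingMincuts u v, G.cutCapacity W ≤ G.cutCapacity C

theorem IsVital.isRegular {G : STNetwork n} {u v : Fin n} (h : G.IsVital u v) :
    G.IsRegular u v :=
  ⟨h.isWeaklyVital, fun _ hC hv hu => absurd (hC.2 u v h hv) hu⟩

theorem IsRegular.sepCapacity_eq {G : STNetwork n} {u v : Fin n} (h : G.IsRegular u v)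
    {W : Finset (Fin n)} (hW : W ∈ G.leavingMincuts u v) :
    G.sepCapacity u v = G.cutCapacity W := by
  refine le_antisymm (G.sepCapacity_le (h.1.isAdmissible hW) fun h => hW.2.2.1 (h.1 hW.2.1)) ?_
  refine G.le_sepCapacity (by linarith [G.cutCapacity_le_sum W]) fun C hC hne => ?_
  by_cases hu : u ∈ C
  · exact hW.2.2.2 C hC.1 hu fun hv => hne ⟨fun _ => hv, fun _ => hu⟩
  · exact h.2 C hC (by tauto) hu W hW

theorem IsRegular.mem_leavingMincuts {G : STNetwork n} {u v : Fin n} (h : G.IsRegular u v)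
    {W : Finset (Fin n)} (hW : G.IsCut W) (hu : u ∈ W) (hv : v ∉ W)
    (hc : G.cutCapacity W ≤ G.sepCapacity u v) : W ∈ G.leavingMincuts u v := by
  obtain ⟨_, W', hW', _⟩ := h.1
  exact mem_leavingMincuts_of_le hW' hW hu hv (h.sepCapacity_eq hW' ▸ hc)

/-! ### Counting edges with private sets -/

/-- If every edge of a family has a set that it leaves and that no later edge crosses, then the
vectors `χ_u - χ_v` of the edges are linearly independent. -/
theorem card_le_of_triangular {ι α : Type*} [LinearOrder α] (I : Finset ι) (u v : ι → Fin n)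
    (S : ι → Finset (Fin n)) (rank : ι → α) (h1 : ∀ i ∈ I, u i ∈ S i ∧ v i ∉ S i)
    (h2 : ∀ i ∈ I, ∀ j ∈ I, i ≠ j → rank i ≤ rank j → (u j ∈ S i ↔ v j ∈ S i)) :
    I.card ≤ n := by
  classical
  let x : I → (Fin n → ℚ) := fun i => Pi.single (u i) 1 - Pi.single (v i) 1
  have hx : ∀ i j : I, ∑ a ∈ S i, x j a =
      (if u j ∈ S i then 1 else 0) - (if v j ∈ S i then 1 else 0) := by
    intro i j
    simp only [x, Pi.sub_apply, Finset.sum_sub_distrib, Finset.sum_pi_single']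
  have hli : LinearIndependent ℚ x := by
    rw [Fintype.linearIndependent_iff]
    intro g hg
    by_contra hne
    push Not at hne
    obtain ⟨i₀, hi₀⟩ := hne
    obtain ⟨i, hi, hmin⟩ := Finset.exists_min_image (Finset.univ.filter fun i => g i ≠ 0)
      (fun i : I => rank i) ⟨i₀, by simpa using hi₀⟩
    have hsum : ∑ j, g j * ∑ a ∈ S i, x j a = 0 := by
      have : ∑ a ∈ S i, (∑ j, g j • x j) a = 0 := by rw [hg]; simp
      rw [← this]
      simp only [Finset.sum_apply, Pi.smul_apply, smul_eq_mul, Finset.mul_sum]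
      exact Finset.sum_comm
    rw [Finset.sum_eq_single i] at hsum
    · rw [hx, if_pos (h1 i i.2).1, if_neg (h1 i i.2).2] at hsum
      simp only [Finset.mem_filter, Finset.mem_univ, true_and] at hi
      exact hi (by simpa using hsum)
    · intro j _ hji
      by_cases hgj : g j = 0
      · rw [hgj, zero_mul]
      · have := h2 i i.2 j j.2 (fun h => hji (Subtype.ext h.symm)) (hmin j (by simpa using hgj))
        rw [hx]
        by_cases hu : u j ∈ S i
        · rw [if_pos hu, if_pos (this.1 hu), sub_self, mul_zero]
        · rw [if_neg hu, if_neg (fun h => hu (this.2 h)), sub_self, mul_zero]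
    · simp
  have := hli.fintype_card_le_finrank
  simpa using this

/-- A set with at most `n` elements can be listed in a table with `n` entries. -/
theorem exists_table {α : Type*} [Nonempty α] (s : Set α) (t : Finset α) (hs : ∀ a ∈ s, a ∈ t)
    (ht : t.card ≤ n) : ∃ f : Fin n → α, ∀ a ∈ s, ∃ k, f k = a := by
  classical
  refine ⟨fun k => if h : (k : ℕ) < t.card then (t.equivFin.symm ⟨k, h⟩ : α)
    else Classical.arbitrary α, fun a ha => ?_⟩
  refine ⟨⟨t.equivFin ⟨a, hs a ha⟩, (t.equivFin ⟨a, hs a ha⟩).2.trans_le ht⟩, ?_⟩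
  simp

/-! ### Labels of set families -/

/-- Every family of vertex sets has a compatible labelling that tells separated vertices apart: a
linear extension of the preorder "every member that contains `x` contains `y`". -/
theorem exists_label (𝓡 : Set (Finset (Fin n))) : ∃ label : Fin n → ℕ,
    (∀ x, label x < (n + 1) * n) ∧ IsOrderedBy 𝓡 label ∧
      ∀ W ∈ 𝓡, ∀ x ∈ W, ∀ y ∉ W, label x ≠ label y := by
  classical
  let up : Fin n → Finset (Fin n) := fun x => Finset.univ.filter fun y => ∀ W ∈ 𝓡, x ∈ W → y ∈ W
  have hup : ∀ x y, y ∈ up x ↔ ∀ W ∈ 𝓡, x ∈ W → y ∈ W := by simp [up]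
  let idx : Finset (Fin n) → Finset (Fin n) := fun A => Finset.univ.filter fun y => up y = A
  have hne : ∀ x, (idx (up x)).Nonempty := fun x => ⟨x, by simp [idx]⟩
  let rep : Fin n → Fin n := fun x => (idx (up x)).min' (hne x)
  have hrep : ∀ x, up (rep x) = up x := by
    intro x
    have := Finset.min'_mem _ (hne x)
    simpa [idx] using this
  have hcongr : ∀ x y, up x = up y → rep x = rep y := by
    intro x y h
    simp only [rep, h]
  refine ⟨fun x => (up x).card * n + rep x, fun x => ?_, fun x y h => ?_, fun W hW x hx y hy => ?_⟩
  · have h1 : (up x).card ≤ n := by simpa using Finset.card_le_univ (up x)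
    have h2 := (rep x).2
    nlinarith
  · have hyx : y ∉ up x := by
      intro hyx
      have hsub : up y ⊆ up x := fun z hz => (hup _ _).2 fun W hW hxW =>
        (hup _ _).1 hz W hW ((hup _ _).1 hyx W hW hxW)
      have hneq : up x ≠ up y := fun heq => by
        have := hcongr x y heq
        simp only [heq, this, lt_irrefl] at h
      have hcard := Finset.card_lt_card (hsub.ssubset_of_ne hneq.symm)
      have h2 := (rep y).2
      have : (up x).card * n + rep x < (up y).card * n + rep y := h
      nlinarith
    rw [hup] at hyx
    push Not at hyx
    exact hyx
  · intro h
    have h' : (up x).card * n + rep x = (up y).card * n + rep y := h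
    have h1 := (rep x).2
    have h2 := (rep y).2
    have h3 : (rep x : ℕ) = rep y := by
      have := congrArg (· % n) h'
      simpa [Nat.mod_eq_of_lt h1, Nat.mod_eq_of_lt h2, Nat.mul_add_mod'] using this
    have h4 : up x = up y := by rw [← hrep x, ← hrep y, Fin.ext h3]
    have h5 : y ∈ up x := h4 ▸ (hup y y).2 fun _ _ h => h
    exact hy ((hup x y).1 h5 W hW hx)

end STNetwork

/-! ### Regular edges: ring families and their greatest members -/

namespace STNetwork

variable {n : ℕ}

/-- The first vertex in the class of `u` and `v` of the relation "no admissible cut of smaller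
capacity than those separating `u` and `v` separates". -/
noncomputable def root (G : STNetwork n) (u v : Fin n) : Fin n := by
  classical
  exact (Finset.univ.filter fun x => G.sepCapacity u v ≤ G.sepCapacity u x).min' ⟨v, by simp⟩

theorem le_sepCapacity_root (G : STNetwork n) (u v : Fin n) :
    G.sepCapacity u v ≤ G.sepCapacity u (G.root u v) := by
  classical
  have := Finset.min'_mem (Finset.univ.filter fun x => G.sepCapacity u v ≤ G.sepCapacity u x)
    ⟨v, by simp⟩
  simpa [root] using this

theorem root_le (G : STNetwork n) {u v x : Fin n} (h : G.sepCapacity u v ≤ G.sepCapacity u x) :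
    G.root u v ≤ x := by
  classical
  exact Finset.min'_le _ _ (by simpa using h)

theorem root_eq (G : STNetwork n) {u v a b : Fin n} (h : G.sepCapacity u v = G.sepCapacity a b)
    (ha : G.sepCapacity u v ≤ G.sepCapacity u a) : G.root u v = G.root a b := by
  refine le_antisymm (G.root_le ?_) (G.root_le ?_)
  · exact le_sepCapacity_trans ha (h ▸ G.le_sepCapacity_root a b)
  · rw [← h]
    exact le_sepCapacity_trans (G.sepCapacity_comm u a ▸ ha) (G.le_sepCapacity_root u v)

theorem root_comm (G : STNetwork n) (u v : Fin n) : G.root u v = G.root v u :=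
  G.root_eq (G.sepCapacity_comm u v) le_rfl

/-- The least cuts that `(u, v)` leaves and that do not contain the root of `u` and `v`. -/
def rootlessMincuts (G : STNetwork n) (u v : Fin n) : Set (Finset (Fin n)) :=
  {W | W ∈ G.leavingMincuts u v ∧ G.root u v ∉ W}

/-- `r` is the vertex that separates best from `z` among the smaller ones, made unique by taking
the first vertex that separates from `z` at least as well. -/
def IsRoot (G : STNetwork n) (z r : Fin n) : Prop :=
  r < z ∧ (∀ x < z, G.sepCapacity z x ≤ G.sepCapacity z r) ∧
    ∀ x, G.sepCapacity z r ≤ G.sepCapacity z x → r ≤ x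

theorem IsRoot.unique {G : STNetwork n} {z r r' : Fin n} (h : G.IsRoot z r) (h' : G.IsRoot z r') :
    r = r' :=
  le_antisymm (h.2.2 _ (h'.2.1 _ h.1)) (h'.2.2 _ (h.2.1 _ h'.1))

/-- The admissible cuts of least capacity that contain `z` but not its root. There is only one such
family for each vertex `z`, but they contain the relevant least cuts of all regular edges. -/
def rootlessFamily (G : STNetwork n) (z : Fin n) : Set (Finset (Fin n)) :=
  {W | G.IsAdmissible W ∧ z ∈ W ∧
    ∃ r, G.IsRoot z r ∧ r ∉ W ∧ G.cutCapacity W = G.sepCapacity z r}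

theorem rootlessFamily_inter_union (G : STNetwork n) {z : Fin n} {W C : Finset (Fin n)}
    (hW : W ∈ G.rootlessFamily z) (hC : C ∈ G.rootlessFamily z) :
    W ∩ C ∈ G.rootlessFamily z ∧ W ∪ C ∈ G.rootlessFamily z := by
  obtain ⟨hWa, hzW, r, hr, hrW, hcW⟩ := hW
  obtain ⟨hCa, hzC, r', hr', hrC, hcC⟩ := hC
  obtain rfl := hr.unique hr'
  have hzI : z ∈ W ∩ C := Finset.mem_inter.2 ⟨hzW, hzC⟩
  have hzU : z ∈ W ∪ C := Finset.mem_union_left _ hzW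
  have hrI : r ∉ W ∩ C := fun h => hrW (Finset.mem_inter.1 h).1
  have hrU : r ∉ W ∪ C := fun h => (Finset.mem_union.1 h).elim hrW hrC
  have h1 := G.sepCapacity_le (hWa.inter hCa) fun h => hrI (h.1 hzI)
  have h2 := G.sepCapacity_le (hWa.union hCa) fun h => hrU (h.1 hzU)
  have h3 := G.submodular W C
  exact ⟨⟨hWa.inter hCa, hzI, r, hr, hrI, by linarith⟩,
    ⟨hWa.union hCa, hzU, r, hr, hrU, by linarith⟩⟩

theorem IsRegular.exists_rootlessFamily {G : STNetwork n} {u v : Fin n} (h : G.IsRegular u v)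
    (hex : ∃ W, W ∈ G.rootlessMincuts u v) :
    ∃ z, ∀ W, W ∈ G.rootlessMincuts u v ↔ W ∈ G.rootlessFamily z ∧ v ∉ W := by
  classical
  obtain ⟨W₀, hW₀, hrW₀⟩ := hex
  have huu : G.sepCapacity u v < G.sepCapacity u u := by
    rw [h.sepCapacity_eq hW₀]
    exact G.cutCapacity_lt_sepCapacity_self W₀ u
  -- `z` is the first vertex that no least cut of the edge separates from `u`
  obtain ⟨z, hz, hzmin⟩ : ∃ z, G.sepCapacity u v < G.sepCapacity u z ∧
      ∀ x, G.sepCapacity u v < G.sepCapacity u x → z ≤ x := by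
    have hne : (Finset.univ.filter fun x => G.sepCapacity u v < G.sepCapacity u x).Nonempty :=
      ⟨u, by simpa using huu⟩
    exact ⟨_, by simpa using Finset.min'_mem _ hne,
      fun x hx => Finset.min'_le _ _ (Finset.mem_filter.2 ⟨Finset.mem_univ x, hx⟩)⟩
  have hsame : ∀ W, G.IsAdmissible W → G.cutCapacity W = G.sepCapacity u v → (u ∈ W ↔ z ∈ W) :=
    fun W hW hc => mem_iff_of_lt_sepCapacity hW (hc ▸ hz)
  have hzW₀ : z ∈ W₀ :=
    (hsame W₀ (h.1.isAdmissible hW₀) (h.sepCapacity_eq hW₀).symm).1 hW₀.2.1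
  have hzu : G.sepCapacity u v < G.sepCapacity z u := G.sepCapacity_comm u z ▸ hz
  have hzx : ∀ x, G.sepCapacity u v ≤ G.sepCapacity u x ↔ G.sepCapacity u v ≤ G.sepCapacity z x :=
    fun x => ⟨fun h => le_sepCapacity_trans hzu.le h, fun h => le_sepCapacity_trans hz.le h⟩
  have hrz : G.root u v < z :=
    lt_of_le_of_ne (G.root_le hz.le) fun heq => hrW₀ (heq ▸ hzW₀)
  have hle : ∀ x < z, G.sepCapacity z x ≤ G.sepCapacity u v := fun x hx => by
    by_contra hlt
    exact (hzmin x (lt_sepCapacity_trans hz (not_le.1 hlt))).not_gt hx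
  have hc : G.sepCapacity z (G.root u v) = G.sepCapacity u v :=
    le_antisymm (hle _ hrz) ((hzx _).1 (G.le_sepCapacity_root u v))
  have hroot : G.IsRoot z (G.root u v) := by
    refine ⟨hrz, fun x hx => hc ▸ hle x hx, fun x hx => G.root_le ?_⟩
    rw [hc] at hx
    exact (hzx x).2 hx
  refine ⟨z, fun W => ⟨fun ⟨hW, hr⟩ => ?_, fun ⟨⟨ha, hzW, r, hr, hrW, hcW⟩, hv⟩ => ?_⟩⟩
  · have hcW := h.sepCapacity_eq hW
    exact ⟨⟨h.1.isAdmissible hW, (hsame W (h.1.isAdmissible hW) hcW.symm).1 hW.2.1,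
      _, hroot, hr, hcW ▸ hc.symm⟩, hW.2.2.1⟩
  · obtain rfl := hr.unique hroot
    rw [hc] at hcW
    exact ⟨h.mem_leavingMincuts ha.1 ((hsame W ha hcW).2 hzW) hv hcW.le, hrW⟩

theorem IsRegular.exists_greatest {G : STNetwork n} {u v : Fin n} (h : G.IsRegular u v)
    (hex : ∃ W, W ∈ G.rootlessMincuts u v) :
    ∃ Y ∈ G.rootlessMincuts u v, ∀ W ∈ G.rootlessMincuts u v, W ⊆ Y := by
  classical
  obtain ⟨z, hz⟩ := h.exists_rootlessFamily hex
  obtain ⟨W₀, hW₀⟩ := hex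
  obtain ⟨Y, hY, hmax⟩ := Finset.exists_max_image
    (Finset.univ.filter fun W => W ∈ G.rootlessMincuts u v) Finset.card ⟨W₀, by simpa using hW₀⟩
  simp only [Finset.mem_filter, Finset.mem_univ, true_and] at hY hmax
  refine ⟨Y, hY, fun W hW => ?_⟩
  have hU : Y ∪ W ∈ G.rootlessMincuts u v := by
    rw [hz] at hY hW ⊢
    exact ⟨(G.rootlessFamily_inter_union hY.1 hW.1).2,
      fun h => (Finset.mem_union.1 h).elim hY.2 hW.2⟩
  have := Finset.eq_of_subset_of_card_le Finset.subset_union_left (hmax _ hU)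
  rw [this]
  exact Finset.subset_union_right

/-- A greatest rootless least cut of a regular edge is not entered by another regular edge of the
same separation capacity whose greatest rootless least cut has the same root. -/
theorem IsRegular.not_enters_greatest {G : STNetwork n} {u v a b : Fin n} (h : G.IsRegular u v)
    (h' : G.IsRegular a b) (hc : G.sepCapacity u v = G.sepCapacity a b)
    (hr : G.root u v = G.root a b) {Y Z : Finset (Fin n)} (hY : Y ∈ G.rootlessMincuts u v)
    (hYmax : ∀ W ∈ G.rootlessMincuts u v, W ⊆ Y) (hZ : Z ∈ G.rootlessMincuts a b)
    (hb : b ∈ Y) : a ∈ Y := by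
  by_contra ha
  have hYa := h.1.isAdmissible hY.1
  have hZa := h'.1.isAdmissible hZ.1
  have hcY := h.sepCapacity_eq hY.1
  have hcZ := h'.sepCapacity_eq hZ.1
  have haZ := hZ.1.2.1
  have hbZ := hZ.1.2.2.1
  have hcap := h'.1.cutCapacity_le hZ.1
  have hpos := h.1.1
  have hrY := hY.2
  have hrZ := hZ.2
  rw [← hr] at hrZ
  have hrU : G.root u v ∉ Y ∪ Z := fun h => (Finset.mem_union.1 h).elim hrY hrZ
  have hU : G.sepCapacity u v ≤ G.cutCapacity (Y ∪ Z) := by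
    have h1 : G.sepCapacity a b ≤ G.sepCapacity a (G.root u v) := hr ▸ G.le_sepCapacity_root a b
    rw [hc]
    exact h1.trans (G.sepCapacity_le (hYa.union hZa) fun h =>
      hrU (h.1 (Finset.mem_union_right _ haZ)))
  have hI := G.mincutCapacity_le (hYa.inter hZa).1
  have h1 := G.submodular_of_edge haZ ha hb hbZ
  have hUeq : G.cutCapacity (Y ∪ Z) = G.sepCapacity u v := by linarith
  by_cases hvZ : v ∈ Z
  · by_cases huZ : u ∈ Z
    · have hrI : G.root u v ∉ Y ∩ Z := fun h => hrY (Finset.mem_inter.1 h).1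
      have h2 := (G.le_sepCapacity_root u v).trans (G.sepCapacity_le (hYa.inter hZa) fun h =>
        hrI (h.1 (Finset.mem_inter.2 ⟨hY.1.2.1, huZ⟩)))
      have := h'.1.1
      linarith
    · have h2 := G.submodular_of_two_edges haZ ha hb hbZ hY.1.2.1 huZ hvZ hY.1.2.2.1
      linarith
  · have hmem : Y ∪ Z ∈ G.rootlessMincuts u v :=
      ⟨h.mem_leavingMincuts (hYa.union hZa).1 (Finset.mem_union_left _ hY.1.2.1)
        (fun h => (Finset.mem_union.1 h).elim hY.1.2.2.1 hvZ) hUeq.le, hrU⟩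
    exact ha (hYmax _ hmem (Finset.mem_union_right _ haZ))

/-- The regular edges have at most `n` different greatest rootless least cuts in total. -/
theorem exists_table_of_greatest (G : STNetwork n) : ∃ top : Fin n → Finset (Fin n),
    ∀ u v, G.IsRegular u v → (∃ W, W ∈ G.rootlessMincuts u v) →
      ∃ k, top k ∈ G.rootlessMincuts u v ∧ ∀ W ∈ G.rootlessMincuts u v, W ⊆ top k := by
  classical
  let s : Set (Finset (Fin n)) := {Y | ∃ u v, G.IsRegular u v ∧ Y ∈ G.rootlessMincuts u v ∧
    ∀ W ∈ G.rootlessMincuts u v, W ⊆ Y}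
  let t : Finset (Finset (Fin n)) := Finset.univ.filter fun Y => Y ∈ s
  have hspec : ∀ Y : Finset (Fin n), ∃ p : Fin n × Fin n, Y ∈ s → G.IsRegular p.1 p.2 ∧
      Y ∈ G.rootlessMincuts p.1 p.2 ∧ ∀ W ∈ G.rootlessMincuts p.1 p.2, W ⊆ Y := by
    intro Y
    by_cases hY : Y ∈ s
    · obtain ⟨u, v, h⟩ := hY
      exact ⟨(u, v), fun _ => h⟩
    · exact ⟨(G.source, G.source), fun h => absurd h hY⟩
  choose e he using hspec
  have ht : t.card ≤ n := by
    refine card_le_of_triangular t (fun Y => (e Y).1) (fun Y => (e Y).2)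
      (fun Y => Y.filter fun x =>
        G.sepCapacity (e Y).1 (e Y).2 ≤ G.sepCapacity (e Y).1 x)
      (fun Y => toLex (G.sepCapacity (e Y).1 (e Y).2, n - Y.card)) ?_ ?_
    · intro Y hY
      obtain ⟨hreg, hmem, _⟩ := he Y (Finset.mem_filter.1 hY).2
      refine ⟨Finset.mem_filter.2 ⟨hmem.1.2.1, ?_⟩, fun h => hmem.1.2.2.1 (Finset.mem_filter.1 h).1⟩
      exact G.sepCapacity_le_self _ _ _
    · intro Y hY Z hZ hne hrank
      obtain ⟨hreg, hmem, hmax⟩ := he Y (Finset.mem_filter.1 hY).2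
      obtain ⟨hreg', hmem', hmax'⟩ := he Z (Finset.mem_filter.1 hZ).2
      generalize (e Y).1 = u, (e Y).2 = v, (e Z).1 = a, (e Z).2 = b at *
      rw [Prod.Lex.toLex_le_toLex] at hrank
      have hcle : G.sepCapacity u v ≤ G.sepCapacity a b := hrank.elim le_of_lt fun h => h.1.le
      simp only [Finset.mem_filter]
      have hK : G.sepCapacity u v ≤ G.sepCapacity u a ↔ G.sepCapacity u v ≤ G.sepCapacity u b :=
        ⟨fun h => le_sepCapacity_trans h hcle,
          fun h => le_sepCapacity_trans h (G.sepCapacity_comm a b ▸ hcle)⟩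
      rw [hK]
      refine and_congr_left fun hKb => ?_
      have hYa := hreg.1.isAdmissible hmem.1
      rcases hrank with hlt | ⟨heq, hcard⟩
      · exact mem_iff_of_lt_sepCapacity hYa (by rwa [← hreg.sepCapacity_eq hmem.1])
      · have hroot := G.root_eq heq (hK.2 hKb)
        refine ⟨fun haY => ?_, fun hbY =>
          hreg.not_enters_greatest hreg' heq hroot hmem hmax hmem' hbY⟩
        by_contra hbY
        have hYZ : Y ∈ G.rootlessMincuts a b :=
          ⟨hreg'.mem_leavingMincuts hYa.1 haY hbY
            (by rw [← hreg.sepCapacity_eq hmem.1]; exact hcle), hroot ▸ hmem.2⟩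
        have hYn : Y.card ≤ n := by simpa using Finset.card_le_univ Y
        have hZn : Z.card ≤ n := by simpa using Finset.card_le_univ Z
        exact hne (Finset.eq_of_subset_of_card_le (hmax' Y hYZ) (by dsimp only at hcard; omega))
  obtain ⟨top, htop⟩ := exists_table s t (fun Y hY => by simpa [t] using hY) ht
  refine ⟨top, fun u v h hex => ?_⟩
  obtain ⟨Y, hY, hmax⟩ := h.exists_greatest hex
  obtain ⟨k, rfl⟩ := htop Y ⟨u, v, h, hY, hmax⟩
  exact ⟨k, hY, hmax⟩

/-- `label` is compatible with a family of vertex sets and tells apart the vertices that a member of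
the family separates. -/
def IsLabelOf (𝓡 : Set (Finset (Fin n))) (label : Fin n → ℕ) : Prop :=
  IsOrderedBy 𝓡 label ∧ ∀ W ∈ 𝓡, ∀ x ∈ W, ∀ y ∉ W, label x ≠ label y

/-- `label` inside `A`, a large value outside. -/
def clamp (A : Finset (Fin n)) (label : Fin n → ℕ) (x : Fin n) : ℕ :=
  if x ∈ A then label x else (n + 1) * n

/-- With `n` labellings and `n` vertex sets one can describe the rootless least cuts of all regular
edges. -/
theorem exists_rootless_tables (G : STNetwork n) :
    ∃ (label : Fin n → Fin n → ℕ) (top : Fin n → Finset (Fin n)),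
      (∀ z x, label z x < (n + 1) * n) ∧
      ∀ u v, G.IsRegular u v → (∃ W, W ∈ G.rootlessMincuts u v) →
        ∃ z k, top k ∈ G.rootlessMincuts u v ∧
          IsLabelOf (G.rootlessMincuts u v) (clamp (top k) (label z)) := by
  choose label hlt hord hsep using fun z => exists_label (G.rootlessFamily z)
  obtain ⟨top, htop⟩ := G.exists_table_of_greatest
  refine ⟨label, top, hlt, fun u v h hex => ?_⟩
  obtain ⟨z, hz⟩ := h.exists_rootlessFamily hex
  obtain ⟨k, hk, hmax⟩ := htop u v h hex
  refine ⟨z, k, hk, fun x y hxy => ?_, fun W hW x hx y hy => ?_⟩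
  · unfold clamp at hxy
    by_cases hx : x ∈ top k
    · by_cases hy : y ∈ top k
      · rw [if_pos hx, if_pos hy] at hxy
        obtain ⟨W, hW, hxW, hyW⟩ := hord z x y hxy
        refine ⟨W ∩ top k, (hz _).2 ⟨(G.rootlessFamily_inter_union hW ((hz _).1 hk).1).1, ?_⟩,
          Finset.mem_inter.2 ⟨hxW, hx⟩, fun h => hyW (Finset.mem_inter.1 h).1⟩
        exact fun h => ((hz _).1 hk).2 (Finset.mem_inter.1 h).2
      · exact ⟨_, hk, hx, hy⟩
    · rw [if_neg hx] at hxy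
      have := hlt z y
      split_ifs at hxy <;> omega
  · unfold clamp
    rw [if_pos (hmax W hW hx)]
    split_ifs with hyk
    · exact hsep z W ((hz W).1 hW).1 x hx y hy
    · exact (hlt z x).ne

/-! ### Irregular weakly vital edges -/

/-- An irregular edge leaves no least cut of another weakly vital edge. -/
theorem mem_of_not_isRegular {G : STNetwork n} {u v a b : Fin n} (h : G.IsWeaklyVital u v)
    {C : Finset (Fin n)} (hC : C ∈ G.leavingMincuts u v) (hab : G.IsWeaklyVital a b)
    (hirr : ¬ G.IsRegular a b) (hne : (a, b) ≠ (u, v)) (ha : a ∈ C) : b ∈ C := by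
  by_contra hb
  have hex : ∃ Z, G.IsAdmissible Z ∧ b ∈ Z ∧ a ∉ Z ∧
      ∃ W ∈ G.leavingMincuts a b, G.cutCapacity Z < G.cutCapacity W := by
    by_contra hno
    push Not at hno
    exact hirr ⟨hab, hno⟩
  obtain ⟨Z, hZa, hbZ, haZ, W, hW, hlt⟩ := hex
  have hZ := hlt.trans_le (hab.cutCapacity_le hW)
  have hCle := h.cutCapacity_le hC
  have h1 := G.submodular_of_edge ha haZ hbZ hb
  have hI := G.mincutCapacity_le (hZa.1.inter hC.1)
  have hU := G.mincutCapacity_le (hZa.1.union hC.1)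
  by_cases hu : u ∈ Z
  · have := hC.2.2.2 (Z ∩ C) (hZa.1.inter hC.1) (Finset.mem_inter.2 ⟨hu, hC.2.1⟩)
      (fun h => hC.2.2.1 (Finset.mem_inter.1 h).2)
    linarith
  · by_cases hv : v ∈ Z
    · have h2 := G.cutCapacity_inter_add_union_le Z C {(a, b), (u, v)}
        (by simp [hu, hv, ha, hb, haZ, hbZ, hC.2.1, hC.2.2.1])
      rw [Finset.sum_pair hne] at h2
      dsimp only at h2
      linarith
    · have := hC.2.2.2 (Z ∪ C) (hZa.1.union hC.1) (Finset.mem_union_right _ hC.2.1)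
        (fun h => (Finset.mem_union.1 h).elim hv hC.2.2.1)
      linarith

theorem cutCapacity_eq_of_not_isRegular {G : STNetwork n} {u v : Fin n} (h : G.IsWeaklyVital u v)
    (hirr : ¬ G.IsRegular u v) {C : Finset (Fin n)} (hC : C ∈ G.leavingMincuts u v) :
    G.cutCapacity C = G.mincutCapacity + G.cap u v := by
  refine le_antisymm (h.cutCapacity_le hC) (not_lt.1 fun hlt => hirr ?_)
  exact IsVital.isRegular ⟨h.1, C, hC, hlt⟩

/-- No mincut separates `x` and `y`. -/
def SameNode (G : STNetwork n) (x y : Fin n) : Prop := ∀ M, G.IsMincut M → (x ∈ M ↔ y ∈ M)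

/-- The first vertex that no mincut separates from `u`. -/
noncomputable def nodeRoot (G : STNetwork n) (u : Fin n) : Fin n := by
  classical
  exact (Finset.univ.filter fun x => G.SameNode u x).min'
    ⟨u, Finset.mem_filter.2 ⟨Finset.mem_univ u, fun _ _ => Iff.rfl⟩⟩

theorem sameNode_nodeRoot (G : STNetwork n) (u : Fin n) : G.SameNode u (G.nodeRoot u) := by
  classical
  have := Finset.min'_mem (Finset.univ.filter fun x => G.SameNode u x)
    ⟨u, Finset.mem_filter.2 ⟨Finset.mem_univ u, fun _ _ => Iff.rfl⟩⟩
  simpa [nodeRoot] using this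

theorem nodeRoot_congr (G : STNetwork n) {u v : Fin n} (h : G.SameNode u v) :
    G.nodeRoot u = G.nodeRoot v := by
  unfold nodeRoot
  congr 1
  ext x
  simp only [Finset.mem_filter, Finset.mem_univ, true_and]
  exact forall₂_congr fun M hM => by rw [h M hM]

/-- An irregular edge between two vertices of the same node that leaves a least cut without the
root of that node. -/
def IsRootlessIrregular (G : STNetwork n) (u v : Fin n) : Prop :=
  G.IsWeaklyVital u v ∧ ¬ G.IsRegular u v ∧ G.SameNode u v ∧
    ∃ C ∈ G.leavingMincuts u v, G.nodeRoot u ∉ C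

theorem card_isRootlessIrregular_le (G : STNetwork n) (t : Finset (Fin n × Fin n))
    (ht : ∀ p ∈ t, G.IsRootlessIrregular p.1 p.2) : t.card ≤ n := by
  classical
  have hspec : ∀ p : Fin n × Fin n, ∃ C : Finset (Fin n), p ∈ t →
      (C ∈ G.leavingMincuts p.1 p.2 ∧ G.nodeRoot p.1 ∉ C) ∧
      ∀ C' ∈ G.leavingMincuts p.1 p.2, G.nodeRoot p.1 ∉ C' → C'.card ≤ C.card := by
    intro p
    by_cases hp : p ∈ t
    · obtain ⟨_, _, _, C₀, hC₀, hr⟩ := ht p hp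
      obtain ⟨C, hC, hmax⟩ := Finset.exists_max_image (Finset.univ.filter fun C =>
        C ∈ G.leavingMincuts p.1 p.2 ∧ G.nodeRoot p.1 ∉ C) Finset.card
        ⟨C₀, by simpa using ⟨hC₀, hr⟩⟩
      simp only [Finset.mem_filter, Finset.mem_univ, true_and] at hC hmax
      exact ⟨C, fun _ => ⟨hC, fun C' h1 h2 => hmax C' ⟨h1, h2⟩⟩⟩
    · exact ⟨∅, fun h => absurd h hp⟩
  choose C hCspec using hspec
  refine card_le_of_triangular t Prod.fst Prod.snd
    (fun p => (C p).filter fun x => G.SameNode p.1 x) (fun _ => 0) ?_ ?_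
  · intro p hp
    obtain ⟨⟨hC, _⟩, _⟩ := hCspec p hp
    exact ⟨Finset.mem_filter.2 ⟨hC.2.1, fun _ _ => Iff.rfl⟩,
      fun h => hC.2.2.1 (Finset.mem_filter.1 h).1⟩
  · rintro ⟨u, v⟩ hp ⟨a, b⟩ hq hne -
    obtain ⟨⟨hC, hr⟩, hmax⟩ := hCspec _ hp
    obtain ⟨⟨hD, hr'⟩, -⟩ := hCspec _ hq
    obtain ⟨hwv, hirr, hsn, -⟩ := ht _ hp
    obtain ⟨hwv', hirr', hsn', -⟩ := ht _ hq
    generalize C (u, v) = W at *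
    generalize C (a, b) = D at *
    dsimp only at *
    simp only [Finset.mem_filter]
    have hK : G.SameNode u a ↔ G.SameNode u b :=
      forall₂_congr fun M hM => by rw [hsn' M hM]
    rw [hK]
    refine and_congr_left fun hub => ⟨mem_of_not_isRegular hwv hC hwv' hirr' hne.symm, fun hb => ?_⟩
    by_contra ha
    have hua := hK.2 hub
    rw [← G.nodeRoot_congr hua] at hr'
    have haD := hD.2.1
    have hbD := hD.2.2.1
    have hcW := cutCapacity_eq_of_not_isRegular hwv hirr hC
    have hcD := cutCapacity_eq_of_not_isRegular hwv' hirr' hD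
    have h1 := G.submodular_of_edge haD ha hb hbD
    have hI := G.mincutCapacity_le (hC.1.inter hD.1)
    have hrU : G.nodeRoot u ∉ W ∪ D := fun h => (Finset.mem_union.1 h).elim hr hr'
    -- the union contains `a` but not the root of its node, so it is not a mincut
    have hU : G.mincutCapacity < G.cutCapacity (W ∪ D) := by
      by_contra hle
      have hM := isMincut_of_le (hC.1.union hD.1) (not_lt.1 hle)
      exact hrU ((G.sameNode_nodeRoot u _ hM).1 ((hua _ hM).2 (Finset.mem_union_right _ haD)))
    by_cases hu : u ∈ D
    · have := hC.2.2.2 (W ∩ D) (hC.1.inter hD.1) (Finset.mem_inter.2 ⟨hC.2.1, hu⟩)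
        (fun h => hC.2.2.1 (Finset.mem_inter.1 h).1)
      linarith
    · by_cases hv : v ∈ D
      · have := G.submodular_of_two_edges haD ha hb hbD hC.2.1 hu hv hC.2.2.1
        linarith
      · have hmem : W ∪ D ∈ G.leavingMincuts u v :=
          mem_leavingMincuts_of_le hC (hC.1.union hD.1) (Finset.mem_union_left _ hC.2.1)
            (fun h => (Finset.mem_union.1 h).elim hC.2.2.1 hv) (by linarith)
        have := Finset.eq_of_subset_of_card_le Finset.subset_union_left (hmax _ hmem hrU)
        exact ha (this ▸ Finset.mem_union_right _ haD)

theorem exists_irregular_table (G : STNetwork n) : ∃ label : Fin n → Fin n → ℕ,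
    (∀ k x, label k x < (n + 1) * n) ∧
    ∀ u v, G.IsRootlessIrregular u v → ∃ k, IsLabelOf (G.leavingMincuts u v) (label k) := by
  classical
  let t : Finset (Fin n × Fin n) := Finset.univ.filter fun p => G.IsRootlessIrregular p.1 p.2
  have : Nonempty (Fin n × Fin n) := ⟨(G.source, G.source)⟩
  obtain ⟨e, he⟩ := exists_table {p : Fin n × Fin n | G.IsRootlessIrregular p.1 p.2} t
    (fun p hp => by simpa [t] using hp)
    (G.card_isRootlessIrregular_le t fun p hp => (Finset.mem_filter.1 hp).2)
  choose label hlt hord hsep using fun k => exists_label (G.leavingMincuts (e k).1 (e k).2)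
  refine ⟨label, hlt, fun u v h => ?_⟩
  obtain ⟨k, hk⟩ := he (u, v) h
  refine ⟨k, ?_⟩
  have h1 := hord k
  have h2 := hsep k
  rw [hk] at h1 h2
  exact ⟨h1, h2⟩

end STNetwork

/-! ### Reversing all edges -/

namespace STNetwork

variable {n : ℕ}

/-- The network with all edges reversed and with source and sink exchanged. Its cuts are the
complements of the cuts of the given network. -/
def reverse (G : STNetwork n) : STNetwork n where
  cap x y := G.cap y x
  cap_nonneg x y := G.cap_nonneg y x
  source := G.sink
  sink := G.source
  source_ne_sink := G.source_ne_sink.symm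

theorem isCut_reverse_compl (G : STNetwork n) (W : Finset (Fin n)) :
    G.reverse.IsCut Wᶜ ↔ G.IsCut W := by
  simp only [IsCut, reverse, Finset.mem_compl, not_not]
  exact and_comm

theorem cutCapacity_reverse_compl (G : STNetwork n) (W : Finset (Fin n)) :
    G.reverse.cutCapacity Wᶜ = G.cutCapacity W := by
  simp only [cutCapacity, reverse, compl_compl]
  exact Finset.sum_comm

theorem isMincut_reverse_compl (G : STNetwork n) (W : Finset (Fin n)) :
    G.reverse.IsMincut Wᶜ ↔ G.IsMincut W := by
  simp only [IsMincut, isCut_reverse_compl, cutCapacity_reverse_compl]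
  refine and_congr_right fun _ => ?_
  rw [compl_surjective.forall]
  simp only [isCut_reverse_compl, cutCapacity_reverse_compl]

theorem mincutCapacity_reverse (G : STNetwork n) :
    G.reverse.mincutCapacity = G.mincutCapacity := by
  obtain ⟨M, hM⟩ := G.exists_isMincut
  rw [← hM.cutCapacity_eq, ← ((G.isMincut_reverse_compl M).2 hM).cutCapacity_eq,
    cutCapacity_reverse_compl]

theorem mem_leavingMincuts_reverse_compl (G : STNetwork n) (u v : Fin n) (W : Finset (Fin n)) :
    Wᶜ ∈ G.reverse.leavingMincuts v u ↔ W ∈ G.leavingMincuts u v := by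
  simp only [leavingMincuts, Set.mem_ofPred_eq]
  rw [compl_surjective.forall]
  simp only [isCut_reverse_compl, cutCapacity_reverse_compl, Finset.mem_compl, not_not]
  constructor
  · rintro ⟨h1, h2, h3, h4⟩
    exact ⟨h1, h3, h2, fun W' a b c => h4 W' a c b⟩
  · rintro ⟨h1, h2, h3, h4⟩
    exact ⟨h1, h3, h2, fun W' a b c => h4 W' a c b⟩

theorem isWeaklyVital_reverse (G : STNetwork n) (u v : Fin n) :
    G.reverse.IsWeaklyVital v u ↔ G.IsWeaklyVital u v := by
  simp only [IsWeaklyVital]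
  rw [compl_surjective.exists]
  simp only [mem_leavingMincuts_reverse_compl, cutCapacity_reverse_compl, mincutCapacity_reverse]
  rfl

theorem isVital_reverse (G : STNetwork n) (u v : Fin n) :
    G.reverse.IsVital v u ↔ G.IsVital u v := by
  simp only [IsVital]
  rw [compl_surjective.exists]
  simp only [mem_leavingMincuts_reverse_compl, cutCapacity_reverse_compl, mincutCapacity_reverse]
  rfl

theorem isAdmissible_reverse_compl (G : STNetwork n) (W : Finset (Fin n)) :
    G.reverse.IsAdmissible Wᶜ ↔ G.IsAdmissible W := by
  simp only [IsAdmissible, isCut_reverse_compl, Finset.mem_compl]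
  refine and_congr_right fun _ => ⟨fun h a b hab hb => ?_, fun h a b hab hb ha => ?_⟩
  · by_contra ha
    exact h b a ((G.isVital_reverse a b).2 hab) ha hb
  · exact hb (h b a ((G.isVital_reverse b a).1 hab) ha)

theorem sepCapacity_le_reverse (G : STNetwork n) (x y : Fin n) :
    G.sepCapacity x y ≤ G.reverse.sepCapacity x y := by
  refine le_sepCapacity _ ?_ ?_
  · have := G.sepCapacity_le_sum x y
    rwa [Finset.sum_comm] at this
  · rw [compl_surjective.forall]
    simp only [isAdmissible_reverse_compl, cutCapacity_reverse_compl, Finset.mem_compl]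
    exact fun W hW h => G.sepCapacity_le hW (by tauto)

theorem sepCapacity_reverse (G : STNetwork n) (x y : Fin n) :
    G.reverse.sepCapacity x y = G.sepCapacity x y :=
  le_antisymm (G.reverse.sepCapacity_le_reverse x y) (G.sepCapacity_le_reverse x y)

theorem isRegular_reverse (G : STNetwork n) (u v : Fin n) :
    G.reverse.IsRegular v u ↔ G.IsRegular u v := by
  simp only [IsRegular, isWeaklyVital_reverse]
  refine and_congr_right fun _ => ?_
  rw [compl_surjective.forall]
  refine forall_congr' fun C => ?_
  rw [compl_surjective.forall]
  simp only [isAdmissible_reverse_compl, cutCapacity_reverse_compl, Finset.mem_compl, not_not,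
    mem_leavingMincuts_reverse_compl]
  tauto

theorem root_reverse (G : STNetwork n) (u v : Fin n) : G.reverse.root v u = G.root u v := by
  rw [root_comm]
  simp only [root, sepCapacity_reverse]

/-- The least cuts that `(u, v)` leaves and that contain the root of `u` and `v`. -/
def rootedMincuts (G : STNetwork n) (u v : Fin n) : Set (Finset (Fin n)) :=
  {W | W ∈ G.leavingMincuts u v ∧ G.root u v ∈ W}

theorem mem_rootlessMincuts_reverse_compl (G : STNetwork n) (u v : Fin n) (W : Finset (Fin n)) :
    Wᶜ ∈ G.reverse.rootlessMincuts v u ↔ W ∈ G.rootedMincuts u v := by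
  simp only [rootlessMincuts, rootedMincuts, Set.mem_ofPred_eq, root_reverse,
    mem_leavingMincuts_reverse_compl, Finset.mem_compl, not_not]

theorem nodeRoot_reverse (G : STNetwork n) (u : Fin n) : G.reverse.nodeRoot u = G.nodeRoot u := by
  have : ∀ x y, G.reverse.SameNode x y ↔ G.SameNode x y := by
    intro x y
    rw [SameNode, compl_surjective.forall]
    simp only [isMincut_reverse_compl, Finset.mem_compl, not_iff_not]
    rfl
  unfold nodeRoot
  congr 1
  ext x
  simp [this]

/-- Passing to complements turns a labelling around. -/
theorem IsLabelOf.of_compl {𝓡 𝓡' : Set (Finset (Fin n))} (h : ∀ W, Wᶜ ∈ 𝓡' ↔ W ∈ 𝓡)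
    {label : Fin n → ℕ} (hl : IsLabelOf 𝓡' label) {T : ℕ} (hT : ∀ x, label x ≤ T) :
    IsLabelOf 𝓡 fun x => T - label x := by
  refine ⟨fun x y hxy => ?_, fun W hW x hx y hy heq => ?_⟩
  · dsimp only at hxy
    obtain ⟨W, hW, hyW, hxW⟩ := hl.1 y x (by have := hT x; have := hT y; omega)
    exact ⟨Wᶜ, (h _).1 (by rwa [compl_compl]), by simpa using hxW, by simpa using hyW⟩
  · refine hl.2 _ ((h W).2 hW) y (by simpa using hy) x (by simpa using hx) ?_
    have := hT x
    have := hT y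
    dsimp only at heq
    omega

/-- `label` outside `A`, zero inside. -/
def clampBelow (A : Finset (Fin n)) (label : Fin n → ℕ) (x : Fin n) : ℕ :=
  if x ∈ A then 0 else label x

theorem exists_rooted_tables (G : STNetwork n) :
    ∃ (label : Fin n → Fin n → ℕ) (bot : Fin n → Finset (Fin n)),
      (∀ z x, label z x ≤ (n + 1) * n) ∧
      ∀ u v, G.IsRegular u v → (∃ W, W ∈ G.rootedMincuts u v) →
        ∃ z k, bot k ∈ G.rootedMincuts u v ∧
          IsLabelOf (G.rootedMincuts u v) (clampBelow (bot k) (label z)) := by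
  obtain ⟨label, top, hlt, h⟩ := G.reverse.exists_rootless_tables
  refine ⟨fun z x => (n + 1) * n - label z x, fun k => (top k)ᶜ, fun z x => Nat.sub_le _ _,
    fun u v hreg ⟨W, hW⟩ => ?_⟩
  obtain ⟨z, k, hk, hl⟩ := h v u ((G.isRegular_reverse u v).2 hreg)
    ⟨Wᶜ, (G.mem_rootlessMincuts_reverse_compl u v W).2 hW⟩
  refine ⟨z, k, ?_, ?_⟩
  · rw [← mem_rootlessMincuts_reverse_compl, compl_compl]
    exact hk
  · have hle : ∀ x, clamp (top k) (label z) x ≤ (n + 1) * n := by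
      intro x
      unfold clamp
      split_ifs
      · exact (hlt z x).le
      · exact le_rfl
    have := hl.of_compl (G.mem_rootlessMincuts_reverse_compl u v) hle
    convert this using 2 with x
    unfold clamp clampBelow
    by_cases hx : x ∈ top k <;> simp [hx]

/-- An irregular edge between two vertices of the same node that leaves a least cut with the
root of that node. -/
def IsRootedIrregular (G : STNetwork n) (u v : Fin n) : Prop :=
  G.IsWeaklyVital u v ∧ ¬ G.IsRegular u v ∧ G.SameNode u v ∧
    ∃ C ∈ G.leavingMincuts u v, G.nodeRoot u ∈ C

theorem exists_rooted_irregular_table (G : STNetwork n) : ∃ label : Fin n → Fin n → ℕ,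
    (∀ k x, label k x ≤ (n + 1) * n) ∧
    ∀ u v, G.IsRootedIrregular u v → ∃ k, IsLabelOf (G.leavingMincuts u v) (label k) := by
  obtain ⟨label, hlt, h⟩ := G.reverse.exists_irregular_table
  refine ⟨fun z x => (n + 1) * n - label z x, fun z x => Nat.sub_le _ _,
    fun u v ⟨h1, h2, h3, C, hC, hr⟩ => ?_⟩
  have hnode : G.reverse.SameNode v u := fun M hM => by
    have := h3 Mᶜ (by rwa [← isMincut_reverse_compl, compl_compl])
    simp only [Finset.mem_compl, not_iff_not] at this
    exact this.symm
  obtain ⟨k, hk⟩ := h v u ⟨(G.isWeaklyVital_reverse u v).2 h1,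
    fun h' => h2 ((G.isRegular_reverse u v).1 h'), hnode, Cᶜ,
    (G.mem_leavingMincuts_reverse_compl u v C).2 hC, by
      rw [nodeRoot_reverse, ← G.nodeRoot_congr h3]
      simpa using hr⟩
  exact ⟨k, hk.of_compl (G.mem_leavingMincuts_reverse_compl u v) fun x => (hlt k x).le⟩

/-! ### Mincuts after the change of one capacity -/

theorem cutCapacity_change (G : STNetwork n) {u v : Fin n} {Δ : ℝ} (h : -G.cap u v ≤ Δ)
    (W : Finset (Fin n)) : (G.change u v Δ h).cutCapacity W =
      G.cutCapacity W + if u ∈ W ∧ v ∉ W then Δ else 0 := by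
  have h2 : (if u ∈ W ∧ v ∉ W then Δ else 0) =
      ∑ p : Fin n × Fin n, if p = (u, v) then (if p.1 ∈ W ∧ p.2 ∉ W then Δ else 0) else 0 := by
    simp
  rw [cutCapacity_eq_sum, cutCapacity_eq_sum, h2, ← Finset.sum_add_distrib]
  refine Finset.sum_congr rfl fun p _ => ?_
  obtain ⟨x, y⟩ := p
  simp only [change, Prod.mk.injEq]
  by_cases hp : x = u ∧ y = v
  · obtain ⟨rfl, rfl⟩ := hp
    simp only [and_self, if_true]
    split_ifs <;> ring
  · simp [hp]

/-- The cuts of least capacity among those that the pair `(u, v)` does not leave. -/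
def avoidingMincuts (G : STNetwork n) (u v : Fin n) : Set (Finset (Fin n)) :=
  {W | G.IsCut W ∧ ¬ (u ∈ W ∧ v ∉ W) ∧
    ∀ W', G.IsCut W' → ¬ (u ∈ W' ∧ v ∉ W') → G.cutCapacity W ≤ G.cutCapacity W'}

section change

variable {G : STNetwork n} {u v : Fin n} {Δ : ℝ} (h : -G.cap u v ≤ Δ) {W : Finset (Fin n)}

theorem cutCapacity_change_of_mem_avoiding (hW : W ∈ G.avoidingMincuts u v) :
    (G.change u v Δ h).cutCapacity W = G.cutCapacity W := by
  rw [cutCapacity_change, if_neg hW.2.1, add_zero]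

theorem cutCapacity_change_of_mem_leaving (hW : W ∈ G.leavingMincuts u v) :
    (G.change u v Δ h).cutCapacity W = G.cutCapacity W + Δ := by
  rw [cutCapacity_change, if_pos ⟨hW.2.1, hW.2.2.1⟩]

theorem mem_or_mem_of_isMincut_change (hW : (G.change u v Δ h).IsMincut W) :
    W ∈ G.avoidingMincuts u v ∨ W ∈ G.leavingMincuts u v := by
  by_cases hl : u ∈ W ∧ v ∉ W
  · refine Or.inr ⟨hW.1, hl.1, hl.2, fun W' hW' hu hv => ?_⟩
    have := hW.2 W' hW'
    rw [cutCapacity_change, cutCapacity_change, if_pos hl, if_pos ⟨hu, hv⟩] at this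
    linarith
  · refine Or.inl ⟨hW.1, hl, fun W' hW' hl' => ?_⟩
    have := hW.2 W' hW'
    rw [cutCapacity_change, cutCapacity_change, if_neg hl, if_neg hl'] at this
    linarith

theorem isMincut_change_of_mem_avoiding (hW : W ∈ G.avoidingMincuts u v)
    (hle : ∀ C ∈ G.leavingMincuts u v, G.cutCapacity W ≤ G.cutCapacity C + Δ) :
    (G.change u v Δ h).IsMincut W := by
  refine ⟨hW.1, fun C hC => ?_⟩
  rw [cutCapacity_change_of_mem_avoiding h hW, cutCapacity_change]
  split_ifs with hl
  · obtain ⟨C', ⟨hcut, hu, hv⟩, hmin⟩ := G.exists_cut_min (fun C => u ∈ C ∧ v ∉ C) ⟨C, hC, hl⟩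
    have h1 := hle C' ⟨hcut, hu, hv, fun W' a b c => hmin W' a ⟨b, c⟩⟩
    have h2 := hmin C hC hl
    linarith
  · rw [add_zero]
    exact hW.2.2 C hC hl

theorem isMincut_change_of_mem_leaving (hW : W ∈ G.leavingMincuts u v)
    (hle : ∀ C ∈ G.avoidingMincuts u v, G.cutCapacity W + Δ ≤ G.cutCapacity C) :
    (G.change u v Δ h).IsMincut W := by
  refine ⟨hW.1, fun C hC => ?_⟩
  rw [cutCapacity_change_of_mem_leaving h hW, cutCapacity_change]
  split_ifs with hl
  · linarith [hW.2.2.2 C hC hl.1 hl.2]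
  · obtain ⟨C', ⟨hcut, hl'⟩, hmin⟩ := G.exists_cut_min (fun C => ¬ (u ∈ C ∧ v ∉ C)) ⟨C, hC, hl⟩
    have h1 := hle C' ⟨hcut, hl', hmin⟩
    have h2 := hmin C hC hl
    linarith

end change

/-- The cuts of least capacity among those that do not contain `u`. -/
def mincutsWithout (G : STNetwork n) (u : Fin n) : Set (Finset (Fin n)) :=
  {W | G.IsCut W ∧ u ∉ W ∧ ∀ W', G.IsCut W' → u ∉ W' → G.cutCapacity W ≤ G.cutCapacity W'}

/-- The cuts of least capacity among those that contain `v`. -/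
def mincutsWith (G : STNetwork n) (v : Fin n) : Set (Finset (Fin n)) :=
  {W | G.IsCut W ∧ v ∈ W ∧ ∀ W', G.IsCut W' → v ∈ W' → G.cutCapacity W ≤ G.cutCapacity W'}

theorem mem_mincutsWithout_iff {G : STNetwork n} {u v : Fin n} {W : Finset (Fin n)}
    (hW : W ∈ G.avoidingMincuts u v) (hu : u ∉ W) (C : Finset (Fin n)) :
    C ∈ G.mincutsWithout u ↔ C ∈ G.avoidingMincuts u v ∧ u ∉ C := by
  constructor
  · rintro ⟨hC, huC, hmin⟩
    exact ⟨⟨hC, fun h => huC h.1, fun C' h1 h2 => (hmin W hW.1 hu).trans (hW.2.2 C' h1 h2)⟩, huC⟩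
  · rintro ⟨hC, huC⟩
    exact ⟨hC.1, huC, fun C' h1 h2 => hC.2.2 C' h1 fun h => h2 h.1⟩

theorem mem_mincutsWith_iff {G : STNetwork n} {u v : Fin n} {W : Finset (Fin n)}
    (hW : W ∈ G.avoidingMincuts u v) (hv : v ∈ W) (C : Finset (Fin n)) :
    C ∈ G.mincutsWith v ↔ C ∈ G.avoidingMincuts u v ∧ v ∈ C := by
  constructor
  · rintro ⟨hC, hvC, hmin⟩
    exact ⟨⟨hC, fun h => h.2 hvC, fun C' h1 h2 => (hmin W hW.1 hv).trans (hW.2.2 C' h1 h2)⟩, hvC⟩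
  · rintro ⟨hC, hvC⟩
    exact ⟨hC.1, hvC, fun C' h1 h2 => hC.2.2 C' h1 fun h => h.2 h2⟩

end STNetwork

/-! ### Labellings assembled from table rows -/

namespace STNetwork

variable {n : ℕ}

theorem IsOrderedBy.mono {𝓡 𝓡' : Set (Finset (Fin n))} (h : 𝓡 ⊆ 𝓡') {label : Fin n → ℕ}
    (hl : IsOrderedBy 𝓡 label) : IsOrderedBy 𝓡' label := fun x y hxy =>
  let ⟨W, hW, hm⟩ := hl x y hxy
  ⟨W, h hW, hm⟩

theorem isOrderedBy_const (𝓡 : Set (Finset (Fin n))) (c : ℕ) : IsOrderedBy 𝓡 fun _ => c :=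
  fun _ _ h => absurd h (lt_irrefl c)

theorem lex_eq {B a b c d : ℕ} (hb : b < B) (hd : d < B) (h : a * B + b = c * B + d) :
    a = c ∧ b = d := by
  have hac : a = c := by
    rcases lt_trichotomy a c with h' | h' | h'
    · nlinarith
    · exact h'
    · nlinarith
  subst hac
  exact ⟨rfl, by omega⟩

theorem IsOrderedBy.lex {𝓡 : Set (Finset (Fin n))} {f g : Fin n → ℕ} (hf : IsOrderedBy 𝓡 f)
    (hg : IsOrderedBy 𝓡 g) {B : ℕ} (hB : ∀ x, g x < B) : IsOrderedBy 𝓡 fun x => f x * B + g x := by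
  intro x y hxy
  have hx := hB x
  have hy := hB y
  dsimp only at hxy
  rcases lt_trichotomy (f x) (f y) with h | h | h
  · exact hf x y h
  · exact hg x y (by rw [h] at hxy; omega)
  · nlinarith

/-- Four labels in one number, the first one being the most significant one. The last one is turned
around, so that it may vanish on the vertices that it does not tell apart. -/
def combine (T : ℕ) (f : Fin 4 → Fin n → ℕ) (x : Fin n) : ℕ :=
  ((f 0 x * (T + 1) + f 1 x) * (T + 1) + f 2 x) * (T + 1) + (T - f 3 x)

theorem isLabelOf_combine {𝓡 : Set (Finset (Fin n))} {T : ℕ} {f : Fin 4 → Fin n → ℕ}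
    (hT : ∀ j x, f j x ≤ T) (h0 : IsOrderedBy 𝓡 (f 0)) (h1 : IsOrderedBy 𝓡 (f 1))
    (h2 : IsOrderedBy 𝓡 (f 2)) (h3 : IsOrderedBy 𝓡 fun x => T - f 3 x)
    (hsep : ∀ W ∈ 𝓡, ∀ x ∈ W, ∀ y ∉ W, ∃ j, f j x ≠ f j y) : IsLabelOf 𝓡 (combine T f) := by
  have hlt : ∀ j x, f j x < T + 1 := fun j x => Nat.lt_succ_of_le (hT j x)
  have hlt3 : ∀ x, T - f 3 x < T + 1 := fun x => by omega
  refine ⟨((h0.lex h1 (hlt 1)).lex h2 (hlt 2)).lex h3 hlt3, fun W hW x hx y hy heq => ?_⟩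
  obtain ⟨heq, e3⟩ := lex_eq (hlt3 x) (hlt3 y) heq
  obtain ⟨heq, e2⟩ := lex_eq (hlt 2 x) (hlt 2 y) heq
  obtain ⟨e0, e1⟩ := lex_eq (hlt 1 x) (hlt 1 y) heq
  obtain ⟨j, hj⟩ := hsep W hW x hx y hy
  have := hT 3 x
  have := hT 3 y
  fin_cases j
  · exact hj e0
  · exact hj e1
  · exact hj e2
  · exact hj (show f 3 x = f 3 y by omega)

/-! ### Labels of the avoiding and of the leaving mincuts -/

/-- A least cut that the edge `(u, v)` does not leave is a least cut without `u` or a least cut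
with `v`, so two labels describe these cuts. A label is replaced by a constant if its family has
larger capacity or is empty. -/
theorem exists_avoiding_labels {G : STNetwork n} {u v : Fin n} {ℓ₁ ℓ₂ : Fin n → ℕ}
    (h₁ : IsLabelOf (G.mincutsWithout u) ℓ₁) (h₂ : IsLabelOf (G.mincutsWith v) ℓ₂) :
    ∃ f₁ f₂ : Fin n → ℕ, (f₁ = (fun _ => 0) ∨ f₁ = ℓ₁) ∧ (f₂ = (fun _ => 0) ∨ f₂ = ℓ₂) ∧
      IsOrderedBy (G.avoidingMincuts u v) f₁ ∧ IsOrderedBy (G.avoidingMincuts u v) f₂ ∧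
      ∀ W ∈ G.avoidingMincuts u v, ∀ x ∈ W, ∀ y ∉ W, f₁ x ≠ f₁ y ∨ f₂ x ≠ f₂ y := by
  have e₁ : ∃ f₁ : Fin n → ℕ, (f₁ = (fun _ => 0) ∨ f₁ = ℓ₁) ∧
      IsOrderedBy (G.avoidingMincuts u v) f₁ ∧
      ∀ W ∈ G.avoidingMincuts u v, u ∉ W → ∀ x ∈ W, ∀ y ∉ W, f₁ x ≠ f₁ y := by
    by_cases hex : ∃ W ∈ G.avoidingMincuts u v, u ∉ W
    · obtain ⟨W, hW, hu⟩ := hex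
      have := mem_mincutsWithout_iff hW hu
      exact ⟨ℓ₁, Or.inr rfl, h₁.1.mono fun C hC => ((this C).1 hC).1,
        fun C hC huC => h₁.2 C ((this C).2 ⟨hC, huC⟩)⟩
    · exact ⟨_, Or.inl rfl, isOrderedBy_const _ _, fun W hW hu => absurd ⟨W, hW, hu⟩ hex⟩
  have e₂ : ∃ f₂ : Fin n → ℕ, (f₂ = (fun _ => 0) ∨ f₂ = ℓ₂) ∧
      IsOrderedBy (G.avoidingMincuts u v) f₂ ∧
      ∀ W ∈ G.avoidingMincuts u v, v ∈ W → ∀ x ∈ W, ∀ y ∉ W, f₂ x ≠ f₂ y := by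
    by_cases hex : ∃ W ∈ G.avoidingMincuts u v, v ∈ W
    · obtain ⟨W, hW, hv⟩ := hex
      have := mem_mincutsWith_iff hW hv
      exact ⟨ℓ₂, Or.inr rfl, h₂.1.mono fun C hC => ((this C).1 hC).1,
        fun C hC hvC => h₂.2 C ((this C).2 ⟨hC, hvC⟩)⟩
    · exact ⟨_, Or.inl rfl, isOrderedBy_const _ _, fun W hW hv => absurd ⟨W, hW, hv⟩ hex⟩
  obtain ⟨f₁, k₁, o₁, s₁⟩ := e₁
  obtain ⟨f₂, k₂, o₂, s₂⟩ := e₂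
  refine ⟨f₁, f₂, k₁, k₂, o₁, o₂, fun W hW x hx y hy => ?_⟩
  by_cases hu : u ∈ W
  · exact Or.inr (s₂ W hW (by_contra fun hv => hW.2.1 ⟨hu, hv⟩) x hx y hy)
  · exact Or.inl (s₁ W hW hu x hx y hy)

/-- If a mincut separates the end vertices of an irregular edge, then whatever is separated by a
least cut that the edge leaves is also separated by a mincut that the edge does not leave: uncross
the two cuts. -/
theorem exists_avoiding_separates {G : STNetwork n} {u v : Fin n} (h : G.IsWeaklyVital u v)
    (hirr : ¬ G.IsRegular u v) (hnode : ¬ G.SameNode u v) {W : Finset (Fin n)}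
    (hW : W ∈ G.leavingMincuts u v) {x y : Fin n} (hx : x ∈ W) (hy : y ∉ W) :
    ∃ A ∈ G.avoidingMincuts u v, (x ∈ A ∧ y ∉ A) ∨ (y ∈ A ∧ x ∉ A) := by
  have hcW := cutCapacity_eq_of_not_isRegular h hirr hW
  obtain ⟨M, hM, hne⟩ : ∃ M, G.IsMincut M ∧ ¬ (u ∈ M ↔ v ∈ M) := by
    simpa [SameNode] using hnode
  have hpos := h.1
  have hMavoid : ¬ (u ∈ M ∧ v ∉ M) := fun ⟨hu, hv⟩ => by
    have := hW.2.2.2 M hM.1 hu hv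
    rw [hcW, hM.cutCapacity_eq] at this
    linarith
  have hu : u ∉ M := fun hu => hne ⟨fun _ => by tauto, fun _ => hu⟩
  have hv : v ∈ M := by tauto
  have hsub := G.submodular_of_edge (W := M) (C := W) hW.2.1 hu hv hW.2.2.1
  rw [hcW, hM.cutCapacity_eq] at hsub
  have h1 := G.mincutCapacity_le (hM.1.inter hW.1)
  have h2 := G.mincutCapacity_le (hM.1.union hW.1)
  have havoid : ∀ A, G.IsCut A → G.cutCapacity A ≤ G.mincutCapacity → ¬ (u ∈ A ∧ v ∉ A) →
      A ∈ G.avoidingMincuts u v := fun A hA hle hl =>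
    ⟨hA, hl, fun C hC _ => hle.trans (G.mincutCapacity_le hC)⟩
  by_cases hxM : x ∈ M
  · by_cases hyM : y ∈ M
    · refine ⟨M ∩ W, havoid _ (hM.1.inter hW.1) (by linarith) (by simp [hu]), Or.inl ?_⟩
      simp [hx, hy, hxM]
    · exact ⟨M, havoid _ hM.1 hM.cutCapacity_eq.le hMavoid, Or.inl ⟨hxM, hyM⟩⟩
  · by_cases hyM : y ∈ M
    · exact ⟨M, havoid _ hM.1 hM.cutCapacity_eq.le hMavoid, Or.inr ⟨hyM, hxM⟩⟩
    · refine ⟨M ∪ W, havoid _ (hM.1.union hW.1) (by linarith) (by simp [hv]), Or.inl ?_⟩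
      simp [hx, hy, hyM]

/-- If some decrease of the capacity of an edge makes all mincuts leave this edge, then the edge is
vital. -/
theorem isVital_of_cutCapacity_sub_lt {G : STNetwork n} {u v : Fin n} (hpos : 0 < G.cap u v)
    {W : Finset (Fin n)} (hW : W ∈ G.leavingMincuts u v)
    (h : ∀ A ∈ G.avoidingMincuts u v, G.cutCapacity W - G.cap u v < G.cutCapacity A) :
    G.IsVital u v := by
  refine ⟨hpos, W, hW, ?_⟩
  obtain ⟨M, hM⟩ := G.exists_isMincut
  rw [← hM.cutCapacity_eq]
  by_cases hl : u ∈ M ∧ v ∉ M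
  · linarith [hW.2.2.2 M hM.1 hl.1 hl.2]
  · linarith [h M ⟨hM.1, hl, fun C hC _ => hM.2 C hC⟩]

/-- If the edge `(u, v)` is not weakly vital, then no change of its capacity makes a cut that it
leaves a mincut. -/
theorem cutCapacity_lt_of_not_isWeaklyVital {G : STNetwork n} {u v : Fin n}
    (hpos : 0 < G.cap u v) (h : ¬ G.IsWeaklyVital u v) {Δ : ℝ} (hΔ : -G.cap u v ≤ Δ)
    {A C : Finset (Fin n)} (hA : A ∈ G.avoidingMincuts u v) (hC : C ∈ G.leavingMincuts u v) :
    G.cutCapacity A < G.cutCapacity C + Δ := by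
  have hlt : G.mincutCapacity + G.cap u v < G.cutCapacity C :=
    not_le.1 fun hle => h ⟨hpos, C, hC, hle⟩
  obtain ⟨M, hM⟩ := G.exists_isMincut
  rw [← hM.cutCapacity_eq] at hlt
  by_cases hl : u ∈ M ∧ v ∉ M
  · linarith [hC.2.2.2 M hM.1 hl.1 hl.2]
  · linarith [hA.2.2 M hM.1 hl]

/-! ### The tables of the data structure -/

/-- `f` is the product of two of the rows of a table. -/
def IsProductOfRows {ι : Type*} (row : ι → Fin n → Fin n → ℕ) (f : Fin n → ℕ) : Prop :=
  ∃ i k j l, ∀ x, f x = row i k x * row j l x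

theorem exists_edgeSum (G : STNetwork n) (W : Finset (Fin n)) :
    ∃ S ⊆ G.edges, G.cutCapacity W = ∑ p ∈ S, G.cap p.1 p.2 := by
  classical
  refine ⟨G.edges.filter fun p => p.1 ∈ W ∧ p.2 ∉ W, Finset.filter_subset _ _, ?_⟩
  rw [cutCapacity_eq_sum, ← Finset.sum_filter, eq_comm]
  refine Finset.sum_subset (fun p hp => by simp at hp ⊢; exact hp.2) fun p hp hp' => ?_
  refine le_antisymm (not_lt.1 fun hlt => hp' ?_) (G.cap_nonneg _ _)
  simp only [edges, Finset.mem_filter, Finset.mem_univ, true_and] at hp ⊢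
  exact ⟨hlt, hp⟩

/-- `row` and `cut` are tables from which the mincuts of the networks that differ from `G` in the
capacity of a single edge can be read off. -/
structure IsMincutTable {ι κ : Type*} (G : STNetwork n) (row : ι → Fin n → Fin n → ℕ)
    (cut : κ → Fin n → Finset (Fin n)) : Prop where
  row_le : ∀ i k x, row i k x ≤ (n + 1) * n
  zero : IsProductOfRows row fun _ => 0
  avoiding : ∀ u v, ∃ f₁ f₂ : Fin n → ℕ, IsProductOfRows row f₁ ∧ IsProductOfRows row f₂ ∧
    (∀ x, f₁ x ≤ (n + 1) * n) ∧ (∀ x, f₂ x ≤ (n + 1) * n) ∧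
    IsOrderedBy (G.avoidingMincuts u v) f₁ ∧ IsOrderedBy (G.avoidingMincuts u v) f₂ ∧
    ∀ W ∈ G.avoidingMincuts u v, ∀ x ∈ W, ∀ y ∉ W, f₁ x ≠ f₁ y ∨ f₂ x ≠ f₂ y
  leaving : ∀ u v, G.IsWeaklyVital u v →
    ∃ f₁ f₂ : Fin n → ℕ, IsProductOfRows row f₁ ∧ IsProductOfRows row f₂ ∧
      (∀ x, f₁ x ≤ (n + 1) * n) ∧ (∀ x, f₂ x ≤ (n + 1) * n) ∧
      IsOrderedBy (G.leavingMincuts u v) f₁ ∧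
      IsOrderedBy (G.leavingMincuts u v) (fun x => (n + 1) * n - f₂ x) ∧
      ∀ W ∈ G.leavingMincuts u v, ∀ x ∈ W, ∀ y ∉ W, f₁ x ≠ f₁ y ∨ f₂ x ≠ f₂ y ∨
        (¬ G.IsRegular u v ∧ ∃ A ∈ G.avoidingMincuts u v, (x ∈ A ∧ y ∉ A) ∨ (y ∈ A ∧ x ∉ A))
  avoiding_cut : ∀ u v, (∃ W, W ∈ G.avoidingMincuts u v) →
    ∃ j k, cut j k ∈ G.avoidingMincuts u v
  leaving_cut : ∀ u v, G.IsRegular u v → ∃ j k, cut j k ∈ G.leavingMincuts u v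

/-- The rows are two constant ones, the labels of the least cuts without and with a given vertex, of
the lattices for the regular edges and of the cuts of the irregular edges (each for the network and
for its reverse), and the indicators of the greatest and of the smallest cuts. -/
theorem exists_isMincutTable (G : STNetwork n) :
    ∃ (row : Fin 10 → Fin n → Fin n → ℕ) (cut : Fin 4 → Fin n → Finset (Fin n)),
      G.IsMincutTable row cut := by
  classical
  choose ℓ₁ hlt₁ hl₁ using fun u => exists_label (G.mincutsWithout u)
  choose ℓ₂ hlt₂ hl₂ using fun v => exists_label (G.mincutsWith v)
  obtain ⟨ℓ₃, top, hlt₃, hl₃⟩ := G.exists_rootless_tables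
  obtain ⟨ℓ₄, bot, hle₄, hl₄⟩ := G.exists_rooted_tables
  obtain ⟨ℓ₅, hlt₅, hl₅⟩ := G.exists_irregular_table
  obtain ⟨ℓ₆, hle₆, hl₆⟩ := G.exists_rooted_irregular_table
  have hchoice : ∀ 𝓡 : Set (Finset (Fin n)), ∃ A, (∃ W, W ∈ 𝓡) → A ∈ 𝓡 := fun 𝓡 => by
    by_cases h : ∃ W, W ∈ 𝓡
    · exact h.imp fun W hW _ => hW
    · exact ⟨∅, fun h' => absurd h' h⟩
  choose c₁ hc₁ using fun u => hchoice (G.mincutsWithout u)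
  choose c₂ hc₂ using fun v => hchoice (G.mincutsWith v)
  let T := (n + 1) * n
  have hT : 1 ≤ T := Nat.mul_pos n.succ_pos G.source.pos
  let row : Fin 10 → Fin n → Fin n → ℕ := ![fun _ _ => 0, fun _ _ => 1, ℓ₁, ℓ₂,
    fun k x => T - ℓ₃ k x, ℓ₄, ℓ₅, ℓ₆, fun k x => if x ∈ top k then 1 else 0,
    fun k x => if x ∈ bot k then 0 else 1]
  let o : Fin n := G.source
  have hzero : IsProductOfRows row fun _ => 0 := ⟨0, o, 0, o, fun x => rfl⟩
  have hsingle : ∀ i k, IsProductOfRows row (row i k) := fun i k =>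
    ⟨1, o, i, k, fun x => (one_mul _).symm⟩
  refine ⟨row, ![c₁, c₂, top, bot], ⟨?_, hzero, fun u v => ?_, fun u v hwv => ?_,
    fun u v ⟨W, hW⟩ => ?_, fun u v hreg => ?_⟩⟩
  · intro i k x
    fin_cases i
    · exact Nat.zero_le _
    · exact hT
    · exact (hlt₁ k x).le
    · exact (hlt₂ k x).le
    · exact Nat.sub_le _ _
    · exact hle₄ k x
    · exact (hlt₅ k x).le
    · exact hle₆ k x
    · change (if x ∈ top k then 1 else 0) ≤ T
      split_ifs <;> omega
    · change (if x ∈ bot k then 0 else 1) ≤ T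
      split_ifs <;> omega
  · obtain ⟨f₁, f₂, k₁, k₂, h⟩ := exists_avoiding_labels (hl₁ u) (hl₂ v)
    refine ⟨f₁, f₂, ?_, ?_, ?_, ?_, h⟩
    · rcases k₁ with rfl | rfl
      exacts [hzero, hsingle 2 u]
    · rcases k₂ with rfl | rfl
      exacts [hzero, hsingle 3 v]
    · rcases k₁ with rfl | rfl
      exacts [fun _ => Nat.zero_le _, fun x => (hlt₁ u x).le]
    · rcases k₂ with rfl | rfl
      exacts [fun _ => Nat.zero_le _, fun x => (hlt₂ v x).le]
  · by_cases hreg : G.IsRegular u v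
    · have e₁ : ∃ f : Fin n → ℕ, IsProductOfRows row f ∧ (∀ x, f x ≤ T) ∧
          IsOrderedBy (G.leavingMincuts u v) f ∧
          ∀ W ∈ G.leavingMincuts u v, G.root u v ∈ W → ∀ x ∈ W, ∀ y ∉ W, f x ≠ f y := by
        by_cases hex : ∃ W, W ∈ G.rootedMincuts u v
        · obtain ⟨z, k, _, hl⟩ := hl₄ u v hreg hex
          refine ⟨_, ⟨9, k, 5, z, fun x => ?_⟩, fun x => ?_, hl.1.mono fun W hW => hW.1,
            fun W hW hr => hl.2 W ⟨hW, hr⟩⟩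
          · change (if x ∈ bot k then 0 else ℓ₄ z x) = (if x ∈ bot k then 0 else 1) * ℓ₄ z x
            split_ifs <;> simp
          · rw [clampBelow]
            split_ifs
            exacts [Nat.zero_le _, hle₄ z x]
        · exact ⟨_, hzero, fun _ => Nat.zero_le _, isOrderedBy_const _ _,
            fun W hW hr => absurd ⟨W, hW, hr⟩ hex⟩
      have e₂ : ∃ f : Fin n → ℕ, IsProductOfRows row f ∧ (∀ x, f x ≤ T) ∧
          IsOrderedBy (G.leavingMincuts u v) (fun x => T - f x) ∧
          ∀ W ∈ G.leavingMincuts u v, G.root u v ∉ W → ∀ x ∈ W, ∀ y ∉ W, f x ≠ f y := by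
        by_cases hex : ∃ W, W ∈ G.rootlessMincuts u v
        · obtain ⟨z, k, _, hl⟩ := hl₃ u v hreg hex
          have heq : ∀ x, clamp (top k) (ℓ₃ z) x =
              T - (if x ∈ top k then 1 else 0) * (T - ℓ₃ z x) := fun x => by
            have := hlt₃ z x
            rw [clamp]
            split_ifs
            · change ℓ₃ z x < T at this
              omega
            · simp [T]
          refine ⟨fun x => (if x ∈ top k then 1 else 0) * (T - ℓ₃ z x), ⟨8, k, 4, z, fun x => rfl⟩,
            fun x => ?_, ?_, fun W hW hr x hx y hy hxy => ?_⟩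
          · dsimp only
            split_ifs <;> simp
          · simp only [← heq]
            exact hl.1.mono fun W hW => hW.1
          · refine hl.2 W ⟨hW, hr⟩ x hx y hy ?_
            dsimp only at hxy
            rw [heq, heq, hxy]
        · exact ⟨_, hzero, fun _ => Nat.zero_le _, isOrderedBy_const _ _,
            fun W hW hr => absurd ⟨W, hW, hr⟩ hex⟩
      obtain ⟨f₁, p₁, b₁, o₁, s₁⟩ := e₁
      obtain ⟨f₂, p₂, b₂, o₂, s₂⟩ := e₂
      refine ⟨f₁, f₂, p₁, p₂, b₁, b₂, o₁, o₂, fun W hW x hx y hy => ?_⟩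
      by_cases hr : G.root u v ∈ W
      · exact Or.inl (s₁ W hW hr x hx y hy)
      · exact Or.inr (Or.inl (s₂ W hW hr x hx y hy))
    · by_cases hnode : G.SameNode u v
      · obtain ⟨i, k, hl⟩ : ∃ i k, IsLabelOf (G.leavingMincuts u v) (row i k) ∧
            ∀ x, row i k x ≤ T := by
          obtain ⟨C, hC, _⟩ := hwv.2
          by_cases hr : G.nodeRoot u ∈ C
          · obtain ⟨k, hk⟩ := hl₆ u v ⟨hwv, hreg, hnode, C, hC, hr⟩
            exact ⟨7, k, hk, hle₆ k⟩
          · obtain ⟨k, hk⟩ := hl₅ u v ⟨hwv, hreg, hnode, C, hC, hr⟩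
            exact ⟨6, k, hk, fun x => (hlt₅ k x).le⟩
        exact ⟨row i k, fun _ => 0, hsingle i k, hzero, hl.2, fun _ => Nat.zero_le _, hl.1.1,
          isOrderedBy_const _ _, fun W hW x hx y hy => Or.inl (hl.1.2 W hW x hx y hy)⟩
      · exact ⟨fun _ => 0, fun _ => 0, hzero, hzero, fun _ => Nat.zero_le _,
          fun _ => Nat.zero_le _, isOrderedBy_const _ _, isOrderedBy_const _ _,
          fun W hW x hx y hy => Or.inr (Or.inr ⟨hreg,
            exists_avoiding_separates hwv hreg hnode hW hx hy⟩)⟩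
  · by_cases hu : u ∈ W
    · have hv : v ∈ W := by_contra fun hv => hW.2.1 ⟨hu, hv⟩
      have hiff := mem_mincutsWith_iff hW hv
      exact ⟨1, v, ((hiff _).1 (hc₂ v ⟨W, (hiff W).2 ⟨hW, hv⟩⟩)).1⟩
    · have hiff := mem_mincutsWithout_iff hW hu
      exact ⟨0, u, ((hiff _).1 (hc₁ u ⟨W, (hiff W).2 ⟨hW, hu⟩⟩)).1⟩
  · obtain ⟨_, C, hC, _⟩ := hreg.1
    by_cases hr : G.root u v ∈ C
    · obtain ⟨_, k, hk, _⟩ := hl₄ u v hreg ⟨C, hC, hr⟩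
      exact ⟨3, k, hk.1⟩
    · obtain ⟨_, k, hk, _⟩ := hl₃ u v hreg ⟨C, hC, hr⟩
      exact ⟨2, k, hk.1⟩

/-! ### The answer to a query -/

open Classical in
/-- Which of two reals is the smaller one: `0` for the first one, `2` for the second one, `1` in case
of a tie. -/
noncomputable def outcome (a b : ℝ) : Fin 3 := if a < b then 0 else if b < a then 2 else 1

/-- The part of the data structure that belongs to one edge and to one outcome of the comparison of
the cuts that the edge leaves with the cuts that it does not leave: how to find the capacity of the
mincuts, a mincut, and a labelling. Four pieces, each a product of two rows, make up the labelling;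
`mask` and `label` say which rows. -/
structure Record (ι κ : Type*) (n : ℕ) where
  leaves : Bool
  cut : κ × Fin n
  mask : Fin 4 → ι × Fin n
  label : Fin 4 → ι × Fin n

/-- The pieces of the labelling that a record describes. -/
def Record.piece {ι κ : Type*} (r : Record ι κ n) (row : ι → Fin n → Fin n → ℕ) (j : Fin 4)
    (x : Fin n) : ℕ :=
  row (r.mask j).1 (r.mask j).2 x * row (r.label j).1 (r.label j).2 x

/-- The labelling that a record describes. -/
def Record.node {ι κ : Type*} (r : Record ι κ n) (row : ι → Fin n → Fin n → ℕ) : Fin n → ℕ :=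
  combine ((n + 1) * n) (r.piece row)

/-- The record describes the mincuts of `G'`, whose capacity is `b` or `a` according to
`r.leaves`. -/
structure Record.Describes {ι κ : Type*} (r : Record ι κ n) (row : ι → Fin n → Fin n → ℕ)
    (cut : κ → Fin n → Finset (Fin n)) (G' : STNetwork n) (a b : ℝ) : Prop where
  isMincut : G'.IsMincut (cut r.cut.1 r.cut.2)
  cutCapacity_eq : G'.cutCapacity (cut r.cut.1 r.cut.2) = if r.leaves then b else a
  isLabelOf : IsLabelOf {C | G'.IsMincut C} (r.node row)
  piece_le : ∀ j x, r.piece row j x ≤ (n + 1) * n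

theorem exists_record {ι κ : Type*} {row : ι → Fin n → Fin n → ℕ} {f : Fin 4 → Fin n → ℕ}
    (hf : ∀ j, IsProductOfRows row (f j)) (hT : ∀ j x, f j x ≤ (n + 1) * n) (leaves : Bool)
    (c : κ × Fin n) : ∃ r : Record ι κ n, r.leaves = leaves ∧ r.cut = c ∧
      (∀ j x, r.piece row j x ≤ (n + 1) * n) ∧ ∀ G' : STNetwork n, IsOrderedBy {C | G'.IsMincut C} (f 0) →
        IsOrderedBy {C | G'.IsMincut C} (f 1) → IsOrderedBy {C | G'.IsMincut C} (f 2) →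
        IsOrderedBy {C | G'.IsMincut C} (fun x => (n + 1) * n - f 3 x) →
        (∀ C, G'.IsMincut C → ∀ x ∈ C, ∀ y ∉ C, ∃ j, f j x ≠ f j y) →
        IsLabelOf {C | G'.IsMincut C} (r.node row) := by
  choose i k j l hf using hf
  refine ⟨⟨leaves, c, fun q => (i q, k q), fun q => (j q, l q)⟩, rfl, rfl,
    fun q x => (hf q x).ge.trans (hT q x), fun G' h0 h1 h2 h3 hsep => ?_⟩
  have := isLabelOf_combine hT h0 h1 h2 h3 hsep
  have heq : f = Record.piece ⟨leaves, c, fun q => (i q, k q), fun q => (j q, l q)⟩ row :=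
    funext fun q => funext fun x => hf q x
  rwa [heq] at this

/-- For every edge there are two reals, the capacities of the least cuts that it does not leave and
that it leaves, and three records, one of which describes the mincuts after a change of the capacity
of the edge. -/
theorem IsMincutTable.exists_records {ι κ : Type*} {G : STNetwork n}
    {row : ι → Fin n → Fin n → ℕ} {cut : κ → Fin n → Finset (Fin n)} (ht : G.IsMincutTable row cut)
    {u v : Fin n} (hpos : 0 < G.cap u v) :
    ∃ (a b : ℝ) (r : Fin 3 → Record ι κ n),
      (∃ S ⊆ G.edges, a = ∑ p ∈ S, G.cap p.1 p.2) ∧ (∃ S ⊆ G.edges, b = ∑ p ∈ S, G.cap p.1 p.2) ∧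
      ∀ Δ (h : -G.cap u v ≤ Δ),
        (r (outcome a (b + Δ))).Describes row cut (G.change u v Δ h) a (b + Δ) := by
  have hconst : ∀ 𝓡 : Set (Finset (Fin n)), IsOrderedBy 𝓡 fun _ : Fin n => (n + 1) * n - 0 :=
    fun 𝓡 => isOrderedBy_const 𝓡 _
  by_cases hA : ∃ A, A ∈ G.avoidingMincuts u v
  · obtain ⟨i, k, hA⟩ := ht.avoiding_cut u v hA
    obtain ⟨f₁, f₂, p₁, p₂, b₁, b₂, o₁, o₂, s₁⟩ := ht.avoiding u v
    have hAeq : ∀ C ∈ G.avoidingMincuts u v, G.cutCapacity C = G.cutCapacity (cut i k) :=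
      fun C hC => le_antisymm (hC.2.2 _ hA.1 hA.2.1) (hA.2.2 _ hC.1 hC.2.1)
    obtain ⟨rA, hrA, hcA, hpA, hlA⟩ := exists_record (f := ![f₁, f₂, fun _ => 0, fun _ => 0])
      (fun j => by fin_cases j <;> [exact p₁; exact p₂; exact ht.zero; exact ht.zero])
      (fun j => by
        fin_cases j <;> [exact b₁; exact b₂; exact fun _ => Nat.zero_le _;
          exact fun _ => Nat.zero_le _]) false (i, k)
    -- The record `rA` does as long as no cut that the edge leaves becomes a mincut.
    have hdescA : ∀ Δ (h : -G.cap u v ≤ Δ) (b : ℝ),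
        (∀ C ∈ G.leavingMincuts u v, G.cutCapacity (cut i k) < G.cutCapacity C + Δ) →
        rA.Describes row cut (G.change u v Δ h) (G.cutCapacity (cut i k)) b := by
      intro Δ h b hlt
      have hmin : ∀ C ∈ G.avoidingMincuts u v, (G.change u v Δ h).IsMincut C := fun C hC =>
        isMincut_change_of_mem_avoiding h hC fun C' hC' => (hAeq C hC).trans_le (hlt C' hC').le
      refine ⟨by rw [hcA]; exact hmin _ hA, ?_, ?_, hpA⟩
      · rw [hcA, hrA, cutCapacity_change_of_mem_avoiding h hA]
        simp
      · refine hlA _ (o₁.mono hmin) (o₂.mono hmin) (isOrderedBy_const _ _) (hconst _)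
          fun C hC x hx y hy => ?_
        rcases mem_or_mem_of_isMincut_change h hC with hC' | hC'
        · rcases s₁ C hC' x hx y hy with hne | hne
          exacts [⟨0, hne⟩, ⟨1, hne⟩]
        · have h1 := hC.2 _ hA.1
          rw [cutCapacity_change_of_mem_avoiding h hA, cutCapacity_change_of_mem_leaving h hC'] at h1
          exact absurd (hlt C hC') h1.not_gt
    by_cases hwv : G.IsWeaklyVital u v
    · obtain ⟨B, hB, _⟩ := hwv.2
      obtain ⟨f₃, f₄, p₃, p₄, b₃, b₄, o₃, o₄, s₃⟩ := ht.leaving u v hwv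
      have hBeq : ∀ C ∈ G.leavingMincuts u v, G.cutCapacity C = G.cutCapacity B :=
        fun C hC => cutCapacity_eq_of_mem_leavingMincuts hC hB
      obtain ⟨rT, hrT, hcT, hpT, hlT⟩ := exists_record (f := ![f₁, f₂, f₃, f₄])
        (fun j => by fin_cases j <;> [exact p₁; exact p₂; exact p₃; exact p₄])
        (fun j => by fin_cases j <;> [exact b₁; exact b₂; exact b₃; exact b₄]) false (i, k)
      have hB' : ∃ j l, G.IsRegular u v → cut j l ∈ G.leavingMincuts u v := by
        by_cases hreg : G.IsRegular u v
        · obtain ⟨j, l, h⟩ := ht.leaving_cut u v hreg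
          exact ⟨j, l, fun _ => h⟩
        · exact ⟨i, k, fun h => absurd h hreg⟩
      obtain ⟨j, l, hjl⟩ := hB'
      obtain ⟨rB, hrB, hcB, hpB, hlB⟩ := exists_record (f := ![fun _ => 0, fun _ => 0, f₃, f₄])
        (fun j => by fin_cases j <;> [exact ht.zero; exact ht.zero; exact p₃; exact p₄])
        (fun j => by
          fin_cases j <;> [exact fun _ => Nat.zero_le _; exact fun _ => Nat.zero_le _; exact b₃;
            exact b₄]) true (j, l)
      refine ⟨G.cutCapacity (cut i k), G.cutCapacity B, ![rA, rT, rB], G.exists_edgeSum _,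
        G.exists_edgeSum _, fun Δ h => ?_⟩
      unfold outcome
      split_ifs with h1 h2
      · exact hdescA Δ h _ fun C hC => by rwa [hBeq C hC]
      · -- The edge is vital, hence regular: the labels of its cuts alone do.
        have hreg : G.IsRegular u v := by
          refine (isVital_of_cutCapacity_sub_lt hpos hB fun C hC => ?_).isRegular
          rw [hAeq C hC]
          linarith
        have hmin : ∀ C ∈ G.leavingMincuts u v, (G.change u v Δ h).IsMincut C := fun C hC =>
          isMincut_change_of_mem_leaving h hC fun C' hC' => by
            rw [hBeq C hC, hAeq C' hC']
            exact h2.le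
        change rB.Describes row cut _ _ _
        refine ⟨by rw [hcB]; exact hmin _ (hjl hreg), ?_, ?_, hpB⟩
        · rw [hcB, hrB, cutCapacity_change_of_mem_leaving h (hjl hreg), hBeq _ (hjl hreg)]
          simp
        · refine hlB _ (isOrderedBy_const _ _) (isOrderedBy_const _ _) (o₃.mono hmin)
            (o₄.mono hmin) fun C hC x hx y hy => ?_
          rcases mem_or_mem_of_isMincut_change h hC with hC' | hC'
          · have h3 := hC.2 _ hB.1
            rw [cutCapacity_change_of_mem_avoiding h hC', cutCapacity_change_of_mem_leaving h hB,
              hAeq C hC'] at h3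
            exact absurd h2 h3.not_gt
          · rcases s₃ C hC' x hx y hy with hne | hne | hne
            exacts [⟨2, hne⟩, ⟨3, hne⟩, absurd hreg hne.1]
      · have heq : G.cutCapacity (cut i k) = G.cutCapacity B + Δ :=
          le_antisymm (not_lt.1 h2) (not_lt.1 h1)
        have hminA : ∀ C ∈ G.avoidingMincuts u v, (G.change u v Δ h).IsMincut C := fun C hC =>
          isMincut_change_of_mem_avoiding h hC fun C' hC' => by
            rw [hBeq C' hC', hAeq C hC]
            exact heq.le
        have hminB : ∀ C ∈ G.leavingMincuts u v, (G.change u v Δ h).IsMincut C := fun C hC =>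
          isMincut_change_of_mem_leaving h hC fun C' hC' => by
            rw [hBeq C hC, hAeq C' hC']
            exact heq.ge
        change rT.Describes row cut _ _ _
        refine ⟨by rw [hcT]; exact hminA _ hA, ?_, ?_, hpT⟩
        · rw [hcT, hrT, cutCapacity_change_of_mem_avoiding h hA]
          simp
        · refine hlT _ (o₁.mono hminA) (o₂.mono hminA) (o₃.mono hminB) (o₄.mono hminB)
            fun C hC x hx y hy => ?_
          rcases mem_or_mem_of_isMincut_change h hC with hC' | hC'
          · rcases s₁ C hC' x hx y hy with hne | hne
            exacts [⟨0, hne⟩, ⟨1, hne⟩]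
          · rcases s₃ C hC' x hx y hy with hne | hne | ⟨_, A, hA', hxy | hxy⟩
            · exact ⟨2, hne⟩
            · exact ⟨3, hne⟩
            · rcases s₁ A hA' x hxy.1 y hxy.2 with hne | hne
              exacts [⟨0, hne⟩, ⟨1, hne⟩]
            · rcases s₁ A hA' y hxy.1 x hxy.2 with hne | hne
              exacts [⟨0, hne.symm⟩, ⟨1, hne.symm⟩]
    · -- No cut that the edge leaves ever becomes a mincut, so the second real does not matter.
      exact ⟨G.cutCapacity (cut i k), G.cutCapacity (cut i k), fun _ => rA, G.exists_edgeSum _,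
        G.exists_edgeSum _, fun Δ h => hdescA Δ h _ fun C hC =>
          cutCapacity_lt_of_not_isWeaklyVital hpos hwv h hA hC⟩
  · -- The edge leaves every cut, so the mincuts stay what they are.
    have hmem : ∀ C, G.IsCut C → u ∈ C ∧ v ∉ C := fun C hC => by
      by_contra hl
      obtain ⟨A, ⟨hcut, hl'⟩, hmin⟩ := G.exists_cut_min (fun C => ¬ (u ∈ C ∧ v ∉ C)) ⟨C, hC, hl⟩
      exact hA ⟨A, hcut, hl', hmin⟩
    obtain ⟨M, hM⟩ := G.exists_isMincut
    have hB : M ∈ G.leavingMincuts u v :=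
      ⟨hM.1, (hmem M hM.1).1, (hmem M hM.1).2, fun C hC _ _ => hM.2 C hC⟩
    have hreg : G.IsRegular u v :=
      (isVital_of_cutCapacity_sub_lt hpos hB fun C hC => absurd ⟨C, hC⟩ hA).isRegular
    obtain ⟨f₃, f₄, p₃, p₄, b₃, b₄, o₃, o₄, s₃⟩ := ht.leaving u v hreg.1
    obtain ⟨j, l, hjl⟩ := ht.leaving_cut u v hreg
    obtain ⟨rB, hrB, hcB, hpB, hlB⟩ := exists_record (f := ![fun _ => 0, fun _ => 0, f₃, f₄])
      (fun j => by fin_cases j <;> [exact ht.zero; exact ht.zero; exact p₃; exact p₄])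
      (fun j => by
        fin_cases j <;> [exact fun _ => Nat.zero_le _; exact fun _ => Nat.zero_le _; exact b₃;
          exact b₄]) true (j, l)
    refine ⟨G.cutCapacity (cut j l), G.cutCapacity (cut j l), fun _ => rB, G.exists_edgeSum _,
      G.exists_edgeSum _, fun Δ h => ?_⟩
    have hmin : ∀ C ∈ G.leavingMincuts u v, (G.change u v Δ h).IsMincut C := fun C hC =>
      isMincut_change_of_mem_leaving h hC fun C' hC' => absurd ⟨C', hC'⟩ hA
    refine ⟨by rw [hcB]; exact hmin _ hjl, ?_, ?_, hpB⟩
    · rw [hcB, hrB, cutCapacity_change_of_mem_leaving h hjl]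
      simp
    · refine hlB _ (isOrderedBy_const _ _) (isOrderedBy_const _ _) (o₃.mono hmin)
        (o₄.mono hmin) fun C hC x hx y hy => ?_
      rcases mem_or_mem_of_isMincut_change h hC with hC' | hC'
      · exact absurd ⟨C, hC'⟩ hA
      · rcases s₃ C hC' x hx y hy with hne | hne | hne
        exacts [⟨2, hne⟩, ⟨3, hne⟩, absurd hreg hne.1]

end STNetwork

/-! ### Running times of programs -/

namespace RAM

variable {M : Machine}

/-- Started in `σ`, the program `p` halts within `k` steps, in a state with the property `Q`. -/
def Runs (M : Machine) (p : Prog) (σ : State) (k : ℕ) (Q : State → Prop) : Prop :=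
  ∃ j ≤ k, ∃ τ, Exec M p σ j τ ∧ Q τ

theorem Runs.mono {p : Prog} {σ : State} {j k : ℕ} {Q R : State → Prop} (h : Runs M p σ j Q)
    (hjk : j ≤ k) (hQ : ∀ τ, Q τ → R τ) : Runs M p σ k R :=
  let ⟨i, hi, τ, he, hq⟩ := h
  ⟨i, hi.trans hjk, τ, he, hQ τ hq⟩

theorem Runs.seq {p q : Prog} {σ : State} {j k : ℕ} {Q R : State → Prop} (hp : Runs M p σ j Q)
    (hq : ∀ τ, Q τ → Runs M q τ k R) : Runs M (.seq p q) σ (j + k) R :=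
  let ⟨_, hi, τ, he, hτ⟩ := hp
  let ⟨_, hi', υ, he', hυ⟩ := hq τ hτ
  ⟨_, Nat.add_le_add hi hi', υ, .seq he he', hυ⟩

theorem runs_skip {σ : State} {k : ℕ} {Q : State → Prop} (h : Q σ) : Runs M .skip σ k Q :=
  ⟨0, k.zero_le, σ, .skip σ, h⟩

theorem runs_ite {c : Test} {p q : Prog} {σ : State} {k : ℕ} {Q : State → Prop}
    (hp : c.Holds σ → Runs M p σ k Q) (hq : ¬ c.Holds σ → Runs M q σ k Q) :
    Runs M (.ite c p q) σ (k + 1) Q := by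
  by_cases h : c.Holds σ
  · obtain ⟨i, hi, τ, he, hτ⟩ := hp h
    exact ⟨i + 1, by omega, τ, .ite_true h he, hτ⟩
  · obtain ⟨i, hi, τ, he, hτ⟩ := hq h
    exact ⟨i + 1, by omega, τ, .ite_false h he, hτ⟩

theorem runs_loop {c : Test} {p : Prog} {t k : ℕ} (I : ℕ → State → Prop)
    (hstep : ∀ i < k, ∀ σ, I i σ → c.Holds σ ∧ Runs M p σ t (I (i + 1)))
    (hend : ∀ σ, I k σ → ¬ c.Holds σ) {σ : State} (h : I 0 σ) :
    Runs M (.loop c p) σ (k * (t + 1) + 1) (I k) := by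
  have key : ∀ d ≤ k, ∀ σ, I (k - d) σ → Runs M (.loop c p) σ (d * (t + 1) + 1) (I k) := by
    intro d
    induction d with
    | zero => exact fun _ σ h => ⟨1, by omega, σ, .loop_false (hend σ h), h⟩
    | succ d ih =>
      intro hd σ h
      obtain ⟨hc, i, hi, τ, he, hτ⟩ := hstep _ (by omega) σ h
      obtain ⟨i', hi', υ, he', hυ⟩ := ih (by omega) τ (by
        rwa [show k - (d + 1) + 1 = k - d by omega] at hτ)
      exact ⟨i + i' + 1, by rw [Nat.succ_mul]; omega, υ, .loop_true hc he he', hυ⟩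
  exact key k le_rfl σ (by simpa using h)

/-- A sequence of instructions. -/
def block : List Instr → Prog
  | [] => .skip
  | i :: l => .seq (.instr i) (block l)

/-- The sequence `l` of instructions leads from `σ`, without error, to a state with the
property `Q`. -/
def Leads (M : Machine) : List Instr → State → (State → Prop) → Prop
  | [], σ, Q => Q σ
  | i :: l, σ, Q => ∃ τ, i.exec M σ = some τ ∧ Leads M l τ Q

theorem Leads.mono {l : List Instr} {σ : State} {Q R : State → Prop} (h : Leads M l σ Q)
    (hQ : ∀ τ, Q τ → R τ) : Leads M l σ R := by
  induction l generalizing σ with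
  | nil => exact hQ σ h
  | cons i l ih =>
    obtain ⟨τ, he, h⟩ := h
    exact ⟨τ, he, ih h⟩

theorem Leads.append {l l' : List Instr} {σ : State} {Q R : State → Prop} (h : Leads M l σ Q)
    (hQ : ∀ τ, Q τ → Leads M l' τ R) : Leads M (l ++ l') σ R := by
  induction l generalizing σ with
  | nil => exact hQ σ h
  | cons i l ih =>
    obtain ⟨τ, he, h⟩ := h
    exact ⟨τ, he, ih h⟩

theorem Leads.runs {l : List Instr} {σ : State} {Q : State → Prop} (h : Leads M l σ Q) {k : ℕ}
    (hk : l.length ≤ k) : Runs M (block l) σ k Q := by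
  refine Runs.mono (j := l.length) ?_ hk fun _ => id
  clear hk
  induction l generalizing σ with
  | nil => exact runs_skip h
  | cons i l ih =>
    obtain ⟨τ, he, h⟩ := h
    obtain ⟨j, hj, υ, he', hυ⟩ := ih h
    exact ⟨1 + j, by simp only [List.length_cons]; omega, υ, .seq (.instr he) he', hυ⟩

theorem exists_setI_eq {σ : State} {r k : ℕ} {P : State → Prop} :
    (∃ τ, σ.setI M r k = some τ ∧ P τ) ↔
      k < M.wordBound ∧ P { σ with ireg := Function.update σ.ireg r k } := by
  unfold State.setI
  split_ifs with h <;> simp [h]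

end RAM

/-! ### Programs for the queries

Registers 0 to 9 hold the end vertices of the queried edge, `n`, the address of the record, the
constant 64 (the number of cells per pair of vertices), the constants `T + 1` and `T` for
`T = (n + 1) * n`, the constant 1, a loop counter, and the number of edges. Registers 10 to 13 hold
vertices and nodes, and registers from 20 on serve for intermediate results. The real registers 0, 1,
2 hold `Δ` and the capacities of the least cuts that the edge does not leave and that it leaves,
after the change. -/

namespace OracleProgram

open RAM Instr Test

/-- Load the field `g` of the record whose address is in register 3. -/
def field (r g : ℕ) : List Instr := [iconst r g, iadd r r 3, idata r r]

/-- Find the record for the edge given in the registers 0 and 1: load the constants, load the two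
capacities of the edge and compare them. -/
def setup : Prog :=
  .seq (block [iconst 4 64, iconst 7 1, iconst 20 0, idata 2 20, iconst 20 1, idata 6 20,
      iconst 20 2, idata 5 20, iconst 20 3, idata 9 20, imul 3 0 2, iadd 3 3 1, iconst 21 3,
      imul 20 3 21, rdata 1 20, iadd 20 20 7, rdata 2 20, radd 2 2 0, imul 3 3 4, iconst 21 20,
      iadd 3 3 21])
    (.ite (rlt 1 2) .skip
      (.ite (rlt 2 1) (block [iconst 20 22, iadd 3 3 20]) (block [iconst 20 11, iadd 3 3 20])))

/-- Report the capacity of the mincuts. -/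
def capProg : Prog :=
  .seq setup (.seq (block (field 20 0 ++ [iconst 21 0]))
    (.ite (ieq 20 21) (.instr (rout 1)) (.instr (rout 2))))

/-- Report a mincut. -/
def cutProg : Prog :=
  .seq setup (.seq (block (field 10 1 ++ field 11 2 ++ [iconst 8 0]))
    (.loop (ilt 8 11) (block [idata 20 10, iout 20, iadd 10 10 4, iadd 8 8 7])))

/-- Compute the `j`-th piece of the label of the vertex in register 10. -/
def piece (j : ℕ) : List Instr :=
  field 20 (3 + j) ++ field 21 (7 + j) ++
    [imul 22 10 4, iadd 20 20 22, idata 20 20, iadd 21 21 22, idata 21 21, imul 20 20 21]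

/-- Compute the node of the vertex in register 10, in register 12. -/
def node : List Instr :=
  piece 0 ++ ([iconst 21 0, iadd 12 20 21] ++ (piece 1 ++ ([imul 12 12 5, iadd 12 12 20] ++
    (piece 2 ++ ([imul 12 12 5, iadd 12 12 20] ++
      (piece 3 ++ [imul 12 12 5, iadd 12 12 6, isub 12 12 20]))))))

/-- Load the edge with the number in register 8, and its new capacity. -/
def loadEdge : Prog :=
  .seq (block [imul 20 8 4, iconst 21 4, iadd 20 20 21, idata 10 20, iadd 20 20 7, idata 11 20,
      iconst 21 3, imul 20 8 21, iconst 21 2, iadd 20 20 21, rdata 3 20, rsub 4 0 0])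
    (.ite (ieq 10 0) (.ite (ieq 11 1) (.instr (radd 3 3 0)) .skip) .skip)

/-- Report the arc of the edge with the number in register 8, if it has one. The nodes of its end
vertices are computed anew, so that no work memory is needed. -/
def reportArc : Prog :=
  .seq loadEdge (.seq (block (node ++ ([iconst 20 0, iadd 13 12 20, iadd 10 11 20] ++ node)))
    (.ite (rlt 4 3)
      (.ite (ieq 13 12) .skip
        (.ite (ilt 13 12) (block [iout 12, iout 13, rout 3]) (block [iout 13, iout 12, rout 3])))
      .skip))

/-- Report the nodes of all vertices, then all arcs. -/
def dagProg : Prog :=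
  .seq setup (.seq (block [iconst 8 0])
    (.seq (.loop (ilt 8 2)
      (block ([iconst 20 0, iadd 10 8 20] ++ (node ++ [iout 12, iadd 8 8 7]))))
    (.seq (block [iconst 8 0])
      (.loop (ilt 8 9) (.seq reportArc (block [iadd 8 8 7]))))))

end OracleProgram

/-! ### Correctness of the program for the nodes -/

namespace OracleProgram

open RAM Instr Test

variable {M : Machine}

/-- `τ` agrees with `σ` on the output, on the real registers and on the first `20` integer
registers, except possibly register `d`. -/
structure Keeps (d : ℕ) (σ τ : State) : Prop where
  ireg : ∀ r < 20, r ≠ d → τ.ireg r = σ.ireg r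
  rreg : τ.rreg = σ.rreg
  out : τ.out = σ.out

theorem Keeps.trans {d : ℕ} {σ τ υ : State} (h : Keeps d σ τ) (h' : Keeps d τ υ) : Keeps d σ υ :=
  ⟨fun r hr hd => (h'.ireg r hr hd).trans (h.ireg r hr hd), h'.rreg.trans h.rreg,
    h'.out.trans h.out⟩

theorem Keeps.of_le {d : ℕ} {σ τ : State} (h : Keeps 20 σ τ) : Keeps d σ τ :=
  ⟨fun r hr _ => h.ireg r hr hr.ne, h.rreg, h.out⟩

/-- The pieces `f j x` of the labels of the vertices `x < n` can be found from the address `A`. -/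
structure NodeTable (M : Machine) (n T A : ℕ) (f : ℕ → ℕ → ℕ) : Prop where
  address_lt : A + 64 < M.wordBound
  vertex_lt : ∀ x < n, x * 64 < M.wordBound
  label_lt : (((T * (T + 1) + T) * (T + 1) + T) * (T + 1) + T) < M.wordBound
  le : ∀ j x, f j x ≤ T
  piece : ∀ j < 4, ∀ x < n, ∃ p q k l, M.ints[3 + j + A]? = some p ∧ M.ints[7 + j + A]? = some q ∧
    p + x * 64 < M.wordBound ∧ q + x * 64 < M.wordBound ∧
    M.ints[p + x * 64]? = some k ∧ M.ints[q + x * 64]? = some l ∧ k * l = f j x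

/-- The node that the program `node` computes. -/
def nodeValue (T : ℕ) (f : ℕ → ℕ → ℕ) (x : ℕ) : ℕ :=
  ((f 0 x * (T + 1) + f 1 x) * (T + 1) + f 2 x) * (T + 1) + (T - f 3 x)

variable {n T A : ℕ} {f : ℕ → ℕ → ℕ}

theorem leads_piece (h : NodeTable M n T A f) {σ : State} (h3 : σ.ireg 3 = A)
    (h4 : σ.ireg 4 = 64) {x : ℕ} (h10 : σ.ireg 10 = x) (hx : x < n) {j : ℕ} (hj : j < 4) :
    Leads M (piece j) σ fun τ => τ.ireg 20 = f j x ∧ Keeps 20 σ τ := by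
  obtain ⟨p, q, k, l, h1, h2, b1, b2, h5, h6, h7⟩ := h.piece j hj x hx
  have hA := h.address_lt
  have hlab := h.label_lt
  have hle := h.le j x
  have hxb := h.vertex_lt x hx
  have e1 : 3 + j < M.wordBound := by omega
  have e2 : 7 + j < M.wordBound := by omega
  have e3 : 3 + j + A < M.wordBound := by omega
  have e4 : 7 + j + A < M.wordBound := by omega
  have e5 : f j x < M.wordBound := by omega
  simp [piece, field, Leads, Instr.exec, exists_setI_eq, h3, h4, h10, h1, h2, h5, h6,
    h7, e1, e2, e3, e4, e5, hxb, b1, b2]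
  refine ⟨fun r hr _ => ?_, rfl, rfl⟩
  simp [show r ≠ 20 by omega, show r ≠ 21 by omega, show r ≠ 22 by omega]

theorem leads_node (h : NodeTable M n T A f) {σ : State} (h3 : σ.ireg 3 = A)
    (h4 : σ.ireg 4 = 64) (h5 : σ.ireg 5 = T + 1) (h6 : σ.ireg 6 = T) {x : ℕ} (h10 : σ.ireg 10 = x)
    (hx : x < n) : Leads M node σ fun τ => τ.ireg 12 = nodeValue T f x ∧ Keeps 12 σ τ := by
  have hlab := h.label_lt
  have l0 := h.le 0 x
  have l1 := h.le 1 x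
  have l2 := h.le 2 x
  have l3 := h.le 3 x
  have hpiece : ∀ j < 4, ∀ τ, Keeps 12 σ τ → Leads M (piece j) τ fun υ =>
      υ.ireg 20 = f j x ∧ υ.ireg 12 = τ.ireg 12 ∧ υ.ireg 5 = T + 1 ∧ υ.ireg 6 = T ∧
        Keeps 12 σ υ := by
    intro j hj τ hk
    refine (leads_piece h ((hk.ireg 3 (by norm_num) (by norm_num)).trans h3)
      ((hk.ireg 4 (by norm_num) (by norm_num)).trans h4)
      ((hk.ireg 10 (by norm_num) (by norm_num)).trans h10) hx hj).mono fun υ ⟨hv, hk'⟩ => ?_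
    have hk2 := hk.trans hk'.of_le
    exact ⟨hv, hk'.ireg 12 (by norm_num) (by norm_num),
      (hk2.ireg 5 (by norm_num) (by norm_num)).trans h5,
      (hk2.ireg 6 (by norm_num) (by norm_num)).trans h6, hk2⟩
  have b1 : f 0 x * (T + 1) ≤ T * (T + 1) := Nat.mul_le_mul_right _ l0
  have b2 : (f 0 x * (T + 1) + f 1 x) * (T + 1) ≤ (T * (T + 1) + T) * (T + 1) :=
    Nat.mul_le_mul_right _ (by omega)
  have b3 : ((f 0 x * (T + 1) + f 1 x) * (T + 1) + f 2 x) * (T + 1) ≤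
    ((T * (T + 1) + T) * (T + 1) + T) * (T + 1) := Nat.mul_le_mul_right _ (by omega)
  have c1 : T * (T + 1) + T ≤ (T * (T + 1) + T) * (T + 1) := Nat.le_mul_of_pos_right _ T.succ_pos
  have c2 : (T * (T + 1) + T) * (T + 1) + T ≤ ((T * (T + 1) + T) * (T + 1) + T) * (T + 1) :=
    Nat.le_mul_of_pos_right _ T.succ_pos
  have keep : ∀ τ : State, Keeps 12 σ τ → ∀ k, Keeps 12 σ
      { τ with ireg := Function.update τ.ireg 12 k } := fun τ hk k =>
    ⟨fun r hr hne => by simpa [Function.update_of_ne hne] using hk.ireg r hr hne, hk.rreg, hk.out⟩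
  unfold node
  refine (hpiece 0 (by norm_num) σ ⟨fun _ _ _ => rfl, rfl, rfl⟩).append
    fun τ ⟨v0, _, k5, k6, hk⟩ => ?_
  refine Leads.append (Q := fun τ => τ.ireg 12 = f 0 x ∧ Keeps 12 σ τ) ?_ fun τ ⟨v0, hk⟩ => ?_
  · simp [Leads, Instr.exec, exists_setI_eq, v0]
    refine ⟨by omega, by omega, fun r hr hne => ?_, hk.rreg, hk.out⟩
    simpa [Function.update_apply, hne, show r ≠ 21 by omega] using hk.ireg r hr hne
  refine (hpiece 1 (by norm_num) τ hk).append fun τ ⟨v1, k12, k5, k6, hk⟩ => ?_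
  rw [v0] at k12
  refine Leads.append (Q := fun τ => τ.ireg 12 = f 0 x * (T + 1) + f 1 x ∧ Keeps 12 σ τ) ?_
    fun τ ⟨v1, hk⟩ => ?_
  · simp [Leads, Instr.exec, exists_setI_eq, v1, k12, k5]
    exact ⟨by omega, by omega, keep τ hk _⟩
  refine (hpiece 2 (by norm_num) τ hk).append fun τ ⟨v2, k12, k5, k6, hk⟩ => ?_
  rw [v1] at k12
  refine Leads.append (Q := fun τ => τ.ireg 12 = (f 0 x * (T + 1) + f 1 x) * (T + 1) + f 2 x ∧
    Keeps 12 σ τ) ?_ fun τ ⟨v2, hk⟩ => ?_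
  · simp [Leads, Instr.exec, exists_setI_eq, v2, k12, k5]
    exact ⟨by omega, by omega, keep τ hk _⟩
  refine (hpiece 3 (by norm_num) τ hk).append fun τ ⟨v3, k12, k5, k6, hk⟩ => ?_
  rw [v2] at k12
  simp [Leads, Instr.exec, exists_setI_eq, v3, k12, k5, k6]
  refine ⟨by omega, by omega, by omega, ?_, keep τ hk _⟩
  rw [nodeValue]
  omega

end OracleProgram

/-! ### Correctness of the programs for the capacity and for a mincut -/

namespace OracleProgram

open RAM Instr Test

variable {M : Machine}

/-- The state after `setup`: the record for the query has the address `A`, the least cuts that the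
edge leaves have the capacity `b` after the change, the other ones have the capacity `a`. -/
structure Ready (u v n m T A : ℕ) (a b Δ : ℝ) (σ : State) : Prop where
  r0 : σ.ireg 0 = u
  r1 : σ.ireg 1 = v
  r2 : σ.ireg 2 = n
  r3 : σ.ireg 3 = A
  r4 : σ.ireg 4 = 64
  r5 : σ.ireg 5 = T + 1
  r6 : σ.ireg 6 = T
  r7 : σ.ireg 7 = 1
  r9 : σ.ireg 9 = m
  q0 : σ.rreg 0 = Δ
  q1 : σ.rreg 1 = a
  q2 : σ.rreg 2 = b

variable {u v n m T A : ℕ} {a b Δ : ℝ}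

theorem Ready.congr {σ τ : State} (h : Ready u v n m T A a b Δ σ)
    (hi : ∀ r < 10, r ≠ 8 → τ.ireg r = σ.ireg r) (hr : ∀ q < 3, τ.rreg q = σ.rreg q) :
    Ready u v n m T A a b Δ τ := by
  constructor
  · rw [hi _ (by norm_num) (by norm_num), h.r0]
  · rw [hi _ (by norm_num) (by norm_num), h.r1]
  · rw [hi _ (by norm_num) (by norm_num), h.r2]
  · rw [hi _ (by norm_num) (by norm_num), h.r3]
  · rw [hi _ (by norm_num) (by norm_num), h.r4]
  · rw [hi _ (by norm_num) (by norm_num), h.r5]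
  · rw [hi _ (by norm_num) (by norm_num), h.r6]
  · rw [hi _ (by norm_num) (by norm_num), h.r7]
  · rw [hi _ (by norm_num) (by norm_num), h.r9]
  · rw [hr _ (by norm_num), h.q0]
  · rw [hr _ (by norm_num), h.q1]
  · rw [hr _ (by norm_num), h.q2]

/-- The constants that `setup` loads. -/
structure Header (M : Machine) (n m T : ℕ) : Prop where
  ints0 : M.ints[0]? = some n
  ints1 : M.ints[1]? = some T
  ints2 : M.ints[2]? = some (T + 1)
  ints3 : M.ints[3]? = some m
  address_lt : ∀ u < n, ∀ v < n, (u * n + v) * 64 + 128 < M.wordBound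
  edge_lt : ∀ p < m, p * 64 + 128 < M.wordBound

theorem runs_setup (h : Header M n m T) {σ : State} (hu : u < n) (hv : v < n)
    (h0 : σ.ireg 0 = u) (h1 : σ.ireg 1 = v) (hΔ : σ.rreg 0 = Δ) (hout : σ.out = [])
    (ha : M.reals[(u * n + v) * 3]? = some a) (hb : M.reals[(u * n + v) * 3 + 1]? = some b) :
    Runs M setup σ 30 fun τ => τ.out = [] ∧
      Ready u v n m T ((u * n + v) * 64 + 20 + 11 * (STNetwork.outcome a (b + Δ) : ℕ)) a (b + Δ) Δ
        τ := by
  have hW := h.address_lt u hu v hv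
  have e1 : ∀ k ≤ 128, k < M.wordBound := fun k hk => by omega
  have e2 : u * n < M.wordBound := by omega
  have e3 : u * n + v < M.wordBound := by omega
  have e4 : (u * n + v) * 3 < M.wordBound := by omega
  have e5 : (u * n + v) * 3 + 1 < M.wordBound := by omega
  have e6 : (u * n + v) * 64 < M.wordBound := by omega
  have e7 : (u * n + v) * 64 + 20 < M.wordBound := by omega
  refine Runs.mono (j := 21 + (3 + 1 + 1)) (Runs.seq (Leads.runs (Q := fun τ => τ.out = [] ∧
    Ready u v n m T ((u * n + v) * 64 + 20) a (b + Δ) Δ τ) ?_ le_rfl) ?_) (by norm_num) fun _ => id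
  · simp [Leads, Instr.exec, exists_setI_eq, h0, h1, hΔ, h.ints0, h.ints1, h.ints2, h.ints3,
      State.setR, ha, hb, e1, e2, e3, e4, e5, e6, e7, hout]
    constructor <;> simp [h0, h1, hΔ]
  · rintro τ ⟨hout, hr⟩
    have hadd : ∀ k ≤ 22, Leads M [iconst 20 k, iadd 3 3 20] τ fun υ => υ.out = [] ∧
        Ready u v n m T ((u * n + v) * 64 + 20 + k) a (b + Δ) Δ υ := by
      intro k hk
      have e8 : (u * n + v) * 64 + 20 + k < M.wordBound := by omega
      simp [Leads, Instr.exec, exists_setI_eq, hr.r3, e1 k (by omega), e8, hout]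
      constructor <;>
        simp [hr.r0, hr.r1, hr.r2, hr.r4, hr.r5, hr.r6, hr.r7, hr.r9, hr.q0, hr.q1, hr.q2]
    refine runs_ite (fun hc => ?_) fun hc => runs_ite (fun hc' => ?_) fun hc' => ?_
    · simp only [Test.Holds, hr.q1, hr.q2] at hc
      refine runs_skip ⟨hout, ?_⟩
      simpa [STNetwork.outcome, hc] using hr
    · simp only [Test.Holds, hr.q1, hr.q2] at hc hc'
      refine (hadd 22 le_rfl).runs (by norm_num) |>.mono le_rfl fun υ hυ => ?_
      simpa [STNetwork.outcome, hc, hc'] using hυ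
    · simp only [Test.Holds, hr.q1, hr.q2] at hc hc'
      refine (hadd 11 (by norm_num)).runs (by norm_num) |>.mono le_rfl fun υ hυ => ?_
      simpa [STNetwork.outcome, hc, hc'] using hυ

theorem runs_capProg_of_ready {σ : State} (hσ : Ready u v n m T A a b Δ σ) (hout : σ.out = [])
    (hA : A < M.wordBound) {k : ℕ} (hk : M.ints[A]? = some k) :
    Runs M (.seq (block (field 20 0 ++ [iconst 21 0]))
      (.ite (ieq 20 21) (.instr (rout 1)) (.instr (rout 2)))) σ 10 fun τ =>
        τ.out = [Sum.inr (if k = 0 then a else b)] := by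
  have hW : 0 < M.wordBound := by omega
  refine Runs.mono (j := 4 + (1 + 1)) (Runs.seq (Leads.runs (Q := fun τ => τ.ireg 20 = k ∧
    τ.ireg 21 = 0 ∧ τ.rreg 1 = a ∧ τ.rreg 2 = b ∧ τ.out = []) ?_ le_rfl) ?_) (by norm_num)
      fun _ => id
  · simp [field, Leads, Instr.exec, exists_setI_eq, hσ.r3, hA, hW, hk, hσ.q1, hσ.q2, hout]
  · rintro τ ⟨h20, h21, h1, h2, hout⟩
    refine runs_ite (fun hc => ?_) fun hc => ?_
    · simp only [Test.Holds, h20, h21] at hc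
      exact ⟨1, le_rfl, _, .instr rfl, by simp [hc, h1, hout]⟩
    · simp only [Test.Holds, h20, h21] at hc
      exact ⟨1, le_rfl, _, .instr rfl, by simp [hc, h2, hout]⟩

theorem runs_cutProg_of_ready {σ : State} (hσ : Ready u v n m T A a b Δ σ) (hout : σ.out = [])
    (hA : A + 2 < M.wordBound) {p k : ℕ} (hp : M.ints[1 + A]? = some p)
    (hk : M.ints[2 + A]? = some k) (hkW : p + k * 64 < M.wordBound)
    {L : ℕ → ℕ} (hL : ∀ i < k, M.ints[p + i * 64]? = some (L i)) :
    Runs M (.seq (block (field 10 1 ++ field 11 2 ++ [iconst 8 0]))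
      (.loop (ilt 8 11) (block [idata 20 10, iout 20, iadd 10 10 4, iadd 8 8 7]))) σ (k * 5 + 8)
        fun τ => τ.out = (List.range k).map fun i => Sum.inl (L i) := by
  let I : ℕ → State → Prop := fun i τ => τ.ireg 8 = i ∧ τ.ireg 11 = k ∧ τ.ireg 10 = p + i * 64 ∧
    τ.ireg 4 = 64 ∧ τ.ireg 7 = 1 ∧ τ.out = (List.range i).map fun i => Sum.inl (L i)
  have h1 : 1 < M.wordBound := by omega
  have h2 : 2 < M.wordBound := by omega
  have h0 : 0 < M.wordBound := by omega
  have h3 : 1 + A < M.wordBound := by omega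
  have h4 : 2 + A < M.wordBound := by omega
  refine Runs.mono (j := 7 + (k * (4 + 1) + 1)) (Runs.seq (Leads.runs (Q := I 0) ?_ le_rfl)
    fun τ hτ => (runs_loop I (fun i hi τ hτ => ?_) (fun τ hτ => ?_) hτ)) (by omega)
    fun τ hτ => hτ.2.2.2.2.2
  · simp [field, Leads, Instr.exec, exists_setI_eq, hσ.r3, hp, hk, I, hσ.r4, hσ.r7, hout, h0, h1,
      h2, h3, h4]
  · obtain ⟨h8, h11, h10, h4, h7, hout⟩ := hτ
    refine ⟨by simpa [Test.Holds, h8, h11] using hi, Leads.runs ?_ le_rfl⟩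
    have e1 : p + i * 64 + 64 < M.wordBound ∧ i + 1 < M.wordBound := by
      constructor <;> nlinarith
    simp [Leads, Instr.exec, exists_setI_eq, h8, h11, h10, h4, h7, hL i hi, I, hout, e1,
      List.range_succ]
    ring
  · simp [Test.Holds, hτ.1, hτ.2.1]

end OracleProgram

/-! ### Correctness of the program for the DAG -/

namespace OracleProgram

open RAM Instr Test

variable {M : Machine} {u v n m T A : ℕ} {a b Δ : ℝ} {f : ℕ → ℕ → ℕ}

theorem Ready.of_keeps {d : ℕ} (hd : 10 ≤ d) {σ τ : State} (h : Ready u v n m T A a b Δ σ)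
    (hk : Keeps d σ τ) : Ready u v n m T A a b Δ τ :=
  h.congr (fun r hr _ => hk.ireg r (by omega) (by omega)) fun q _ => by rw [hk.rreg]

/-- What `reportArc` reports for an edge from `x` to `y` of capacity `w`, when `N` gives the
nodes. -/
noncomputable def arcOutput (N : ℕ → ℕ) (x y : ℕ) (w : ℝ) : List (ℕ ⊕ ℝ) :=
  open Classical in
  if 0 < w then
    if N x = N y then [] else
      if N x < N y then [Sum.inl (N y), Sum.inl (N x), Sum.inr w]
      else [Sum.inl (N x), Sum.inl (N y), Sum.inr w]
  else []

/-- The edge number `p` leads from `x` to `y` and has the capacity `w`. -/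
structure EdgeAt (M : Machine) (n p x y : ℕ) (w : ℝ) : Prop where
  tail_lt : x < n
  head_lt : y < n
  tail : M.ints[p * 64 + 4]? = some x
  head : M.ints[p * 64 + 4 + 1]? = some y
  cap : M.reals[p * 3 + 2]? = some w

theorem runs_loadEdge (h : Header M n m T) {σ : State} (hσ : Ready u v n m T A a b Δ σ) {p x y : ℕ}
    (h8 : σ.ireg 8 = p) (hp : p < m) {w : ℝ} (he : EdgeAt M n p x y w) :
    Runs M loadEdge σ 15 fun τ => Ready u v n m T A a b Δ τ ∧ τ.ireg 8 = p ∧ τ.out = σ.out ∧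
      τ.ireg 10 = x ∧ τ.ireg 11 = y ∧ τ.rreg 3 = (if x = u ∧ y = v then w + Δ else w) ∧
      τ.rreg 4 = 0 := by
  have hW := h.edge_lt p hp
  have e1 : ∀ k ≤ 128, k < M.wordBound := fun k hk => by omega
  have e2 : p * 64 < M.wordBound := by omega
  have e3 : p * 64 + 4 < M.wordBound := by omega
  have e4 : p * 64 + 4 + 1 < M.wordBound := by omega
  have e5 : p * 3 < M.wordBound := by omega
  have e6 : p * 3 + 2 < M.wordBound := by omega
  refine Runs.mono (j := 12 + (1 + 1 + 1)) (Runs.seq (Leads.runs (Q := fun τ =>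
    Ready u v n m T A a b Δ τ ∧ τ.ireg 8 = p ∧ τ.out = σ.out ∧ τ.ireg 10 = x ∧ τ.ireg 11 = y ∧
      τ.rreg 3 = w ∧ τ.rreg 4 = 0) ?_ le_rfl) ?_) le_rfl fun _ => id
  · simp [Leads, Instr.exec, exists_setI_eq, h8, hσ.r4, hσ.r7, he.tail, he.head,
      he.cap, e1, e2, e3, e4, e5, e6, State.setR]
    refine hσ.congr (fun r hr hne => ?_) fun q hq => ?_
    · simp [show r ≠ 20 by omega, show r ≠ 21 by omega, show r ≠ 10 by omega,
        show r ≠ 11 by omega]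
    · simp [show q ≠ 3 by omega, show q ≠ 4 by omega]
  · rintro τ ⟨hτ, h8, hout, h10, h11, h3, h4⟩
    refine runs_ite (fun hc => runs_ite (fun hc' => ?_) fun hc' => ?_) fun hc => ?_
    · simp only [Test.Holds, h10, h11, hτ.r0, hτ.r1] at hc hc'
      refine ⟨1, le_rfl, _, .instr rfl, hτ.congr (fun _ _ _ => rfl) (fun q hq => ?_), h8, hout, h10,
        h11, ?_, ?_⟩
      · simp [State.setR, show q ≠ 3 by omega]
      · simp [State.setR, hc, hc', h3, hτ.q0]
      · simp [State.setR, h4]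
    · simp only [Test.Holds, h10, h11, hτ.r0, hτ.r1] at hc hc'
      exact runs_skip ⟨hτ, h8, hout, h10, h11, by simp [hc', h3], h4⟩
    · simp only [Test.Holds, h10, hτ.r0] at hc
      exact runs_skip ⟨hτ, h8, hout, h10, h11, by simp [hc, h3], h4⟩

theorem node_length : node.length = 57 := rfl

theorem runs_reportArc (h : Header M n m T) (hN : NodeTable M n T A f) {σ : State}
    (hσ : Ready u v n m T A a b Δ σ) {p x y : ℕ} (h8 : σ.ireg 8 = p) (hp : p < m) {w : ℝ}
    (he : EdgeAt M n p x y w) :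
    Runs M reportArc σ 140 fun τ => Ready u v n m T A a b Δ τ ∧ τ.ireg 8 = p ∧
      τ.out = σ.out ++ arcOutput (nodeValue T f) x y (if x = u ∧ y = v then w + Δ else w) := by
  generalize hw' : (if x = u ∧ y = v then w + Δ else w) = w'
  refine Runs.mono (j := 15 + (117 + (3 + 1 + 1 + 1))) (Runs.seq (runs_loadEdge h hσ h8 hp he)
    fun τ ⟨hτ, h8, hout, h10, h11, h3, h4⟩ => Runs.seq (Leads.runs (Q := fun τ =>
      Ready u v n m T A a b Δ τ ∧ τ.ireg 8 = p ∧ τ.out = σ.out ∧ τ.ireg 13 = nodeValue T f x ∧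
      τ.ireg 12 = nodeValue T f y ∧ τ.rreg 3 = w' ∧ τ.rreg 4 = 0) ?_ (by simp [node_length])) ?_)
    (by norm_num) fun _ => id
  · rw [hw'] at h3
    refine (leads_node hN hτ.r3 hτ.r4 hτ.r5 hτ.r6 h10 he.tail_lt).append fun υ ⟨h12, hk⟩ => ?_
    have hυ := hτ.of_keeps (by norm_num) hk
    have k8 := hk.ireg 8 (by norm_num) (by norm_num)
    have k11 := hk.ireg 11 (by norm_num) (by norm_num)
    refine Leads.append (Q := fun ω => Ready u v n m T A a b Δ ω ∧ ω.ireg 8 = p ∧ ω.out = σ.out ∧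
      ω.ireg 13 = nodeValue T f x ∧ ω.ireg 10 = y ∧ ω.rreg 3 = w' ∧ ω.rreg 4 = 0) ?_
      fun ω ⟨hω, h8, hout, h13, h10, h3, h4⟩ => ?_
    · have hW := hN.address_lt
      have e1 : nodeValue T f x < M.wordBound := by
        refine lt_of_le_of_lt ?_ hN.label_lt
        unfold nodeValue
        gcongr
        exacts [hN.le _ _, hN.le _ _, hN.le _ _, Nat.sub_le _ _]
      have e2 : y < M.wordBound := by
        have := hN.vertex_lt y he.head_lt
        omega
      simp [Leads, Instr.exec, exists_setI_eq, h12, k11, h11, k8, h8, hk.out, hout, hk.rreg, h3, h4,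
        e1, e2, show 0 < M.wordBound by omega]
      refine hυ.congr (fun r hr hne => ?_) fun q hq => by rw [hk.rreg]
      simp [show r ≠ 20 by omega, show r ≠ 13 by omega, show r ≠ 10 by omega]
    · refine (leads_node hN hω.r3 hω.r4 hω.r5 hω.r6 h10 he.head_lt).mono fun ψ ⟨h12, hk⟩ => ?_
      exact ⟨hω.of_keeps (by norm_num) hk, (hk.ireg 8 (by norm_num) (by norm_num)).trans h8,
        hk.out.trans hout, (hk.ireg 13 (by norm_num) (by norm_num)).trans h13, h12,
        by rw [hk.rreg, h3], by rw [hk.rreg, h4]⟩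
  · rintro τ ⟨hτ, h8, hout, h13, h12, h3, h4⟩
    have hlead : ∀ i j, Leads M [iout i, iout j, rout 3] τ fun υ =>
        Ready u v n m T A a b Δ υ ∧ υ.ireg 8 = p ∧
        υ.out = σ.out ++ [Sum.inl (τ.ireg i), Sum.inl (τ.ireg j), Sum.inr w'] := by
      intro i j
      simp [Leads, Instr.exec, h8, hout, h3]
      exact hτ.congr (fun _ _ _ => rfl) fun _ _ => rfl
    refine runs_ite (fun hc => runs_ite (fun hc' => ?_) fun hc' => runs_ite (fun hc'' => ?_)
      fun hc'' => ?_) fun hc => ?_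
    · simp only [Test.Holds, h3, h4, h12, h13] at hc hc'
      exact runs_skip ⟨hτ, h8, by simp [arcOutput, hc', hout]⟩
    · refine ((hlead 12 13).runs le_rfl).mono (by norm_num) fun υ ⟨hυ, k8, kout⟩ => ?_
      simp only [Test.Holds, h3, h4, h12, h13] at hc hc' hc''
      exact ⟨hυ, k8, by simp [arcOutput, hc, hc', hc'', kout, h12, h13]⟩
    · refine ((hlead 13 12).runs le_rfl).mono (by norm_num) fun υ ⟨hυ, k8, kout⟩ => ?_
      simp only [Test.Holds, h3, h4, h12, h13] at hc hc' hc''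
      exact ⟨hυ, k8, by simp [arcOutput, hc, hc', hc'', kout, h12, h13]⟩
    · simp only [Test.Holds, h3, h4] at hc
      exact runs_skip ⟨hτ, h8, by simp [arcOutput, hc, hout]⟩

theorem runs_dagProg_of_ready (h : Header M n m T) (hN : NodeTable M n T A f) {σ : State}
    (hσ : Ready u v n m T A a b Δ σ) (hout : σ.out = []) (hn : n < M.wordBound)
    {x y : ℕ → ℕ} {w : ℕ → ℝ} (he : ∀ p < m, EdgeAt M n p (x p) (y p) (w p)) :
    Runs M (.seq (block [iconst 8 0])
      (.seq (.loop (ilt 8 2)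
        (block ([iconst 20 0, iadd 10 8 20] ++ (node ++ [iout 12, iadd 8 8 7]))))
      (.seq (block [iconst 8 0])
        (.loop (ilt 8 9) (.seq reportArc (block [iadd 8 8 7]))))))
      σ (n * 62 + m * 142 + 4) fun τ => τ.out =
        ((List.range n).map fun x => Sum.inl (nodeValue T f x)) ++
        (List.range m).flatMap fun p => arcOutput (nodeValue T f) (x p) (y p)
          (if x p = u ∧ y p = v then w p + Δ else w p) := by
  have hW := hN.address_lt
  have h0 : 0 < M.wordBound := by omega
  let N : ℕ → List (ℕ ⊕ ℝ) := fun i => (List.range i).map fun x => Sum.inl (nodeValue T f x)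
  let I : ℕ → State → Prop := fun i τ => Ready u v n m T A a b Δ τ ∧ τ.ireg 8 = i ∧ τ.out = N i
  let J : ℕ → State → Prop := fun i τ => Ready u v n m T A a b Δ τ ∧ τ.ireg 8 = i ∧
    τ.out = N n ++ (List.range i).flatMap fun p => arcOutput (nodeValue T f) (x p) (y p)
          (if x p = u ∧ y p = v then w p + Δ else w p)
  have hinit : ∀ σ, Ready u v n m T A a b Δ σ → Leads M [iconst 8 0] σ fun τ =>
      Ready u v n m T A a b Δ τ ∧ τ.ireg 8 = 0 ∧ τ.out = σ.out := by
    intro σ hσ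
    simp [Leads, Instr.exec, exists_setI_eq, h0]
    refine hσ.congr (fun r hr hne => ?_) fun q hq => rfl
    simp [hne]
  have hincr : ∀ σ, Ready u v n m T A a b Δ σ → ∀ k, σ.ireg 8 = k → k + 1 < M.wordBound →
      Leads M [iadd 8 8 7] σ fun τ => Ready u v n m T A a b Δ τ ∧ τ.ireg 8 = k + 1 ∧
        τ.out = σ.out := by
    intro σ hσ k hk hkW
    simp [Leads, Instr.exec, exists_setI_eq, hk, hσ.r7, hkW]
    refine hσ.congr (fun r hr hne => ?_) fun q hq => rfl
    simp [hne]
  refine Runs.mono (j := 1 + ((n * (61 + 1) + 1) + (1 + (m * (140 + 1 + 1) + 1))))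
    (Runs.seq (Q := I 0) ?_ fun τ hτ => Runs.seq (Q := I n) ?_ fun υ hυ =>
      Runs.seq (Q := J 0) ?_ fun ω hω => runs_loop J (fun p hp τ hτ => ?_) (fun τ hτ => ?_) hω)
    (by omega) fun τ hτ => hτ.2.2
  · exact (hinit σ hσ).runs le_rfl |>.mono le_rfl fun τ hτ => ⟨hτ.1, hτ.2.1, hτ.2.2.trans hout⟩
  · refine runs_loop I (fun i hi τ hτ => ⟨?_, Leads.runs ?_ (by simp [node_length])⟩)
      (fun τ hτ => ?_) hτ
    · simpa [Test.Holds, hτ.2.1, hτ.1.r2] using hi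
    · obtain ⟨hτ, h8, hout⟩ := hτ
      refine Leads.append (Q := fun υ => Ready u v n m T A a b Δ υ ∧ υ.ireg 8 = i ∧ υ.out = N i ∧
        υ.ireg 10 = i) ?_ fun υ ⟨hυ, h8, hout, h10⟩ => ?_
      · simp [Leads, Instr.exec, exists_setI_eq, h8, hout, h0, hi.trans hn]
        refine hτ.congr (fun r hr hne => ?_) fun q hq => rfl
        simp [show r ≠ 20 by omega, show r ≠ 10 by omega]
      refine (leads_node hN hυ.r3 hυ.r4 hυ.r5 hυ.r6 h10 hi).append fun ω ⟨h12, hk⟩ => ?_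
      refine Leads.append (l := [iout 12]) (Q := fun ψ => Ready u v n m T A a b Δ ψ ∧
        ψ.ireg 8 = i ∧ ψ.out = N (i + 1)) ?_ fun ψ ⟨hψ, h8, hout⟩ => ?_
      · simp only [Leads, Instr.exec, Option.some.injEq, exists_eq_left']
        refine ⟨(hυ.of_keeps (by norm_num) hk).congr (fun _ _ _ => rfl) fun _ _ => rfl,
          (hk.ireg 8 (by norm_num) (by norm_num)).trans h8, ?_⟩
        simp [hk.out, hout, h12, N, List.range_succ]
      · exact (hincr ψ hψ i h8 (by omega)).mono fun χ hχ => ⟨hχ.1, hχ.2.1, hχ.2.2.trans hout⟩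
    · simp [Test.Holds, hτ.2.1, hτ.1.r2]
  · exact (hinit υ hυ.1).runs le_rfl |>.mono le_rfl fun τ hτ =>
      ⟨hτ.1, hτ.2.1, by rw [hτ.2.2, hυ.2.2]; simp⟩
  · obtain ⟨hτ, h8, hout⟩ := hτ
    refine ⟨by simpa [Test.Holds, h8, hτ.r9] using hp, ?_⟩
    refine Runs.seq (runs_reportArc h hN hτ h8 hp (he p hp)) fun υ ⟨hυ, h8, kout⟩ => ?_
    refine (hincr υ hυ p h8 ?_).runs le_rfl |>.mono le_rfl fun ψ hψ => ⟨hψ.1, hψ.2.1, ?_⟩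
    · have := h.edge_lt p hp
      omega
    · rw [hψ.2.2, kout, hout, List.append_assoc, List.range_succ, List.flatMap_append]
      simp
  · simp [Test.Holds, hτ.2.1, hτ.1.r9]

end OracleProgram

/-! ### The memory layout -/

/-- A three-dimensional array, as a list. -/
def grid {α : Type*} (n R : ℕ) (c : Fin n → Fin n → Fin R → α) : List α :=
  List.ofFn fun i : Fin (n * n * R) => c i.divNat.divNat i.divNat.modNat i.modNat

theorem length_grid {α : Type*} (n R : ℕ) (c : Fin n → Fin n → Fin R → α) :
    (grid n R c).length = n * n * R := by
  simp [grid]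

theorem exists_of_mem_grid {α : Type*} {n R : ℕ} {c : Fin n → Fin n → Fin R → α} {x : α}
    (h : x ∈ grid n R c) : ∃ a b f, c a b f = x := by
  obtain ⟨i, rfl⟩ := (List.mem_ofFn' _ _).1 h
  exact ⟨_, _, _, rfl⟩

theorem getElem?_grid {α : Type*} {n R : ℕ} (c : Fin n → Fin n → Fin R → α) (a b : Fin n)
    (f : Fin R) : (grid n R c)[((a : ℕ) * n + b) * R + f]? = some (c a b f) := by
  have ha := a.2
  have hb := b.2
  have hf := f.2
  have h1 : (a : ℕ) * n + b < n * n := by nlinarith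
  have h2 : ((a : ℕ) * n + b) * R + f < n * n * R := by nlinarith
  have e1 : (((a : ℕ) * n + b) * R + f) / R = a * n + b := by
    rw [add_comm, Nat.add_mul_div_right _ _ (by omega), Nat.div_eq_of_lt hf, zero_add]
  have e2 : (((a : ℕ) * n + b) * R + f) % R = f := by
    rw [add_comm, Nat.add_mul_mod_self_right, Nat.mod_eq_of_lt hf]
  have e3 : ((a : ℕ) * n + b) / n = a := by
    rw [add_comm, Nat.add_mul_div_right _ _ (by omega), Nat.div_eq_of_lt hb, zero_add]
  have e4 : ((a : ℕ) * n + b) % n = b := by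
    rw [add_comm, Nat.add_mul_mod_self_right, Nat.mod_eq_of_lt hb]
  rw [grid, List.getElem?_ofFn, dif_pos h2]
  congr 1
  have i1 : (⟨_, h2⟩ : Fin (n * n * R)).divNat = ⟨_, h1⟩ := Fin.ext e1
  have i2 : (⟨_, h2⟩ : Fin (n * n * R)).modNat = f := Fin.ext e2
  have i3 : (⟨_, h1⟩ : Fin (n * n)).divNat = a := Fin.ext e3
  have i4 : (⟨_, h1⟩ : Fin (n * n)).modNat = b := Fin.ext e4
  rw [i1, i2, i3, i4]

namespace STNetwork

variable {n : ℕ}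

/-- The address of the cell for the vertex `0` in row `k` of the `i`-th table. -/
def rowAddress (n i k : ℕ) : ℕ := k * n * 64 + i

/-- The words in which a record is stored. -/
def Record.word (r : Record (Fin 10) (Fin 4) n) (cut : Fin 4 → Fin n → Finset (Fin n)) : ℕ → ℕ
  | 0 => if r.leaves then 1 else 0
  | 1 => rowAddress n (16 + r.cut.1) r.cut.2
  | 2 => (cut r.cut.1 r.cut.2).card
  | 3 => rowAddress n (6 + (r.mask 0).1) (r.mask 0).2
  | 4 => rowAddress n (6 + (r.mask 1).1) (r.mask 1).2
  | 5 => rowAddress n (6 + (r.mask 2).1) (r.mask 2).2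
  | 6 => rowAddress n (6 + (r.mask 3).1) (r.mask 3).2
  | 7 => rowAddress n (6 + (r.label 0).1) (r.label 0).2
  | 8 => rowAddress n (6 + (r.label 1).1) (r.label 1).2
  | 9 => rowAddress n (6 + (r.label 2).1) (r.label 2).2
  | 10 => rowAddress n (6 + (r.label 3).1) (r.label 3).2
  | _ => 0

/-- The edge with the number `q`, in some enumeration of the edges. -/
noncomputable def edgeAt (G : STNetwork n) (q : ℕ) : Fin n × Fin n :=
  G.edges.toList.getD q (G.source, G.source)

/-- The integer in the cell with the indices `a`, `b`, `f`. For `f < 4` this is a constant, for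
`f = 4` and `f = 5` an end vertex of the edge with the number `a * n + b`, for `6 ≤ f < 16` the entry
for the vertex `b` in row `a` of a table, for `16 ≤ f < 20` the vertex with the number `b` in a cut,
and for `20 ≤ f < 53` a part of one of the three records for the edge `(a, b)`. -/
noncomputable def intCell (G : STNetwork n) (row : Fin 10 → Fin n → Fin n → ℕ)
    (cut : Fin 4 → Fin n → Finset (Fin n)) (r : Fin n → Fin n → Fin 3 → Record (Fin 10) (Fin 4) n)
    (a b : Fin n) (f : Fin 64) : ℕ :=
  if f.val = 0 then n
  else if f.val = 1 then (n + 1) * n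
  else if f.val = 2 then (n + 1) * n + 1
  else if f.val = 3 then G.edges.card
  else if f.val = 4 then (G.edgeAt (a * n + b)).1
  else if f.val = 5 then (G.edgeAt (a * n + b)).2
  else if f.val < 16 then row (Fin.ofNat 10 (f.val - 6)) a b
  else if f.val < 20 then (cut (Fin.ofNat 4 (f.val - 16)) a).toList.getD b G.source
  else if f.val < 53 then
    (r a b (Fin.ofNat 3 ((f.val - 20) / 11))).word cut ((f.val - 20) % 11)
  else 0

/-- The real in the cell with the indices `a`, `b`, `f`: the capacities that belong to the edge
`(a, b)`, or the capacity of the edge with the number `a * n + b`. -/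
noncomputable def realCell (G : STNetwork n) (α β : Fin n → Fin n → ℝ) (a b : Fin n) (f : Fin 3) :
    ℝ :=
  if f = 0 then α a b
  else if f = 1 then β a b
  else if (a * n + b : ℕ) < G.edges.card then
    G.cap (G.edgeAt (a * n + b)).1 (G.edgeAt (a * n + b)).2
  else 0

/-- The data structure. -/
noncomputable def oracle (G : STNetwork n) (row : Fin 10 → Fin n → Fin n → ℕ)
    (cut : Fin 4 → Fin n → Finset (Fin n)) (r : Fin n → Fin n → Fin 3 → Record (Fin 10) (Fin 4) n)
    (α β : Fin n → Fin n → ℝ) : OracleData where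
  ints := grid n 64 (G.intCell row cut r)
  reals := grid n 3 (G.realCell α β)

theorem two_le (G : STNetwork n) : 2 ≤ n := by
  have h1 := G.source.2
  have h2 := G.sink.2
  have h3 : (G.source : ℕ) ≠ G.sink := fun h => G.source_ne_sink (Fin.ext h)
  omega

theorem card_edges_le (G : STNetwork n) : G.edges.card ≤ n ^ 2 := by
  have := Finset.card_le_univ G.edges
  simpa [sq] using this

theorem edgeAt_mem (G : STNetwork n) {q : ℕ} (hq : q < G.edges.card) : G.edgeAt q ∈ G.edges := by
  have hq' : q < G.edges.toList.length := by simpa using hq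
  rw [edgeAt, List.getD_eq_getElem _ _ hq', ← Finset.mem_toList]
  exact List.getElem_mem hq'

theorem map_edgeAt_range (G : STNetwork n) :
    (List.range G.edges.card).map G.edgeAt = G.edges.toList := by
  refine List.ext_getElem (by simp) fun q h1 h2 => ?_
  simp [edgeAt, List.getElem?_eq_getElem h2]

theorem pow_bound (G : STNetwork n) {K : ℕ} (hK : 20 ≤ K) : 1000 * n ^ 2 < n ^ K := by
  have h2 := G.two_le
  calc 1000 * n ^ 2 < 2 ^ 18 * n ^ 2 := by
        have : 0 < n ^ 2 := by positivity
        omega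
    _ ≤ n ^ 18 * n ^ 2 := Nat.mul_le_mul_right _ (Nat.pow_le_pow_left h2 18)
    _ = n ^ 20 := by ring
    _ ≤ n ^ K := Nat.pow_le_pow_right (by omega) hK

theorem label_bound (G : STNetwork n) {K : ℕ} (hK : 20 ≤ K) {T : ℕ} (hT : T = (n + 1) * n) :
    ((T * (T + 1) + T) * (T + 1) + T) * (T + 1) + T < n ^ K := by
  have h2 := G.two_le
  have h3 : T + 1 ≤ n ^ 3 := by
    have h4 : 2 * (n * n) ≤ n * (n * n) := Nat.mul_le_mul_right _ h2
    have h5 : 2 * n ≤ n * n := Nat.mul_le_mul_right _ h2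
    rw [hT, show n ^ 3 = n * (n * n) by ring, Nat.succ_mul]
    omega
  calc ((T * (T + 1) + T) * (T + 1) + T) * (T + 1) + T < (T + 1) ^ 4 := by
        rw [Nat.lt_iff_add_one_le]
        apply le_of_eq
        ring
    _ ≤ (n ^ 3) ^ 4 := Nat.pow_le_pow_left h3 4
    _ = n ^ 12 := by ring
    _ ≤ n ^ K := Nat.pow_le_pow_right (by omega) (by omega)

theorem rowAddress_le (i : ℕ) (k : Fin n) (hi : i < 64) : rowAddress n i k ≤ 64 * n ^ 2 := by
  have := k.2
  have : rowAddress n i k ≤ k * n * 64 + 64 * n := by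
    unfold rowAddress
    omega
  nlinarith

theorem Record.word_le (r : Record (Fin 10) (Fin 4) n) (cut : Fin 4 → Fin n → Finset (Fin n))
    (g : ℕ) : r.word cut g ≤ 64 * n ^ 2 := by
  have hn : 1 ≤ n := r.cut.2.pos
  have h6 : ∀ p : Fin 10 × Fin n, rowAddress n (6 + p.1) p.2 ≤ 64 * n ^ 2 := fun p =>
    rowAddress_le _ _ (by omega)
  unfold Record.word
  split
  · split_ifs <;> nlinarith
  · exact rowAddress_le _ _ (by omega)
  · have := card_finset_fin_le (cut r.cut.1 r.cut.2)
    nlinarith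
  all_goals first | exact h6 _ | exact Nat.zero_le _

section oracle

variable {G : STNetwork n} {row : Fin 10 → Fin n → Fin n → ℕ}
  {cut : Fin 4 → Fin n → Finset (Fin n)} {r : Fin n → Fin n → Fin 3 → Record (Fin 10) (Fin 4) n}
  {α β : Fin n → Fin n → ℝ} {K : ℕ}

theorem intCell_le (hrow : ∀ i k x, row i k x ≤ (n + 1) * n) (a b : Fin n) (f : Fin 64) :
    G.intCell row cut r a b f ≤ 64 * n ^ 2 := by
  have hn := G.two_le
  have hm := G.card_edges_le
  unfold intCell
  split_ifs
  · nlinarith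
  · nlinarith
  · nlinarith
  · nlinarith
  · have := (G.edgeAt (a * n + b)).1.2
    nlinarith
  · have := (G.edgeAt (a * n + b)).2.2
    nlinarith
  · refine (hrow _ _ _).trans ?_
    nlinarith
  · have := ((cut (Fin.ofNat 4 (f.val - 16)) a).toList.getD b G.source).2
    nlinarith
  · exact Record.word_le _ _ _
  · exact Nat.zero_le _

theorem fitsQuadraticSpace_oracle (hK : 100 ≤ K) (hrow : ∀ i k x, row i k x ≤ (n + 1) * n)
    (hα : ∀ u v, ∃ S ⊆ G.edges, α u v = ∑ p ∈ S, G.cap p.1 p.2)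
    (hβ : ∀ u v, ∃ S ⊆ G.edges, β u v = ∑ p ∈ S, G.cap p.1 p.2) :
    (G.oracle row cut r α β).FitsQuadraticSpace G K := by
  refine ⟨?_, fun k hk => ?_, fun x hx => ?_⟩
  · simp only [oracle, length_grid]
    nlinarith
  · obtain ⟨a, b, f, rfl⟩ := exists_of_mem_grid hk
    have h1 := intCell_le (G := G) (cut := cut) (r := r) hrow a b f
    have h2 := G.pow_bound (K := K) (by omega)
    omega
  · obtain ⟨a, b, f, rfl⟩ := exists_of_mem_grid hx
    unfold realCell
    split_ifs with h1 h2 h3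
    · exact hα a b
    · exact hβ a b
    · exact ⟨{G.edgeAt (a * n + b)}, Finset.singleton_subset_iff.2 (G.edgeAt_mem h3), by simp⟩
    · exact ⟨∅, Finset.empty_subset _, by simp⟩

theorem ints_oracle (a b : Fin n) {f : ℕ} (hf : f < 64) :
    (G.oracle row cut r α β).ints[((a : ℕ) * n + b) * 64 + f]? =
      some (G.intCell row cut r a b ⟨f, hf⟩) :=
  getElem?_grid _ a b ⟨f, hf⟩

theorem reals_oracle (a b : Fin n) {f : ℕ} (hf : f < 3) :
    (G.oracle row cut r α β).reals[((a : ℕ) * n + b) * 3 + f]? =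
      some (G.realCell α β a b ⟨f, hf⟩) :=
  getElem?_grid _ a b ⟨f, hf⟩

theorem ints_oracle_word (u v : Fin n) (c : Fin 3) {g : ℕ} (hg : g < 11) :
    (G.oracle row cut r α β).ints[g + (((u : ℕ) * n + v) * 64 + 20 + 11 * c)]? =
      some ((r u v c).word cut g) := by
  have hc := c.2
  have h := ints_oracle (G := G) (row := row) (cut := cut) (r := r) (α := α) (β := β) u v
    (show 20 + 11 * (c : ℕ) + g < 64 by omega)
  rw [show g + (((u : ℕ) * n + v) * 64 + 20 + 11 * c) =
    ((u : ℕ) * n + v) * 64 + (20 + 11 * c + g) by ring, h]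
  have e1 : (20 + 11 * (c : ℕ) + g - 20) / 11 = c := by omega
  have e2 : (20 + 11 * (c : ℕ) + g - 20) % 11 = g := by omega
  have e3 : Fin.ofNat 3 (c : ℕ) = c := Fin.ext (by simp)
  simp only [intCell, e1, e2, e3]
  split_ifs <;> first | rfl | omega

theorem ints_oracle_row (i : Fin 10) (k x : Fin n) :
    (G.oracle row cut r α β).ints[rowAddress n (6 + i) k + (x : ℕ) * 64]? = some (row i k x) := by
  have hi := i.2
  have h := ints_oracle (G := G) (row := row) (cut := cut) (r := r) (α := α) (β := β) k x
    (show 6 + (i : ℕ) < 64 by omega)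
  rw [show rowAddress n (6 + i) k + (x : ℕ) * 64 = ((k : ℕ) * n + x) * 64 + (6 + i) by
    rw [rowAddress]; ring, h]
  have e1 : 6 + (i : ℕ) - 6 = i := by omega
  have e3 : Fin.ofNat 10 (i : ℕ) = i := Fin.ext (by simp)
  simp only [intCell, e1, e3]
  split_ifs <;> first | rfl | omega

theorem ints_oracle_cut (i : Fin 4) (k x : Fin n) :
    (G.oracle row cut r α β).ints[rowAddress n (16 + i) k + (x : ℕ) * 64]? =
      some (((cut i k).toList.getD x G.source : Fin n) : ℕ) := by
  have hi := i.2
  have h := ints_oracle (G := G) (row := row) (cut := cut) (r := r) (α := α) (β := β) k x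
    (show 16 + (i : ℕ) < 64 by omega)
  rw [show rowAddress n (16 + i) k + (x : ℕ) * 64 = ((k : ℕ) * n + x) * 64 + (16 + i) by
    rw [rowAddress]; ring, h]
  have e1 : 16 + (i : ℕ) - 16 = i := by omega
  have e3 : Fin.ofNat 4 (i : ℕ) = i := Fin.ext (by simp)
  simp only [intCell, e1, e3]
  split_ifs <;> first | rfl | omega

theorem header_oracle (hK : 100 ≤ K) :
    OracleProgram.Header ((G.oracle row cut r α β).machine n K) n G.edges.card ((n + 1) * n) := by
  have hn := G.two_le
  have hm := G.card_edges_le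
  have hW := G.pow_bound (K := K) (by omega)
  have h0 : 0 < n := by omega
  have h := fun f (hf : f < 64) => ints_oracle (G := G) (row := row) (cut := cut) (r := r) (α := α)
    (β := β) ⟨0, h0⟩ ⟨0, h0⟩ hf
  simp only [zero_mul, add_zero, zero_add] at h
  refine ⟨?_, ?_, ?_, ?_, fun u hu v hv => ?_, fun p hp => ?_⟩
  · exact h 0 (by norm_num)
  · exact h 1 (by norm_num)
  · exact h 2 (by norm_num)
  · exact h 3 (by norm_num)
  · change _ < n ^ K
    nlinarith
  · change _ < n ^ K
    nlinarith

theorem edgeAt_oracle {q : ℕ} (hq : q < G.edges.card) :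
    OracleProgram.EdgeAt ((G.oracle row cut r α β).machine n K) n q (G.edgeAt q).1 (G.edgeAt q).2
      (G.cap (G.edgeAt q).1 (G.edgeAt q).2) := by
  have hn := G.two_le
  have hm := G.card_edges_le
  have hq2 : q < n * n := by nlinarith
  let a : Fin n := ⟨q / n, Nat.div_lt_of_lt_mul hq2⟩
  let b : Fin n := ⟨q % n, Nat.mod_lt _ (by omega)⟩
  have hab : (a : ℕ) * n + b = q := Nat.div_add_mod' q n
  have h := fun f (hf : f < 64) => ints_oracle (G := G) (row := row) (cut := cut) (r := r) (α := α)
    (β := β) a b hf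
  have h' := reals_oracle (G := G) (row := row) (cut := cut) (r := r) (α := α)
    (β := β) a b (f := 2) (by norm_num)
  simp only [hab] at h h'
  refine ⟨(G.edgeAt q).1.2, (G.edgeAt q).2.2, ?_, ?_, ?_⟩
  · exact (h 4 (by norm_num)).trans (by simp [intCell, hab])
  · exact (h 5 (by norm_num)).trans (by simp [intCell, hab])
  · exact h'.trans (by simp [realCell, hab, hq])

/-- The pieces of the labelling of a record, as functions of natural numbers. -/
def Record.pieceNat (r : Record (Fin 10) (Fin 4) n) (row : Fin 10 → Fin n → Fin n → ℕ) (j x : ℕ) :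
    ℕ :=
  if h : j < 4 ∧ x < n then r.piece row ⟨j, h.1⟩ ⟨x, h.2⟩ else 0

theorem nodeValue_pieceNat (r : Record (Fin 10) (Fin 4) n) (row : Fin 10 → Fin n → Fin n → ℕ)
    (x : Fin n) :
    OracleProgram.nodeValue ((n + 1) * n) (r.pieceNat row) x = r.node row x := by
  simp [OracleProgram.nodeValue, Record.node, combine, Record.pieceNat]

theorem nodeTable_oracle (hK : 100 ≤ K) (u v : Fin n) (c : Fin 3)
    (hle : ∀ j x, (r u v c).piece row j x ≤ (n + 1) * n) :
    OracleProgram.NodeTable ((G.oracle row cut r α β).machine n K) n ((n + 1) * n)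
      (((u : ℕ) * n + v) * 64 + 20 + 11 * c) ((r u v c).pieceNat row) := by
  have hn := G.two_le
  have hW := G.pow_bound (K := K) (by omega)
  have hu := u.2
  have hv := v.2
  have hc := c.2
  have haddr : ∀ (p : Fin 10 × Fin n) (x : Fin n),
      rowAddress n (6 + p.1) p.2 + x * 64 < n ^ K := fun p x => by
    have h1 := rowAddress_le (n := n) (6 + p.1) p.2 (by omega)
    have h2 := x.2
    nlinarith
  refine ⟨?_, fun x hx => ?_, G.label_bound (by omega) rfl, fun j x => ?_, fun j hj x hx => ?_⟩
  · change _ < n ^ K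
    have : (u : ℕ) * n + v + 1 ≤ n * n := by nlinarith
    nlinarith
  · change _ < n ^ K
    nlinarith
  · unfold Record.pieceNat
    split_ifs
    exacts [hle _ _, Nat.zero_le _]
  · refine ⟨rowAddress n (6 + ((r u v c).mask ⟨j, hj⟩).1) ((r u v c).mask ⟨j, hj⟩).2,
      rowAddress n (6 + ((r u v c).label ⟨j, hj⟩).1) ((r u v c).label ⟨j, hj⟩).2,
      row ((r u v c).mask ⟨j, hj⟩).1 ((r u v c).mask ⟨j, hj⟩).2 ⟨x, hx⟩,
      row ((r u v c).label ⟨j, hj⟩).1 ((r u v c).label ⟨j, hj⟩).2 ⟨x, hx⟩,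
      (ints_oracle_word (α := α) (β := β) u v c (by omega)).trans ?_,
      (ints_oracle_word (α := α) (β := β) u v c (by omega)).trans ?_,
      haddr _ ⟨x, hx⟩, haddr _ ⟨x, hx⟩, ints_oracle_row (α := α) (β := β) _ _ ⟨x, hx⟩,
      ints_oracle_row (α := α) (β := β) _ _ ⟨x, hx⟩,
      by simp [Record.pieceNat, Record.piece, hj, hx]⟩
    · interval_cases j <;> rfl
    · interval_cases j <;> rfl

end oracle

end STNetwork

/-! ### The queries -/

namespace STNetwork

open OracleProgram

variable {n : ℕ} {G : STNetwork n} {row : Fin 10 → Fin n → Fin n → ℕ}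
  {cut : Fin 4 → Fin n → Finset (Fin n)} {r : Fin n → Fin n → Fin 3 → Record (Fin 10) (Fin 4) n}
  {α β : Fin n → Fin n → ℝ} {K : ℕ} {u v : Fin n} {Δ : ℝ}

theorem runs_setup_oracle (hK : 100 ≤ K) {σ : RAM.State} (hσ : IsQueryState σ u v Δ) :
    RAM.Runs ((G.oracle row cut r α β).machine n K) setup σ 30 fun τ => τ.out = [] ∧
      Ready u v n G.edges.card ((n + 1) * n)
        (((u : ℕ) * n + v) * 64 + 20 + 11 * (outcome (α u v) (β u v + Δ) : ℕ)) (α u v)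
        (β u v + Δ) Δ τ :=
  runs_setup (header_oracle hK) u.2 v.2 hσ.1 hσ.2.1 hσ.2.2.1 hσ.2.2.2
    ((reals_oracle (row := row) (cut := cut) (r := r) u v (f := 0) (by norm_num)).trans rfl)
    ((reals_oracle (row := row) (cut := cut) (r := r) u v (f := 1) (by norm_num)).trans rfl)

theorem record_address_lt (G : STNetwork n) (hK : 100 ≤ K) (u v : Fin n) (c : Fin 3) :
    ((u : ℕ) * n + v) * 64 + 20 + 11 * c + 2 < n ^ K := by
  have hn := G.two_le
  have hW := G.pow_bound (K := K) (by omega)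
  have hu := u.2
  have hv := v.2
  have hc := c.2
  have : (u : ℕ) * n + v + 1 ≤ n * n := by nlinarith
  nlinarith

theorem runs_capProg_oracle (hK : 100 ≤ K) {σ : RAM.State} (hσ : IsQueryState σ u v Δ) :
    RAM.Runs ((G.oracle row cut r α β).machine n K) capProg σ 40 fun τ => τ.out = encodeReal
      (if (r u v (outcome (α u v) (β u v + Δ))).leaves then β u v + Δ else α u v) := by
  have hW := G.record_address_lt hK u v (outcome (α u v) (β u v + Δ))
  have hk := ints_oracle_word (G := G) (row := row) (cut := cut) (r := r) (α := α) (β := β) u v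
    (outcome (α u v) (β u v + Δ)) (g := 0) (by norm_num)
  rw [zero_add] at hk
  refine RAM.Runs.seq (runs_setup_oracle hK hσ) fun τ ⟨hout, hτ⟩ =>
    (runs_capProg_of_ready hτ hout (lt_of_le_of_lt (Nat.le_add_right _ 2) hW) hk).mono le_rfl
      fun υ hυ => ?_
  rw [hυ, encodeReal]
  generalize r u v (outcome (α u v) (β u v + Δ)) = ρ
  cases hρ : ρ.leaves <;> simp [Record.word, hρ]

/-- The list of vertices in `encodeVertices` is coerced to a list of numbers as a whole; this is the
form with a coercion of each vertex. -/
theorem encodeVertices_eq (L : List (Fin n)) :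
    encodeVertices L = L.map fun v : Fin n => (Sum.inl (v : ℕ) : ℕ ⊕ ℝ) := by
  induction L with
  | nil => rfl
  | cons v L ih => simpa [encodeVertices] using ih

theorem runs_cutProg_oracle (hK : 100 ≤ K) {σ : RAM.State} (hσ : IsQueryState σ u v Δ)
    {C : Finset (Fin n)} (hC : C = cut (r u v (outcome (α u v) (β u v + Δ))).cut.1
      (r u v (outcome (α u v) (β u v + Δ))).cut.2) :
    RAM.Runs ((G.oracle row cut r α β).machine n K) cutProg σ (30 + (C.card * 5 + 8))
      fun τ => τ.out = encodeVertices C.toList := by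
  have hn := G.two_le
  have hW := G.record_address_lt hK u v (outcome (α u v) (β u v + Δ))
  have hW' := G.pow_bound (K := K) (by omega)
  have hcard := card_finset_fin_le C
  have hword := fun g (hg : g < 11) => ints_oracle_word (G := G) (row := row) (cut := cut) (r := r)
    (α := α) (β := β) u v (outcome (α u v) (β u v + Δ)) hg
  have hp := hword 1 (by norm_num)
  have hk := hword 2 (by norm_num)
  simp only [Record.word, ← hC] at hp hk
  refine RAM.Runs.seq (runs_setup_oracle hK hσ) fun τ ⟨hout, hτ⟩ =>
    (runs_cutProg_of_ready hτ hout hW hp hk ?_ (L := fun i => (C.toList.getD i G.source : Fin n))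
      fun i hi => ?_).mono le_rfl fun υ hυ => ?_
  · have := rowAddress_le (16 + ((r u v (outcome (α u v) (β u v + Δ))).cut.1 : ℕ))
      (r u v (outcome (α u v) (β u v + Δ))).cut.2 (by omega)
    change _ < n ^ K
    nlinarith
  · rw [hC]
    exact ints_oracle_cut (α := α) (β := β) _ _ ⟨i, hi.trans_le hcard⟩
  · rw [hυ, encodeVertices_eq]
    refine List.ext_getElem (by simp) fun i h1 h2 => ?_
    have h3 : i < C.toList.length := by simpa using h2
    simp [List.getElem?_eq_getElem h3]

open Classical in
/-- The arcs that `dagProg` reports, in the order in which it reports them. -/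
noncomputable def arcList (G G' : STNetwork n) (node : Fin n → ℕ) : List (ℕ × ℕ × ℝ) :=
  (G.edges.toList.filter fun p => node p.1 ≠ node p.2 ∧ 0 < G'.cap p.1 p.2).map
    (G'.labelledArc node)

theorem mem_edges {p : Fin n × Fin n} : p ∈ G.edges ↔ 0 < G.cap p.1 p.2 := by
  simp [edges]

theorem isPicardQueyranneDAG_arcList (huv : (u, v) ∈ G.edges) (h : -G.cap u v ≤ Δ)
    {node : Fin n → ℕ} (hl : IsLabelOf {C | (G.change u v Δ h).IsMincut C} node) :
    (G.change u v Δ h).IsPicardQueyranneDAG node (G.arcList (G.change u v Δ h) node) := by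
  classical
  refine isPicardQueyranneDAG_of_label _ hl.1 hl.2
    (S := G.edges.filter fun p => node p.1 ≠ node p.2 ∧ 0 < (G.change u v Δ h).cap p.1 p.2)
    (fun p => ?_) ?_
  · rw [Finset.mem_filter, and_iff_right_iff_imp]
    rintro ⟨_, hp⟩
    rw [change] at hp
    dsimp only at hp
    split_ifs at hp with he
    · rwa [show p = (u, v) from Prod.ext he.1 he.2]
    · exact mem_edges.2 hp
  · rw [arcList, Finset.filter_val, ← Finset.coe_toList, Multiset.filter_coe, Multiset.map_coe]

theorem flatMap_arcOutput (G' : STNetwork n) {node : Fin n → ℕ} {N : ℕ → ℕ}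
    (hN : ∀ x : Fin n, N x = node x) (l : List (Fin n × Fin n)) :
    (open Classical in
      ((l.filter fun p => node p.1 ≠ node p.2 ∧ 0 < G'.cap p.1 p.2).map
        (G'.labelledArc node)).flatMap fun a => [Sum.inl a.1, Sum.inl a.2.1, Sum.inr a.2.2]) =
      l.flatMap fun p => arcOutput N p.1 p.2 (G'.cap p.1 p.2) := by
  classical
  induction l with
  | nil => rfl
  | cons p l ih =>
    rw [List.flatMap_cons, ← ih, List.filter_cons, arcOutput, hN, hN]
    by_cases h1 : 0 < G'.cap p.1 p.2 <;> by_cases h2 : node p.1 = node p.2 <;>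
      by_cases h3 : node p.1 < node p.2 <;> simp [h1, h2, h3, labelledArc]

theorem runs_dagProg_oracle (hK : 100 ≤ K) {σ : RAM.State} (hσ : IsQueryState σ u v Δ)
    (h : -G.cap u v ≤ Δ) {node : Fin n → ℕ}
    (hnode : node = (r u v (outcome (α u v) (β u v + Δ))).node row)
    (hle : ∀ j x, (r u v (outcome (α u v) (β u v + Δ))).piece row j x ≤ (n + 1) * n) :
    RAM.Runs ((G.oracle row cut r α β).machine n K) dagProg σ
      (30 + (n * 62 + G.edges.card * 142 + 4))
      fun τ => τ.out = encodeDAG node (G.arcList (G.change u v Δ h) node) := by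
  have hn := G.two_le
  have hW := G.pow_bound (K := K) (by omega)
  have hval : ∀ x : Fin n, nodeValue ((n + 1) * n)
      ((r u v (outcome (α u v) (β u v + Δ))).pieceNat row) x = node x := fun x => by
    rw [nodeValue_pieceNat, hnode]
  refine RAM.Runs.seq (runs_setup_oracle hK hσ) fun τ ⟨hout, hτ⟩ =>
    (runs_dagProg_of_ready (header_oracle hK) (nodeTable_oracle hK u v _ hle) hτ hout ?_
      fun p hp => edgeAt_oracle hp).mono le_rfl fun υ hυ => ?_
  · change n < n ^ K
    nlinarith
  · rw [hυ, encodeDAG, arcList, flatMap_arcOutput _ hval, ← map_edgeAt_range, List.flatMap_map]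
    congr 1
    · refine List.ext_getElem (by simp) fun i h1 h2 => ?_
      have hi : i < n := by simpa using h2
      simp [← hval ⟨i, hi⟩]
    · refine congrArg (fun f => List.flatMap f _) (funext fun p => ?_)
      congr 1
      simp only [change, Fin.val_inj]
      split_ifs with he
      · rw [he.1, he.2]
      · rfl

theorem le_two_mul_card_edges_add (G : STNetwork n) : n ≤ 2 * G.edges.card + G.isolated.card := by
  classical
  have hsub : (Finset.univ : Finset (Fin n)) ⊆
      (G.edges.image Prod.fst ∪ G.edges.image Prod.snd) ∪ G.isolated := by
    intro x _
    by_cases hx : x ∈ G.isolated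
    · exact Finset.mem_union_right _ hx
    · refine Finset.mem_union_left _ ?_
      simp only [isolated, Finset.mem_filter, Finset.mem_univ, true_and, not_forall] at hx
      obtain ⟨p, hp, hx⟩ := hx
      by_cases h1 : p.1 = x
      · exact Finset.mem_union_left _ (Finset.mem_image.2 ⟨p, hp, h1⟩)
      · exact Finset.mem_union_right _ (Finset.mem_image.2 ⟨p, hp, by tauto⟩)
  have h1 := Finset.card_le_card hsub
  have h2 := Finset.card_union_le (G.edges.image Prod.fst ∪ G.edges.image Prod.snd) G.isolated
  have h3 := Finset.card_union_le (G.edges.image Prod.fst) (G.edges.image Prod.snd)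
  have h4 : (G.edges.image Prod.fst).card ≤ G.edges.card := Finset.card_image_le
  have h5 : (G.edges.image Prod.snd).card ≤ G.edges.card := Finset.card_image_le
  simp only [Finset.card_univ, Fintype.card_fin] at h1
  omega

theorem length_encodeDAG_arcList_le (G G' : STNetwork n) (node : Fin n → ℕ) :
    (encodeDAG node (G.arcList G' node)).length ≤ n + 3 * G.edges.card := by
  have : (G.arcList G' node).length ≤ G.edges.card := by
    rw [arcList, List.length_map]
    exact (List.length_filter_le _ _).trans (by simp)
  simp only [encodeDAG, List.length_append, List.length_ofFn, List.length_flatMap,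
    List.length_cons, List.length_nil, List.map_const', List.sum_replicate, smul_eq_mul]
  omega

/-- There is a data structure in which every query finds a record that describes its answer. -/
theorem exists_oracle (G : STNetwork n) (hK : 100 ≤ K) :
    ∃ (row : Fin 10 → Fin n → Fin n → ℕ) (cut : Fin 4 → Fin n → Finset (Fin n))
      (r : Fin n → Fin n → Fin 3 → Record (Fin 10) (Fin 4) n) (α β : Fin n → Fin n → ℝ),
      (G.oracle row cut r α β).FitsQuadraticSpace G K ∧
      ∀ u v, (u, v) ∈ G.edges → ∀ Δ (h : -G.cap u v ≤ Δ),
        (r u v (outcome (α u v) (β u v + Δ))).Describes row cut (G.change u v Δ h) (α u v)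
          (β u v + Δ) := by
  obtain ⟨row, cut, ht⟩ := G.exists_isMincutTable
  have hex : ∀ u v, ∃ (a b : ℝ) (r : Fin 3 → Record (Fin 10) (Fin 4) n),
      (∃ S ⊆ G.edges, a = ∑ p ∈ S, G.cap p.1 p.2) ∧ (∃ S ⊆ G.edges, b = ∑ p ∈ S, G.cap p.1 p.2) ∧
      ((u, v) ∈ G.edges → ∀ Δ (h : -G.cap u v ≤ Δ),
        (r (outcome a (b + Δ))).Describes row cut (G.change u v Δ h) a (b + Δ)) := by
    intro u v
    by_cases huv : (u, v) ∈ G.edges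
    · obtain ⟨a, b, r, ha, hb, hr⟩ := ht.exists_records (mem_edges.1 huv)
      exact ⟨a, b, r, ha, hb, fun _ => hr⟩
    · exact ⟨0, 0, fun _ => ⟨false, (0, u), fun _ => (0, u), fun _ => (0, u)⟩,
        ⟨∅, by simp⟩, ⟨∅, by simp⟩, fun h => absurd h huv⟩
  choose α β r hα hβ hr using hex
  exact ⟨row, cut, r, α, β, fitsQuadraticSpace_oracle hK ht.row_le hα hβ, hr⟩

end STNetwork

theorem theorem1p9 :
    ∃ (K : ℕ) (capProg cutProg dagProg : RAM.Prog),
      ∀ (n : ℕ) (G : STNetwork n), ∃ D : OracleData, D.FitsQuadraticSpace G K ∧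
        ∀ (u v : Fin n), (u, v) ∈ G.edges → ∀ (Δ : ℝ) (h : -G.cap u v ≤ Δ),
        ∀ σ : RAM.State, IsQueryState σ u v Δ →
          (∃ (k : ℕ) (C : Finset (Fin n)), (G.change u v Δ h).IsMincut C ∧ k ≤ K ∧
            D.Answers n K capProg σ k (encodeReal ((G.change u v Δ h).cutCapacity C))) ∧
          (∃ (k : ℕ) (L : List (Fin n)), L.Nodup ∧ (G.change u v Δ h).IsMincut L.toFinset ∧
            k ≤ K * L.toFinset.card ∧
            D.Answers n K cutProg σ k (encodeVertices L)) ∧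
          (∃ (k : ℕ) (node : Fin n → ℕ) (arcs : List (ℕ × ℕ × ℝ)),
            (G.change u v Δ h).IsPicardQueyranneDAG node arcs ∧
            k ≤ K * (G.edges.card + G.isolated.card) ∧
            (encodeDAG node arcs).length ≤ K * (G.edges.card + G.isolated.card) ∧
            D.Answers n K dagProg σ k (encodeDAG node arcs)) := by
  refine ⟨1000, OracleProgram.capProg, OracleProgram.cutProg, OracleProgram.dagProg,
    fun n G => ?_⟩
  obtain ⟨row, cut, r, α, β, hfit, hr⟩ := G.exists_oracle (K := 1000) (by norm_num)
  refine ⟨_, hfit, fun u v huv Δ h σ hσ => ?_⟩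
  have hd := hr u v huv Δ h
  have hm : 0 < G.edges.card := Finset.card_pos.2 ⟨_, huv⟩
  have hn := G.le_two_mul_card_edges_add
  refine ⟨?_, ?_, ?_⟩
  · obtain ⟨k, hk, τ, he, hout⟩ :=
      STNetwork.runs_capProg_oracle (row := row) (cut := cut) (by norm_num : 100 ≤ 1000) hσ
    exact ⟨k, _, hd.isMincut, by omega, τ, he, by rw [hout, hd.cutCapacity_eq]⟩
  · obtain ⟨k, hk, τ, he, hout⟩ :=
      STNetwork.runs_cutProg_oracle (G := G) (row := row) (by norm_num : 100 ≤ 1000) hσ rfl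
    refine ⟨k, _, Finset.nodup_toList _, ?_, ?_, τ, he, hout⟩
    · rw [Finset.toList_toFinset]
      exact hd.isMincut
    · have hpos := Finset.card_pos.2 ⟨_, hd.isMincut.1.1⟩
      rw [Finset.toList_toFinset]
      omega
  · obtain ⟨k, hk, τ, he, hout⟩ :=
      STNetwork.runs_dagProg_oracle (G := G) (cut := cut) (by norm_num : 100 ≤ 1000) hσ h rfl
        hd.piece_le
    refine ⟨k, _, _, STNetwork.isPicardQueyranneDAG_arcList huv h hd.isLabelOf, ?_, ?_, τ, he, hout⟩
    · omega
    · exact (G.length_encodeDAG_arcList_le _ _).trans (by omega)
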